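/- Let $\mathbf{Set}$ be the category of small sets and $\mathbf{Cat}$ the category of small categories and functors. **Globular sets.** For $n\ge 0$, an $n$-globular set $X$ consists of sets $X_k$ of $k$-cells ($0\le k\le n$) and maps $s,t\colon X_{k+1}\to X_k$ with $ss=st$ and $ts=tt$. Throughout, an $n$-globular set is given by its family of cells between prescribed objects: a $0$-globular set is a set, and an $(n+1)$-globular set $X$ consists of a set $X_0$ together with an $n$-globular set $X(x,y)$ for all $x,y\in X_0$, where $X_{k+1}=\coprod_{x,y}X(x,y)_k$. Every $n$-globular set is isomorphic to one of this form. (As for the hom-sets of a category, this convention is what makes the statements below isomorphisms of categories, and not only equivalences.) **Diagrams.** Write $\langle \ell\rangle=\{1<\dots<\ell\}$. A simple $k$-string diagram $D$ is a sequence of arbitrary maps $$\langle \ell_k\rangle\xrightarrow{v^k}\langle \ell_{k-1}\rangle\to\cdots\to\langle \ell_1\rangle\xrightarrow{v^1}\langle \ell_0\rangle=\langle 1\rangle .$$ For $k\geq 1$ its source and its target are both the truncation to dimension $k-1$. An $X$-labelling of $D$ is a choice of cells $x^m_i\in X_m$ ($0\le m\le k$, $1\le i\le \ell_m$) such that, for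 $m\ge1$, $s(x^m_i)=x^{m-1}_{v^m(i)}$ if $i$ is the least element of its fibre under $v^m$, and $s(x^m_i)=t(x^m_p)$ otherwise, where $p=\max\{j<i: v^m(j)=v^m(i)\}$. (Equivalently, a labelling is a map $\widehat D\to X$, where $\widehat D$ is the globular set obtained by attaching cells $x^m_i$ one after the other, along their sources, according to these rules.) For $k\geq 1$, the source of the labelling is its restriction to the truncation of $D$; the target is the same except that the label $x^{k-1}_i$ is replaced by $t(x^k_p)$, $p=\max (v^k)^{-1}(i)$, whenever $i\in\operatorname{im}v^k$. **The monad.** Let $T_n(X)_k$ ($k\le n$) be the set of $X$-labelled simple $k$-string diagrams. This defines an endofunctor $T_n$ of $n$-globular sets. It is a monad: the unit sends a $k$-cell $x$ to the diagram with all $\ell_m=1$ whose $k$-cell is labelled $x$. If $D$ is labelled by labelled $m$-diagrams $D^m_i$ ($0\le m\le k$, $1\le i\le\ell_m(D)$), the multiplication sends it to the diagram with levels the ordered disjoint unions $\coprod_{i=1}^{\ell_m(D)}\langle\ell_m(D^m_i)\rangle$ (the $i$-th summand preceding the $j$-th for $i<j$), with maps $$\langle\ell_m(D^m_i)\rangle\xrightarrow{v^m(D^m_i)}\langle\ell_{m-1}(D^m_i)\rangle=\langle\ell_{m-1}(D^{m-1}_{v^m(i)})\rangle$$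 and with the top-dimensional labels of the $D^m_i$. An $n$-sesquicategory is an algebra over $T_n$, and $\mathrm{Sesq}_n$ is the category of $T_n$-algebras and algebra morphisms. Let $(-)_0\colon\mathrm{Sesq}_n\to\mathbf{Set}$ be the functor taking the set of $0$-cells. **Categories with lifted hom.** Let $(\mathrm{Sesq}_{n}\mathrm{Cat})^\flat$ be the following category. An object is a pair $(\mathcal C,\underline{\mathrm{Hom}}_{\mathcal C})$ of a small category $\mathcal C$ and a functor $\underline{\mathrm{Hom}}_{\mathcal C}\colon\mathcal C^{op}\times\mathcal C\to\mathrm{Sesq}_{n}$ with $(-)_0\circ\underline{\mathrm{Hom}}_{\mathcal C}=\mathrm{Hom}_{\mathcal C}$. A morphism $(\mathcal C,\underline{\mathrm{Hom}}_{\mathcal C})\to(\mathcal D,\underline{\mathrm{Hom}}_{\mathcal D})$ is a functor $F\colon\mathcal C\to\mathcal D$ together with a natural transformation $\underline{\mathrm{Hom}}_{\mathcal C}\Rightarrow\underline{\mathrm{Hom}}_{\mathcal D}\circ(F^{op}\times F)$ whose composite with $(-)_0$ is the natural transformation $\mathrm{Hom}_{\mathcal C}\Rightarrow\mathrm{Hom}_{\mathcal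 D}\circ(F^{op}\times F)$ given by the action of $F$ on morphisms. **Theorem.** The categories $\mathrm{Sesq}_1$ and $\mathbf{Cat}$ are isomorphic. For every $n\ge 1$ the category $\mathrm{Sesq}_n$ is isomorphic to $(\mathrm{Sesq}_{n-1}\mathrm{Cat})^\flat$. -/

import Mathlib

open CategoryTheory

universe u w

namespace Sesqui

/-- An `n`-globular set: cells in each dimension `k`, none of them above dimension `n`, with source
and target maps satisfying the globularity relations. -/
structure GlobSet (n : ℕ) where
  cells : ℕ → Type u
  s : ∀ k, cells (k + 1) → cells k
  t : ∀ k, cells (k + 1) → cells k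
  ss : ∀ k (x : cells (k + 2)), s k (s (k + 1) x) = s k (t (k + 1) x)
  tt : ∀ k (x : cells (k + 2)), t k (s (k + 1) x) = t k (t (k + 1) x)
  isEmpty : ∀ k, n < k → IsEmpty (cells k)

/-- A map of globular sets. Source and target may be truncated at different dimensions, in
accordance with the extension of globular sets by the empty set. -/
@[ext]
structure GlobSet.Hom {n m : ℕ} (X : GlobSet.{u} n) (Y : GlobSet.{w} m) where
  app : ∀ k, X.cells k → Y.cells k
  app_s : ∀ k x, app k (X.s k x) = Y.s k (app (k + 1) x)
  app_t : ∀ k x, app k (X.t k x) = Y.t k (app (k + 1) x)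

instance (n : ℕ) : Category.{u} (GlobSet.{u} n) where
  Hom X Y := GlobSet.Hom X Y
  id X := ⟨fun _ x => x, fun _ _ => rfl, fun _ _ => rfl⟩
  comp f g := ⟨fun k x => g.app k (f.app k x),
    fun k x => by rw [f.app_s, g.app_s], fun k x => by rw [f.app_t, g.app_t]⟩

theorem GlobSet.hom_ext {n : ℕ} {X Y : GlobSet.{u} n} {f g : X ⟶ Y}
    (h : ∀ k x, f.app k x = g.app k x) : f = g :=
  GlobSet.Hom.ext (funext fun k => funext (h k))

theorem GlobSet.comp_app {n : ℕ} {X Y Z : GlobSet.{u} n} (f : X ⟶ Y) (g : Y ⟶ Z) (k : ℕ)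
    (x : X.cells k) : (f ≫ g).app k x = g.app k (f.app k x) := rfl

theorem GlobSet.id_app {n : ℕ} {X : GlobSet.{u} n} (k : ℕ) (x : X.cells k) :
    GlobSet.Hom.app (𝟙 X) k x = x := rfl

/-- The iterated source of a cell. -/
def GlobSet.iterS {n : ℕ} (X : GlobSet.{u} n) {k : ℕ} (x : X.cells k) (m : ℕ) (h : m ≤ k) :
    X.cells m :=
  Nat.decreasingInduction (motive := fun m _ => X.cells m) (fun m _ y => X.s m y) x h

theorem GlobSet.iterS_self {n : ℕ} (X : GlobSet.{u} n) {k : ℕ} (x : X.cells k) :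
    X.iterS x k le_rfl = x := by
  simp [GlobSet.iterS]

theorem GlobSet.s_iterS {n : ℕ} (X : GlobSet.{u} n) {k : ℕ} (x : X.cells k) (m : ℕ)
    (h : m + 1 ≤ k) : X.s m (X.iterS x (m + 1) h) = X.iterS x m (Nat.le_of_succ_le h) := by
  unfold GlobSet.iterS
  rw [Nat.decreasingInduction_succ_left (motive := fun m _ => X.cells m) _ _ h]

theorem GlobSet.iterS_s {n : ℕ} (X : GlobSet.{u} n) {k : ℕ} (x : X.cells (k + 1)) (m : ℕ)
    (h : m ≤ k) : X.iterS (X.s k x) m h = X.iterS x m (h.trans k.le_succ) := by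
  induction h using Nat.decreasingInduction with
  | self => rw [iterS_self, ← X.s_iterS x k le_rfl, iterS_self]
  | of_succ m h ih => rw [← X.s_iterS _ _ h, ih, X.s_iterS]

theorem GlobSet.iterS_t {n : ℕ} (X : GlobSet.{u} n) {k : ℕ} (x : X.cells (k + 1)) (m : ℕ)
    (h : m < k) : X.iterS (X.t k x) m h.le = X.iterS x m (h.le.trans k.le_succ) := by
  obtain ⟨k, rfl⟩ : ∃ j, k = j + 1 := ⟨k - 1, by omega⟩
  rw [← X.iterS_s x m h.le, ← X.iterS_s _ m (by omega), ← X.iterS_s _ m (by omega), X.ss]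

theorem GlobSet.Hom.app_iterS {n : ℕ} {X Y : GlobSet.{u} n} (f : GlobSet.Hom X Y) {k : ℕ}
    (x : X.cells k) (m : ℕ) (h : m ≤ k) :
    f.app m (X.iterS x m h) = Y.iterS (f.app k x) m h := by
  induction h using Nat.decreasingInduction with
  | self => simp [GlobSet.iterS_self]
  | of_succ m h ih => rw [← X.s_iterS _ _ h, f.app_s, ih, Y.s_iterS]

/-- A simple `k`-string diagram `⟨ℓ_k⟩ → ⋯ → ⟨ℓ_1⟩ → ⟨ℓ_0⟩ = ⟨1⟩`: arbitrary (not necessarily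
order preserving) maps between the finite ordinals `Fin (len m)`. -/
structure Diagram (k : ℕ) where
  len : ∀ m, m ≤ k → ℕ
  v : ∀ m (h : m + 1 ≤ k), Fin (len (m + 1) h) → Fin (len m (Nat.le_of_succ_le h))
  len_zero : len 0 (Nat.zero_le k) = 1

/-- Truncation of a diagram to dimension `j`. -/
def Diagram.trunc {k : ℕ} (D : Diagram k) (j : ℕ) (hj : j ≤ k) : Diagram j where
  len m h := D.len m (h.trans hj)
  v m h := D.v m (h.trans hj)
  len_zero := D.len_zero

section SlotCell

variable {A B : Type} {Y Z : Type*} [LinearOrder A]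

/-- Cells `x a` (`a : A`) are attached one after the other, `x a` on top of the slot `v a`. After
the attachments indexed by `S`, the slot `q` carries the cell `c`: this is the initial
cell `y q` if nothing has been attached to `q`, and the target of the last cell attached to `q`
otherwise. -/
def IsSlotCell (t : Z → Y) (v : A → B) (x : A → Z) (y : B → Y) (S : Set A) (q : B) (c : Y) : Prop :=
  ((∀ a ∈ S, v a ≠ q) ∧ c = y q) ∨ ∃ p, IsGreatest {a | a ∈ S ∧ v a = q} p ∧ c = t (x p)

open Classical in
/-- The cell carried by the slot `q` after all the attachments. -/
noncomputable def finalCell (t : Z → Y) (v : A → B) (x : A → Z) (y : B → Y) (q : B) : Y :=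
  if h : ∃ p, IsGreatest {a | v a = q} p then t (x h.choose) else y q

variable {t : Z → Y} {v : A → B} {x : A → Z} {y : B → Y} {S : Set A} {q : B} {c : Y}

theorem finalCell_pos (h : ∃ p, IsGreatest {a | v a = q} p) :
    finalCell t v x y q = t (x h.choose) := dif_pos h

theorem finalCell_neg (h : ¬ ∃ p, IsGreatest {a | v a = q} p) :
    finalCell t v x y q = y q := dif_neg h

theorem exists_isGreatest_or [Finite A] (v : A → B) (S : Set A) (q : B) :
    (∀ a ∈ S, v a ≠ q) ∨ ∃ p, IsGreatest {a | a ∈ S ∧ v a = q} p := by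
  by_cases h : ∀ a ∈ S, v a ≠ q
  · exact Or.inl h
  · push Not at h
    obtain ⟨a, ha, hq⟩ := h
    have hf : {a | a ∈ S ∧ v a = q}.Finite := Set.toFinite _
    exact Or.inr (hf.exists_maximal ⟨a, ha, hq⟩ |>.imp fun p hp =>
      ⟨hp.1, fun b hb => not_lt.1 fun h => hp.not_gt hb h⟩)

theorem IsSlotCell.unique {c' : Y} (h : IsSlotCell t v x y S q c)
    (h' : IsSlotCell t v x y S q c') : c = c' := by
  rcases h with ⟨h, rfl⟩ | ⟨p, h, rfl⟩ <;> rcases h' with ⟨h', rfl⟩ | ⟨p', h', rfl⟩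
  · rfl
  · exact absurd h'.1.2 (h _ h'.1.1)
  · exact absurd h.1.2 (h' _ h.1.1)
  · rw [h.unique h']

theorem finalCell_spec [Finite A] (t : Z → Y) (v : A → B) (x : A → Z) (y : B → Y) (q : B) :
    IsSlotCell t v x y Set.univ q (finalCell t v x y q) := by
  unfold finalCell
  split_ifs with h
  · exact Or.inr ⟨h.choose, by simpa using h.choose_spec, rfl⟩
  · refine Or.inl ⟨fun a ha hq => h ?_, rfl⟩
    rcases exists_isGreatest_or v Set.univ q with h' | h'
    · exact absurd hq (h' a ha)
    · simpa using h'

/-- Enlarging the set of attachments without touching the slot. -/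
theorem IsSlotCell.extend {S' : Set A} (h : IsSlotCell t v x y S q c) (hS : S ⊆ S')
    (hS' : ∀ a ∈ S', v a = q → a ∈ S) : IsSlotCell t v x y S' q c := by
  rcases h with ⟨h, hc⟩ | ⟨p, h, hc⟩
  · exact Or.inl ⟨fun a ha hq => h a (hS' a ha hq) hq, hc⟩
  · exact Or.inr ⟨p, ⟨⟨hS h.1.1, h.1.2⟩, fun a ha => h.2 ⟨hS' a ha.1 ha.2, ha.2⟩⟩, hc⟩

theorem IsSlotCell.map {Y' Z' : Type*} {t' : Z' → Y'} {f : Y → Y'} {g : Z → Z'}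
    (hfg : ∀ z, f (t z) = t' (g z)) (h : IsSlotCell t v x y S q c) :
    IsSlotCell t' v (fun a => g (x a)) (fun b => f (y b)) S q (f c) := by
  rcases h with ⟨h, rfl⟩ | ⟨p, h, rfl⟩
  · exact Or.inl ⟨h, rfl⟩
  · exact Or.inr ⟨p, h, hfg _⟩

end SlotCell

/-- An `X`-labelling of a simple string diagram. The cell `x m i` is attached to the `m`-dimensional
data after all the cells `x m j`, `j < i`: its source is `x (m-1) (v i)` if `i` is the first
element of its fibre, and the target of the previous element of the fibre otherwise. -/
@[ext]
structure Labelling {k n : ℕ} (D : Diagram k) (X : GlobSet.{u} n) where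
  x : ∀ m (h : m ≤ k), Fin (D.len m h) → X.cells m
  src : ∀ m (h : m + 1 ≤ k) (i : Fin (D.len (m + 1) h)),
    IsSlotCell (X.t m) (D.v m h) (x (m + 1) h) (x m (Nat.le_of_succ_le h)) (Set.Iio i) (D.v m h i)
      (X.s m (x (m + 1) h i))

/-- A labelled simple `k`-string diagram. -/
structure LDiagram (k : ℕ) {n : ℕ} (X : GlobSet.{u} n) where
  shape : Diagram k
  lab : Labelling shape X

namespace LDiagram

variable {n k : ℕ} {X Y Z : GlobSet.{u} n}

/-- A labelled diagram is determined by its isomorphism class. -/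
theorem eq_of_iso {d e : LDiagram k X}
    (f : ∀ m (h : m ≤ k), Fin (d.shape.len m h) → Fin (e.shape.len m h))
    (mono : ∀ m h, StrictMono (f m h)) (surj : ∀ m h, Function.Surjective (f m h))
    (hv : ∀ m h i, f m _ (d.shape.v m h i) = e.shape.v m h (f (m + 1) h i))
    (hx : ∀ m h i, d.lab.x m h i = e.lab.x m h (f m h i)) : d = e := by
  obtain ⟨⟨l, v, h0⟩, ⟨x, hs⟩⟩ := d
  obtain ⟨⟨l', v', h0'⟩, ⟨x', hs'⟩⟩ := e
  obtain rfl : l = l' := by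
    funext m h
    simpa using Fintype.card_congr (Equiv.ofBijective (f m h) ⟨(mono m h).injective, surj m h⟩)
  have hf : ∀ m h i, f m h i = i := fun m h i => by
    have : (mono m h).orderIsoOfSurjective _ (surj m h) = OrderIso.refl _ := Subsingleton.elim _ _
    exact congrArg (fun g => g i) this
  simp only [hf] at hv hx
  obtain rfl : v = v' := by funext m h i; exact hv m h i
  obtain rfl : x = x' := by funext m h i; exact hx m h i
  rfl

/-- The source of a cell and its target are parallel to the cell in the slot it is attached to. -/
theorem parallel_aux (d : LDiagram k X) (m : ℕ) (h : m + 2 ≤ k) (i : Fin (d.shape.len (m + 2) h)) :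
    X.s m (X.s (m + 1) (d.lab.x _ h i)) = X.s m (d.lab.x (m + 1) _ (d.shape.v _ h i)) ∧
      X.t m (X.s (m + 1) (d.lab.x _ h i)) = X.t m (d.lab.x (m + 1) _ (d.shape.v _ h i)) := by
  induction i using WellFoundedLT.induction with
  | ind i ih =>
    rcases d.lab.src _ h i with ⟨-, hc⟩ | ⟨p, hp, hc⟩
    · rw [hc]; exact ⟨rfl, rfl⟩
    · rw [hc, ← X.ss, ← X.tt, (ih p hp.1.1).1, (ih p hp.1.1).2, hp.1.2]; exact ⟨rfl, rfl⟩

theorem parallel (d : LDiagram k X) (m : ℕ) (h : m + 2 ≤ k) {S q c}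
    (hc : IsSlotCell (X.t _) (d.shape.v _ h) (d.lab.x _ h) (d.lab.x (m + 1) _) S q c) :
    X.s m c = X.s m (d.lab.x (m + 1) _ q) ∧ X.t m c = X.t m (d.lab.x (m + 1) _ q) := by
  rcases hc with ⟨-, rfl⟩ | ⟨p, hp, rfl⟩
  · exact ⟨rfl, rfl⟩
  · rw [← X.ss, ← X.tt, (d.parallel_aux _ h p).1, (d.parallel_aux _ h p).2, hp.1.2]
    exact ⟨rfl, rfl⟩

/-- Restriction of the labelling to the truncated diagram. -/
def trunc (d : LDiagram k X) (j : ℕ) (hj : j ≤ k) : LDiagram j X where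
  shape := d.shape.trunc j hj
  lab := ⟨fun m h => d.lab.x m (h.trans hj), fun m h => d.lab.src m (h.trans hj)⟩

/-- The source of a labelled diagram: restriction along the inclusion of the truncated diagram. -/
def source (d : LDiagram (k + 1) X) : LDiagram k X := d.trunc k k.le_succ

/-- The labels of the target: in dimension `k` one takes the target of the last cell
attached to each slot. -/
noncomputable def targetLabel (d : LDiagram (k + 1) X) (m : ℕ) (h : m ≤ k)
    (i : Fin (d.shape.len m (h.trans k.le_succ))) : X.cells m :=
  if m = k then
    finalCell (X.t m) (d.shape.v m (Nat.succ_le_succ h)) (d.lab.x (m + 1) (Nat.succ_le_succ h))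
      (d.lab.x m (h.trans k.le_succ)) i
  else d.lab.x m _ i

theorem targetLabel_lt (d : LDiagram (k + 1) X) (m : ℕ) (h : m < k) (i) :
    d.targetLabel m h.le i = d.lab.x m _ i := if_neg h.ne

theorem targetLabel_self (d : LDiagram (k + 1) X) (i) :
    d.targetLabel k le_rfl i = finalCell (X.t k) (d.shape.v k le_rfl) (d.lab.x (k + 1) le_rfl)
      (d.lab.x k k.le_succ) i := if_pos rfl

theorem targetLabel_parallel (d : LDiagram (k + 1) X) (m : ℕ) (h : m + 1 ≤ k) (i) :
    X.s m (d.targetLabel (m + 1) h i) = X.s m (d.lab.x (m + 1) (h.trans k.le_succ) i) ∧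
    X.t m (d.targetLabel (m + 1) h i) = X.t m (d.lab.x (m + 1) (h.trans k.le_succ) i) := by
  unfold targetLabel
  split_ifs
  · exact d.parallel m (Nat.succ_le_succ h) (finalCell_spec _ _ _ _ _)
  · exact ⟨rfl, rfl⟩

/-- The target of a labelled diagram. -/
noncomputable def target (d : LDiagram (k + 1) X) : LDiagram k X where
  shape := d.shape.trunc k k.le_succ
  lab := ⟨d.targetLabel, fun m h i => by
    rw [(d.targetLabel_parallel m h i).1]
    have hy : d.targetLabel m (Nat.le_of_succ_le h) = d.lab.x m _ :=
      funext fun j => d.targetLabel_lt m h j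
    rw [hy]
    rcases d.lab.src m (h.trans k.le_succ) i with hc | ⟨p, hp, hc⟩
    · exact Or.inl hc
    · exact Or.inr ⟨p, hp, hc.trans (d.targetLabel_parallel m h p).2.symm⟩⟩

theorem eq_of_shape {D : Diagram k} {l l' : Labelling D X} (h : ∀ m h i, l.x m h i = l'.x m h i) :
    LDiagram.mk D l = ⟨D, l'⟩ := by
  congr 1
  exact Labelling.ext (funext fun m => funext fun hm => funext fun i => h m hm i)

theorem source_target (d : LDiagram (k + 2) X) : d.target.source = d.source.source :=
  eq_of_shape fun m h i => d.targetLabel_lt m (Nat.lt_succ_of_le h) i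

theorem target_target (d : LDiagram (k + 2) X) : d.target.target = d.source.target := by
  refine eq_of_shape fun m h i => ?_
  rcases h.lt_or_eq with h' | rfl
  · exact (targetLabel_lt d.target m h' i).trans ((d.targetLabel_lt m (Nat.lt_succ_of_lt h') i).trans
      (targetLabel_lt d.source m h' i).symm)
  · refine (targetLabel_self d.target i).trans (Eq.trans ?_ (targetLabel_self d.source i).symm)
    have hy : d.target.lab.x m m.le_succ = d.source.lab.x m m.le_succ :=
      funext fun j => d.targetLabel_lt m m.lt_succ_self j
    rw [hy]
    by_cases hp : ∃ p, IsGreatest {a | d.source.shape.v m le_rfl a = i} p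
    · exact (finalCell_pos hp).trans
        ((d.targetLabel_parallel m le_rfl _).2.trans (finalCell_pos hp).symm)
    · exact (finalCell_neg hp).trans (finalCell_neg hp).symm

/-- The action of a map of globular sets on labels. -/
def map (f : X ⟶ Y) (d : LDiagram k X) : LDiagram k Y where
  shape := d.shape
  lab := ⟨fun m h i => f.app m (d.lab.x m h i), fun m h i => by
    have := (d.lab.src m h i).map (f.app_t m)
    rwa [f.app_s] at this⟩

theorem map_source (f : X ⟶ Y) (d : LDiagram (k + 1) X) : (d.map f).source = d.source.map f := rfl

theorem map_target (f : X ⟶ Y) (d : LDiagram (k + 1) X) : (d.map f).target = d.target.map f := by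
  refine eq_of_shape fun m h i => ?_
  change (d.map f).targetLabel m h i = f.app m (d.targetLabel m h i)
  unfold targetLabel
  split_ifs
  · exact (finalCell_spec _ _ _ _ _).unique
      ((finalCell_spec (X.t m) _ _ _ _).map (f := f.app m) (g := f.app (m + 1)) (f.app_t m))
  · rfl

end LDiagram

/-- The functor `T` on objects: the `k`-cells of `T X` are the `X`-labelled simple `k`-string
diagrams, `k ≤ n`. -/
noncomputable def TObj {n : ℕ} (X : GlobSet.{u} n) : GlobSet.{u} n where
  cells k := {_d : LDiagram k X // k ≤ n}
  s k d := ⟨d.1.source, k.le_succ.trans d.2⟩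
  t k d := ⟨d.1.target, k.le_succ.trans d.2⟩
  ss _ d := Subtype.ext d.1.source_target.symm
  tt _ d := Subtype.ext d.1.target_target.symm
  isEmpty _ hk := ⟨fun d => absurd d.2 (not_le.2 hk)⟩

/-- The functor `T` on morphisms: apply the map to all labels. -/
noncomputable def TMap {n : ℕ} {X Y : GlobSet.{u} n} (f : X ⟶ Y) : TObj X ⟶ TObj Y where
  app _ d := ⟨d.1.map f, d.2⟩
  app_s _ _ := rfl
  app_t _ d := Subtype.ext (d.1.map_target f).symm

/-- The diagram `((1), …, (1))` all of whose levels are singletons. -/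
def Diagram.one (k : ℕ) : Diagram k where
  len _ _ := 1
  v _ _ i := i
  len_zero := rfl

/-- The diagram `((1), …, (1))` with its `k`-cell labelled by `x`. -/
def LDiagram.unit {n k : ℕ} {X : GlobSet.{u} n} (x : X.cells k) : LDiagram k X where
  shape := Diagram.one k
  lab := ⟨fun m h _ => X.iterS x m h, fun m h i =>
    Or.inl ⟨fun j hj => absurd hj (by
      rw [show j = i from Subsingleton.elim (α := Fin 1) j i]; exact lt_irrefl i),
      X.s_iterS x m h⟩⟩

theorem LDiagram.unit_target {n k : ℕ} {X : GlobSet.{u} n} (x : X.cells (k + 1)) :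
    (LDiagram.unit x).target = LDiagram.unit (X.t k x) := by
  refine LDiagram.eq_of_shape (D := Diagram.one k) fun m h i => ?_
  rcases h.lt_or_eq with h' | rfl
  · exact ((LDiagram.unit x).targetLabel_lt m h' i).trans (X.iterS_t x m h').symm
  · refine ((LDiagram.unit x).targetLabel_self i).trans ?_
    have hp : ∃ p, IsGreatest {a | (LDiagram.unit x).shape.v m le_rfl a = i} p :=
      ⟨i, rfl, fun j _ => (Subsingleton.elim (α := Fin 1) j i).le⟩
    refine (finalCell_pos hp).trans ?_
    change X.t m (X.iterS x (m + 1) le_rfl) = X.iterS (X.t m x) m le_rfl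
    rw [X.iterS_self, X.iterS_self]

/-- The unique order isomorphism between `{1, …, s 1 + ⋯ + s l}` and the ordered disjoint
union of the ordinals `{1, …, s i}`. -/
noncomputable def sumIso {l : ℕ} (s : Fin l → ℕ) :
    Fin (∑ i, s i) ≃o _root_.Lex (Σ i : Fin l, Fin (s i)) :=
  Fintype.orderIsoFinOfCardEq _ ((Fintype.card_sigma).trans (by simp))

theorem sumIso_symm_val {l l' : ℕ} {s : Fin l → ℕ} {s' : Fin l' → ℕ} (hl : l = l')
    (hs : ∀ i, s i = s' (Fin.cast hl i)) {i : Fin l} {j : Fin (s i)} {i' : Fin l'}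
    {j' : Fin (s' i')} (hi : i.val = i'.val) (hj : j.val = j'.val) :
    ((sumIso s).symm (toLex ⟨i, j⟩)).val = ((sumIso s').symm (toLex ⟨i', j'⟩)).val := by
  subst hl
  obtain rfl : s = s' := funext hs
  obtain rfl : i = i' := Fin.ext hi
  obtain rfl : j = j' := Fin.ext hj
  rfl

section

variable {n k : ℕ} {X Y : GlobSet.{u} n}

namespace LDiagram

/-- In a diagram labelled by labelled diagrams, the label of the `i`-th cell at level `m`. -/
abbrev block (d : LDiagram k (TObj X)) (m : ℕ) (h : m ≤ k) (i : Fin (d.shape.len m h)) :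
    LDiagram m X := (d.lab.x m h i).1

/-- The number of `m`-cells of the label of the `i`-th cell at level `m`. -/
abbrev size (d : LDiagram k (TObj X)) (m : ℕ) (h : m ≤ k) (i : Fin (d.shape.len m h)) : ℕ :=
  (d.block m h i).shape.len m le_rfl

/-- The disjoint union of the top levels of the labels at level `m`, where the elements of the
`i`-th component come before those of the `j`-th component for `i < j`. -/
abbrev Level (d : LDiagram k (TObj X)) (m : ℕ) (h : m ≤ k) : Type :=
  _root_.Lex (Σ i : Fin (d.shape.len m h), Fin (d.size m h i))

/-- The unique order isomorphism of `Level` with a finite ordinal. -/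
noncomputable def levelIso (d : LDiagram k (TObj X)) (m : ℕ) (h : m ≤ k) :
    Fin (∑ i, d.size m h i) ≃o d.Level m h :=
  sumIso (d.size m h)

/-- The slot cells of a diagram labelled by diagrams all have the shape of the slot. -/
theorem shape_slot_aux (d : LDiagram k (TObj X)) (m : ℕ) (h : m + 1 ≤ k)
    (i : Fin (d.shape.len (m + 1) h)) :
    (d.block (m + 1) h i).shape.trunc m m.le_succ = (d.block m _ (d.shape.v m h i)).shape := by
  induction i using WellFoundedLT.induction with
  | ind i ih =>
    rcases d.lab.src _ h i with ⟨-, hc⟩ | ⟨p, hp, hc⟩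
    · exact congrArg (fun c => c.1.shape) hc
    · have h1 := congrArg (fun c => c.1.shape) hc
      have h2 := ih p hp.1.1
      rw [hp.1.2] at h2
      exact h1.trans h2

theorem size_eq (d : LDiagram k (TObj X)) (m : ℕ) (h : m + 1 ≤ k)
    (i : Fin (d.shape.len (m + 1) h)) :
    (d.block (m + 1) h i).shape.len m m.le_succ = d.size m _ (d.shape.v m h i) :=
  congrArg (fun D : Diagram m => D.len m le_rfl) (d.shape_slot_aux m h i)

/-- The maps between the levels of the composite, induced by the maps of the labels. -/
def levelMap (d : LDiagram k (TObj X)) (m : ℕ) (h : m + 1 ≤ k) (a : d.Level (m + 1) h) :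
    d.Level m (Nat.le_of_succ_le h) :=
  toLex ⟨d.shape.v m h a.1, Fin.cast (d.size_eq m h a.1)
    ((d.block (m + 1) h a.1).shape.v m le_rfl a.2)⟩

/-- The composite of a diagram labelled by diagrams. -/
noncomputable def compShape (d : LDiagram k (TObj X)) : Diagram k where
  len m h := ∑ i, d.size m h i
  v m h p := (d.levelIso m _).symm (d.levelMap m h (d.levelIso (m + 1) h p))
  len_zero := by
    have h1 := d.shape.len_zero
    have : ∀ i, d.size 0 (Nat.zero_le k) i = 1 := fun i => (d.block 0 _ i).shape.len_zero
    simp [this, h1]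

/-- The label of an element of a level of the composite. -/
def levelLabel (d : LDiagram k (TObj X)) (m : ℕ) (h : m ≤ k) (a : d.Level m h) : X.cells m :=
  (d.block m h a.1).lab.x m le_rfl a.2

theorem trunc_lab_eq {m : ℕ} {d e : LDiagram m X} (h : d = e) (j : ℕ) (hj : j ≤ m)
    (r : Fin (d.shape.len j hj)) :
    d.lab.x j hj r = e.lab.x j hj (Fin.cast (by rw [h]) r) := by
  subst h; rfl

theorem levelMap_eq_iff (d : LDiagram k (TObj X)) (m : ℕ) (h : m + 1 ≤ k)
    (i : Fin (d.shape.len (m + 1) h)) (j : Fin (d.size (m + 1) h i))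
    (r : Fin (d.size m (Nat.le_of_succ_le h) (d.shape.v m h i))) :
    d.levelMap m h (toLex ⟨i, j⟩) = toLex ⟨d.shape.v m h i, r⟩ ↔
      ((d.block (m + 1) h i).shape.v m le_rfl j).val = r.val := by
  constructor
  · intro e
    have := eq_of_heq (Sigma.mk.inj (toLex.injective e)).2
    exact congrArg Fin.val this
  · intro e
    refine congrArg toLex (Sigma.ext rfl (heq_of_eq (Fin.ext e)))

theorem level_slot_aux (d : LDiagram k (TObj X)) (m : ℕ) (h : m + 1 ≤ k)
    (S : Set (Fin (d.shape.len (m + 1) h))) (hS : IsLowerSet S)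
    (ih : ∀ p ∈ S, ∀ (r : Fin (d.size m _ (d.shape.v m h p)))
      (r' : Fin ((d.block (m + 1) h p).shape.len m m.le_succ)) (_ : r'.val = r.val),
      IsSlotCell (X.t m) (d.levelMap m h) (d.levelLabel (m + 1) h) (d.levelLabel m _)
        {a : d.Level (m + 1) h | a.1 ∈ Set.Iio p} (toLex ⟨d.shape.v m h p, r⟩)
        ((d.block (m + 1) h p).lab.x m m.le_succ r'))
    (b : Fin (d.shape.len m (Nat.le_of_succ_le h))) (c : (TObj X).cells m)
    (hc : IsSlotCell ((TObj X).t m) (d.shape.v m h) (d.lab.x (m + 1) h) (d.lab.x m _) S b c)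
    (r : Fin (d.size m _ b)) (r' : Fin (c.1.shape.len m le_rfl)) (hr : r'.val = r.val) :
    IsSlotCell (X.t m) (d.levelMap m h) (d.levelLabel (m + 1) h) (d.levelLabel m _)
      {a : d.Level (m + 1) h | a.1 ∈ S} (toLex ⟨b, r⟩) (c.1.lab.x m le_rfl r') := by
  rcases hc with ⟨hne, rfl⟩ | ⟨p, hp, rfl⟩
  · obtain rfl : r' = r := Fin.ext hr
    exact Or.inl ⟨fun a ha hv => hne a.1 ha (congrArg Sigma.fst hv), rfl⟩
  · obtain ⟨⟨hpS, rfl⟩, hmax⟩ := hp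
    specialize ih p hpS r r' hr
    have hle : ∀ a : d.Level (m + 1) h, a.1 ∈ S →
        d.levelMap m h a = toLex ⟨d.shape.v m h p, r⟩ → a.1 ≤ p := fun a ha hv =>
      hmax ⟨ha, congrArg Sigma.fst hv⟩
    by_cases hq : ∃ q, IsGreatest {j | (d.block (m + 1) h p).shape.v m le_rfl j = r'} q
    · have e1 : ((TObj X).t m (d.lab.x (m + 1) h p)).1.lab.x m le_rfl r' =
          X.t m ((d.block (m + 1) h p).lab.x (m + 1) le_rfl hq.choose) :=
        ((d.block (m + 1) h p).targetLabel_self r').trans (finalCell_pos hq)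
      rw [e1]
      refine Or.inr ⟨toLex ⟨p, hq.choose⟩, ⟨⟨hpS, ?_⟩, ?_⟩, rfl⟩
      · rw [levelMap_eq_iff, hq.choose_spec.1, hr]
      · rintro a ⟨haS, hv⟩
        rcases (hle a haS hv).lt_or_eq with hlt | heq
        · exact Sigma.Lex.left _ _ hlt
        · obtain ⟨i, j⟩ := a
          obtain rfl : i = p := heq
          refine Sigma.Lex.right _ _ (hq.choose_spec.2 ?_)
          have := (d.levelMap_eq_iff m h i j r).1 hv
          exact Fin.ext (this.trans hr.symm)
    · have e1 : ((TObj X).t m (d.lab.x (m + 1) h p)).1.lab.x m le_rfl r' =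
          (d.block (m + 1) h p).lab.x m m.le_succ r' :=
        ((d.block (m + 1) h p).targetLabel_self r').trans (finalCell_neg hq)
      rw [e1]
      refine ih.extend (fun a ha => hS (le_of_lt ha) hpS) fun a haS hv => ?_
      rcases (hle a haS hv).lt_or_eq with hlt | heq
      · exact hlt
      · exfalso
        obtain ⟨i, j⟩ := a
        obtain rfl : i = p := heq
        have hj := (d.levelMap_eq_iff m h i j r).1 hv
        rcases exists_isGreatest_or ((d.block (m + 1) h i).shape.v m le_rfl) Set.univ r'
          with h' | ⟨q, h'⟩
        · exact h' j trivial (Fin.ext (hj.trans hr.symm))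
        · exact hq ⟨q, by simpa using h'⟩

/-- Slots of the composite: after all the blocks indexed by a lower set `S` have been
attached, the slot `(b, r)` carries the `r`-th label of the diagram which is carried by `b`. -/
theorem level_slot (d : LDiagram k (TObj X)) (m : ℕ) (h : m + 1 ≤ k)
    (S : Set (Fin (d.shape.len (m + 1) h))) (hS : IsLowerSet S)
    (b : Fin (d.shape.len m (Nat.le_of_succ_le h))) (c : (TObj X).cells m)
    (hc : IsSlotCell ((TObj X).t m) (d.shape.v m h) (d.lab.x (m + 1) h) (d.lab.x m _) S b c)
    (r : Fin (d.size m _ b)) (r' : Fin (c.1.shape.len m le_rfl)) (hr : r'.val = r.val) :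
    IsSlotCell (X.t m) (d.levelMap m h) (d.levelLabel (m + 1) h) (d.levelLabel m _)
      {a : d.Level (m + 1) h | a.1 ∈ S} (toLex ⟨b, r⟩) (c.1.lab.x m le_rfl r') := by
  refine d.level_slot_aux m h S hS (fun p hp => ?_) b c hc r r' hr
  clear hp
  induction p using WellFoundedLT.induction with
  | ind p ih =>
    intro r r' hr
    exact d.level_slot_aux m h (Set.Iio p) (isLowerSet_Iio p) (fun q hq => ih q hq) _ _
      (d.lab.src m h p) r r' hr

theorem level_src (d : LDiagram k (TObj X)) (m : ℕ) (h : m + 1 ≤ k) (a : d.Level (m + 1) h) :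
    IsSlotCell (X.t m) (d.levelMap m h) (d.levelLabel (m + 1) h) (d.levelLabel m _)
      (Set.Iio a) (d.levelMap m h a) (X.s m (d.levelLabel (m + 1) h a)) := by
  obtain ⟨i, j⟩ := a
  set e := d.block (m + 1) h i with he
  have h1 := d.level_slot m h (Set.Iio i) (isLowerSet_Iio i) _ _ (d.lab.src m h i)
    (Fin.cast (d.size_eq m h i) (e.shape.v m le_rfl j)) (e.shape.v m le_rfl j) rfl
  change IsSlotCell (X.t m) (d.levelMap m h) (d.levelLabel (m + 1) h) (d.levelLabel m _)
      {a : d.Level (m + 1) h | a.1 ∈ Set.Iio i} (d.levelMap m h (toLex ⟨i, j⟩))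
      (e.lab.x m m.le_succ (e.shape.v m le_rfl j)) at h1
  change IsSlotCell (X.t m) (d.levelMap m h) (d.levelLabel (m + 1) h) (d.levelLabel m _)
      (Set.Iio (toLex ⟨i, j⟩)) (d.levelMap m h (toLex ⟨i, j⟩)) (X.s m (e.lab.x (m + 1) le_rfl j))
  have hv : ∀ j', d.levelMap m h (toLex ⟨i, j'⟩) = d.levelMap m h (toLex ⟨i, j⟩) ↔
      e.shape.v m le_rfl j' = e.shape.v m le_rfl j := fun j' =>
    (d.levelMap_eq_iff m h i j' _).trans Fin.ext_iff.symm
  rcases e.lab.src m le_rfl j with ⟨hne, hc⟩ | ⟨p, hp, hc⟩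
  · rw [hc]
    refine h1.extend (fun a ha => Sigma.Lex.left _ _ ha) ?_
    rintro ⟨i', j'⟩ ha hva
    rcases Sigma.lex_iff.1 ha with hlt | ⟨heq, hlt⟩
    · exact hlt
    · obtain rfl : i' = i := heq
      exact absurd ((hv j').1 hva) (hne j' hlt)
  · rw [hc]
    refine Or.inr ⟨toLex ⟨i, p⟩, ⟨⟨Sigma.Lex.right _ _ hp.1.1, (hv p).2 hp.1.2⟩, ?_⟩, rfl⟩
    rintro ⟨i', j'⟩ ⟨ha, hva⟩
    rcases Sigma.lex_iff.1 ha with hlt | ⟨heq, hlt⟩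
    · exact Sigma.Lex.left _ _ hlt
    · obtain rfl : i' = i := heq
      exact Sigma.Lex.right _ _ (hp.2 ⟨hlt, (hv j').1 hva⟩)

end LDiagram

/-- Reindexing along an order isomorphism of the attached cells. -/
theorem IsSlotCell.reindex {A A' B B' : Type} {Y Z : Type*} [LinearOrder A] [LinearOrder A']
    {t : Z → Y} {v : A → B} {x : A → Z} {y : B → Y} {S : Set A} {q : B} {c : Y}
    (f : A' ≃o A) (g : B' ≃ B) (hc : IsSlotCell t v x y S q c) :
    IsSlotCell t (fun a => g.symm (v (f a))) (fun a => x (f a)) (fun b => y (g b)) (f ⁻¹' S)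
      (g.symm q) c := by
  rcases hc with ⟨h, rfl⟩ | ⟨p, h, rfl⟩
  · exact Or.inl ⟨fun a ha hq => h _ ha (g.symm.injective hq), by simp⟩
  · refine Or.inr ⟨f.symm p, ⟨⟨by simpa using h.1.1, by simpa using h.1.2⟩, fun a ha => ?_⟩,
      by simp⟩
    rw [f.le_symm_apply]
    exact h.2 ⟨ha.1, g.symm.injective ha.2⟩

namespace LDiagram

/-- The composite of a diagram labelled by labelled diagrams: every cell is replaced by
the diagram which labels it. -/
noncomputable def comp (d : LDiagram k (TObj X)) : LDiagram k X where
  shape := d.compShape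
  lab := ⟨fun m h p => d.levelLabel m h (d.levelIso m h p), fun m h i => by
    have := (d.level_src m h (d.levelIso (m + 1) h i)).reindex (d.levelIso (m + 1) h)
      (d.levelIso m _).toEquiv
    rwa [show (d.levelIso (m + 1) h) ⁻¹' Set.Iio (d.levelIso (m + 1) h i) = Set.Iio i from
      Set.ext fun j => (d.levelIso (m + 1) h).lt_iff_lt] at this⟩

/-- Description of the cells of the composite in terms of `Level`. -/
theorem comp_eq_of_level {d : LDiagram k (TObj X)} {e : LDiagram k X}
    (f : ∀ m (h : m ≤ k), d.Level m h → Fin (e.shape.len m h))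
    (mono : ∀ m h, StrictMono (f m h)) (surj : ∀ m h, Function.Surjective (f m h))
    (hv : ∀ m h a, f m _ (d.levelMap m h a) = e.shape.v m h (f (m + 1) h a))
    (hx : ∀ m h a, d.levelLabel m h a = e.lab.x m h (f m h a)) : d.comp = e := by
  refine eq_of_iso (fun m h p => f m h (d.levelIso m h p))
    (fun m h => (mono m h).comp (d.levelIso m h).strictMono)
    (fun m h => (surj m h).comp (d.levelIso m h).surjective) (fun m h i => ?_)
    (fun m h i => hx m h _)
  change f m _ (d.levelIso m _ ((d.levelIso m _).symm _)) = _
  rw [OrderIso.apply_symm_apply, hv]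

theorem comp_source (d : LDiagram (k + 1) (TObj X)) : d.comp.source = d.source.comp := rfl

theorem comp_map (f : X ⟶ Y) (d : LDiagram k (TObj X)) :
    (d.map (TMap f)).comp = d.comp.map f := rfl

theorem shape_slot (d : LDiagram k (TObj X)) (m : ℕ) (h : m + 1 ≤ k) {S q}
    {c : (TObj X).cells m}
    (hc : IsSlotCell ((TObj X).t m) (d.shape.v m h) (d.lab.x (m + 1) h) (d.lab.x m _) S q c) :
    c.1.shape = (d.block m (Nat.le_of_succ_le h) q).shape := by
  rcases hc with ⟨-, rfl⟩ | ⟨p, hp, rfl⟩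
  · rfl
  · have := d.shape_slot_aux m h p
    rw [hp.1.2] at this
    exact this

theorem target_block_shape (d : LDiagram (k + 1) (TObj X)) (m : ℕ) (h : m ≤ k)
    (i : Fin (d.target.shape.len m h)) :
    (d.target.block m h i).shape = (d.block m (h.trans k.le_succ) i).shape := by
  rcases h.lt_or_eq with h' | rfl
  · exact congrArg (fun c => c.1.shape) (d.targetLabel_lt m h' i)
  · refine (congrArg (fun c => c.1.shape) (d.targetLabel_self i)).trans ?_
    exact d.shape_slot m le_rfl (finalCell_spec _ _ _ _ i)

theorem shape_v_eq {D D' : Diagram k} (h : D = D') (m : ℕ) (hm : m + 1 ≤ k)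
    (i : Fin (D.len (m + 1) hm)) :
    (D.v m hm i).val = (D'.v m hm (Fin.cast (by rw [h]) i)).val := by
  subst h; rfl

theorem level_ext {d : LDiagram k (TObj X)} {m : ℕ} {h : m ≤ k} {i : Fin (d.shape.len m h)}
    {r r' : Fin (d.size m h i)} (hr : r.val = r'.val) :
    (toLex ⟨i, r⟩ : d.Level m h) = toLex ⟨i, r'⟩ := by
  rw [Fin.ext hr]

theorem comp_target (d : LDiagram (k + 1) (TObj X)) : d.comp.target = d.target.comp := by
  symm
  have hsz : ∀ m h i, d.target.size m h i = d.size m (h.trans k.le_succ) i := fun m h i =>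
    congrArg (fun D : Diagram m => D.len m le_rfl) (d.target_block_shape m h i)
  have hlab : ∀ m (h : m ≤ k) (a : d.target.Level m h),
      d.target.levelLabel m h a = d.comp.targetLabel m h
        ((d.levelIso m _).symm (toLex ⟨a.1, Fin.cast (hsz m h a.1) a.2⟩)) := by
    rintro m h ⟨i, r⟩
    rcases h.lt_or_eq with h' | rfl
    · refine Eq.trans ?_ (d.comp.targetLabel_lt m h' _).symm
      change (d.target.block m h i).lab.x m le_rfl r = d.levelLabel m _ (d.levelIso m _ _)
      rw [OrderIso.apply_symm_apply]
      exact trunc_lab_eq (congrArg Subtype.val (d.targetLabel_lt m h' i)) m le_rfl r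
    · refine Eq.trans ?_ (d.comp.targetLabel_self _).symm
      have h1 := d.level_slot m le_rfl Set.univ isLowerSet_univ i _ (finalCell_spec _ _ _ _ i)
        (Fin.cast (hsz m le_rfl i) r)
        (Fin.cast (congrArg (fun c => c.1.shape.len m le_rfl) (d.targetLabel_self i)) r) rfl
      have h2 := h1.reindex (d.levelIso (m + 1) le_rfl) (d.levelIso m m.le_succ).toEquiv
      refine Eq.trans ?_ (h2.unique (finalCell_spec _ _ _ _ _))
      exact trunc_lab_eq (congrArg Subtype.val (d.targetLabel_self i)) m le_rfl r
  refine comp_eq_of_level (fun m h a => (d.levelIso m (h.trans k.le_succ)).symm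
      (toLex ⟨a.1, Fin.cast (hsz m h a.1) a.2⟩)) ?_ ?_ ?_ hlab
  · rintro m h ⟨i, r⟩ ⟨i', r'⟩ hlt
    refine (d.levelIso m _).symm.strictMono ?_
    rcases Sigma.lex_iff.1 hlt with hlt | ⟨heq, hlt⟩
    · exact Sigma.Lex.left _ _ hlt
    · obtain rfl : i = i' := heq
      exact Sigma.Lex.right _ _ hlt
  · intro m h p
    refine ⟨toLex ⟨(d.levelIso m (h.trans k.le_succ) p).1,
      Fin.cast (hsz m h _).symm (d.levelIso m (h.trans k.le_succ) p).2⟩, ?_⟩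
    exact (d.levelIso m _).symm_apply_apply p
  · rintro m h ⟨i, r⟩
    change _ = (d.levelIso m _).symm (d.levelMap m _ (d.levelIso (m + 1) _
      ((d.levelIso (m + 1) _).symm _)))
    rw [OrderIso.apply_symm_apply]
    congr 1
    exact level_ext (shape_v_eq (d.target_block_shape (m + 1) h i) m le_rfl r)

theorem iterS_TObj (d : (TObj X).cells k) (m : ℕ) (h : m ≤ k) :
    ((TObj X).iterS d m h).1 = d.1.trunc m h := by
  induction h using Nat.decreasingInduction with
  | self => rw [GlobSet.iterS_self]; rfl
  | of_succ m h ih =>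
    rw [← (TObj X).s_iterS d m h]
    change ((TObj X).iterS d (m + 1) h).1.source = _
    rw [ih]
    rfl

theorem comp_unit (d : LDiagram k X) (hk : k ≤ n) :
    (unit (X := TObj X) ⟨d, hk⟩).comp = d := by
  have hb : ∀ m h i, (unit (X := TObj X) ⟨d, hk⟩).block m h i = d.trunc m h := fun m h _ =>
    iterS_TObj (X := X) ⟨d, hk⟩ m h
  have hs : ∀ m h i, (unit (X := TObj X) ⟨d, hk⟩).size m h i = d.shape.len m h := fun m h i =>
    congrArg (fun e : LDiagram m X => e.shape.len m le_rfl) (hb m h i)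
  refine comp_eq_of_level (fun m h a => Fin.cast (hs m h a.1) a.2) ?_ ?_ ?_ ?_
  · rintro m h ⟨i, r⟩ ⟨i', r'⟩ hlt
    obtain rfl : i = i' := Subsingleton.elim (α := Fin 1) i i'
    rcases Sigma.lex_iff.1 hlt with hlt | ⟨heq, hlt⟩
    · exact absurd hlt (lt_irrefl i)
    · exact hlt
  · intro m h r
    exact ⟨toLex ⟨(0 : Fin 1), Fin.cast (hs m h (0 : Fin 1)).symm r⟩, rfl⟩
  · rintro m h ⟨i, r⟩
    exact Fin.ext (shape_v_eq (congrArg LDiagram.shape (hb (m + 1) h i)) m le_rfl r)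
  · rintro m h ⟨i, r⟩
    exact trunc_lab_eq (hb m h i) m le_rfl r

end LDiagram

/-- The unit of the monad: a cell labels the diagram `((1), …, (1))`. -/
noncomputable def TUnit (X : GlobSet.{u} n) : X ⟶ TObj X where
  app k x := ⟨LDiagram.unit x, not_lt.1 fun h => (X.isEmpty k h).false x⟩
  app_s k x := Subtype.ext (LDiagram.eq_of_shape (D := Diagram.one k)
    fun m h _ => X.iterS_s x m h)
  app_t _ x := Subtype.ext (LDiagram.unit_target x).symm

/-- The multiplication of the monad: composition of diagrams labelled by diagrams. -/
noncomputable def TMult (X : GlobSet.{u} n) : TObj (TObj X) ⟶ TObj X where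
  app _ d := ⟨d.1.comp, d.2⟩
  app_s _ d := Subtype.ext d.1.comp_source.symm
  app_t _ d := Subtype.ext d.1.comp_target.symm

namespace LDiagram

theorem comp_map_unit (d : LDiagram k X) : (d.map (TUnit X)).comp = d := by
  refine comp_eq_of_level (fun m h a => a.1) ?_ ?_ ?_ ?_
  · rintro m h ⟨i, r⟩ ⟨i', r'⟩ hlt
    rcases Sigma.lex_iff.1 hlt with hlt | ⟨heq, hlt⟩
    · exact hlt
    · obtain rfl : i = i' := heq
      obtain rfl : r = r' := Subsingleton.elim (α := Fin 1) r r'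
      exact absurd hlt (lt_irrefl r)
  · intro m h r
    exact ⟨toLex ⟨r, (0 : Fin 1)⟩, rfl⟩
  · rintro m h ⟨i, r⟩
    rfl
  · rintro m h ⟨i, r⟩
    exact X.iterS_self _

/-- The shape of a diagram labelled by diagrams, together with the shapes of its labels. -/
def skeleton (d : LDiagram k (TObj X)) :
    Σ D : Diagram k, ∀ m (h : m ≤ k), Fin (D.len m h) → Diagram m :=
  ⟨d.shape, fun m h i => (d.block m h i).shape⟩

theorem skeleton_target (d : LDiagram (k + 1) (TObj X)) :
    d.target.skeleton = d.source.skeleton := by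
  refine Sigma.ext rfl (heq_of_eq ?_)
  funext m h i
  exact d.target_block_shape m h i

theorem skeleton_slot (d : LDiagram k (TObj (TObj X))) (m : ℕ) (h : m + 1 ≤ k)
    (i : Fin (d.shape.len (m + 1) h)) :
    (d.block (m + 1) h i).source.skeleton = (d.block m _ (d.shape.v m h i)).skeleton := by
  induction i using WellFoundedLT.induction with
  | ind i ih =>
    rcases d.lab.src _ h i with ⟨-, hc⟩ | ⟨p, hp, hc⟩
    · exact congrArg (fun c => c.1.skeleton) hc
    · have h1 := congrArg (fun c => c.1.skeleton) hc
      have h2 := ih p hp.1.1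
      rw [hp.1.2] at h2
      exact h1.trans ((d.block (m + 1) h p).skeleton_target.trans h2)

theorem size_skeleton {d e : LDiagram k (TObj X)} (hs : d.skeleton = e.skeleton) (m : ℕ)
    (h : m ≤ k) : ∃ hl : d.shape.len m h = e.shape.len m h,
      ∀ i, d.size m h i = e.size m h (Fin.cast hl i) := by
  have key : ∀ S S' : Σ D : Diagram k, ∀ m (h : m ≤ k), Fin (D.len m h) → Diagram m, S = S' →
      ∃ hl : S.1.len m h = S'.1.len m h,
        ∀ i, (S.2 m h i).len m le_rfl = (S'.2 m h (Fin.cast hl i)).len m le_rfl := by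
    rintro S _ rfl
    exact ⟨rfl, fun _ => rfl⟩
  exact key _ _ hs

theorem comp_comp (d : LDiagram k (TObj (TObj X))) :
    d.comp.comp = (d.map (TMult X)).comp := by
  set e := d.map (TMult X) with he
  let g : ∀ m (h : m ≤ k) (a : d.Level m h), Fin ((d.block m h a.1).size m le_rfl a.2) →
      e.Level m h := fun m h a t =>
    toLex ⟨a.1, ((d.block m h a.1).levelIso m le_rfl).symm (toLex ⟨a.2, t⟩)⟩
  have g_eq : ∀ m h a a' t t', a = a' → t.val = t'.val → g m h a t = g m h a' t' := by
    rintro m h a _ t t' rfl ht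
    rw [Fin.ext ht]
  have g_lt : ∀ m h a a' t t', a < a' → g m h a t < g m h a' t' := by
    rintro m h ⟨i, j⟩ ⟨i', j'⟩ t t' hlt
    rcases Sigma.lex_iff.1 hlt with hlt | ⟨heq, hlt⟩
    · exact Sigma.Lex.left _ _ hlt
    · obtain rfl : i = i' := heq
      refine Sigma.Lex.right _ _ (((d.block m h i).levelIso m le_rfl).symm.strictMono ?_)
      exact Sigma.Lex.left _ _ hlt
  have g_map : ∀ m (h : m + 1 ≤ k) (a : d.Level (m + 1) h) t t',
      t'.val = (((d.block (m + 1) h a.1).block (m + 1) le_rfl a.2).shape.v m le_rfl t).val →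
      g m _ (d.levelMap m h a) t' = e.levelMap m h (g (m + 1) h a t) := by
    rintro m h ⟨i, j⟩ t t' ht
    refine level_ext (d := e) (m := m) ?_
    change _ = ((d.block (m + 1) h i).comp.shape.v m le_rfl
      (((d.block (m + 1) h i).levelIso (m + 1) le_rfl).symm (toLex ⟨j, t⟩))).val
    obtain ⟨hl, hs⟩ := size_skeleton (d.skeleton_slot m h i) m le_rfl
    refine (sumIso_symm_val hl hs ?_ ?_).symm.trans (congrArg Fin.val (congrArg
      ((d.block (m + 1) h i).levelIso m m.le_succ).symm
      (congrArg ((d.block (m + 1) h i).levelMap m le_rfl)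
        (OrderIso.apply_symm_apply ((d.block (m + 1) h i).levelIso (m + 1) le_rfl)
          (toLex ⟨j, t⟩)).symm)))
    · rfl
    · exact ht.symm
  refine comp_eq_of_level (fun m h a => (e.levelIso m h).symm (g m h (d.levelIso m h a.1) a.2))
    ?_ ?_ ?_ ?_
  · rintro m h ⟨p, t⟩ ⟨p', t'⟩ hlt
    refine (e.levelIso m h).symm.strictMono ?_
    rcases Sigma.lex_iff.1 hlt with hlt | ⟨heq, hlt⟩
    · exact g_lt m h _ _ _ _ ((d.levelIso m h).strictMono hlt)
    · obtain rfl : p = p' := heq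
      refine Sigma.Lex.right _ _ (((d.block m h _).levelIso m le_rfl).symm.strictMono ?_)
      exact Sigma.Lex.right _ _ hlt
  · intro m h r
    obtain ⟨⟨i, q⟩, rfl⟩ := (e.levelIso m h).symm.surjective r
    obtain ⟨⟨j, t⟩, rfl⟩ := ((d.block m h i).levelIso m le_rfl).symm.surjective q
    obtain ⟨p, hp⟩ := (d.levelIso m h).surjective (toLex ⟨i, j⟩)
    have hsz : d.comp.size m h p = (d.block m h i).size m le_rfl j :=
      congrArg (fun a : d.Level m h => (d.block m h a.1).size m le_rfl a.2) hp
    refine ⟨toLex ⟨p, Fin.cast hsz.symm t⟩, congrArg _ ?_⟩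
    exact g_eq m h _ (toLex ⟨i, j⟩) _ t hp rfl
  · rintro m h ⟨p, t⟩
    change _ = (e.levelIso m _).symm (e.levelMap m h (e.levelIso (m + 1) h
      ((e.levelIso (m + 1) h).symm _)))
    rw [OrderIso.apply_symm_apply]
    refine congrArg _ ?_
    have hp : d.levelIso m (Nat.le_of_succ_le h) ((d.levelIso m _).symm
      (d.levelMap m h (d.levelIso (m + 1) h p))) = d.levelMap m h (d.levelIso (m + 1) h p) :=
      OrderIso.apply_symm_apply _ _
    have hsz := congrArg (fun a : d.Level m _ => (d.block m _ a.1).size m le_rfl a.2) hp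
    refine (g_eq m _ _ _ _ (Fin.cast hsz _) hp rfl).trans (g_map m h _ t _ rfl)
  · rintro m h ⟨p, t⟩
    change _ = e.levelLabel m h (e.levelIso m h ((e.levelIso m h).symm _))
    rw [OrderIso.apply_symm_apply]
    exact (congrArg ((d.block m h (d.levelIso m h p).1).levelLabel m le_rfl)
      (OrderIso.apply_symm_apply ((d.block m h (d.levelIso m h p).1).levelIso m le_rfl)
        (toLex ⟨(d.levelIso m h p).2, t⟩))).symm

end LDiagram

end

/-- The monad `T` on `n`-globular sets whose operations are encoded by simple string diagrams. -/
noncomputable def T (n : ℕ) : Monad (GlobSet.{u} n) where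
  obj X := TObj X
  map f := TMap f
  map_id _ := rfl
  map_comp _ _ := rfl
  η := {
    app X := TUnit X
    naturality _ _ f := GlobSet.hom_ext fun k x => Subtype.ext
      (LDiagram.eq_of_shape (D := Diagram.one k) fun m h _ => (f.app_iterS x m h).symm) }
  μ := {
    app X := TMult X
    naturality _ _ f := GlobSet.hom_ext fun _ d => Subtype.ext (d.1.comp_map f) }
  assoc _ := GlobSet.hom_ext fun _ d => Subtype.ext d.1.comp_comp.symm
  left_unit _ := GlobSet.hom_ext fun _ d => Subtype.ext (d.1.comp_unit d.2)
  right_unit _ := GlobSet.hom_ext fun _ d => Subtype.ext d.1.comp_map_unit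

section Realization

variable {k : ℕ}

open Classical in
/-- The cell of `Diagram.hat` to which the source of the `i`-th cell of dimension `m + 1`
is attached. -/
noncomputable def Diagram.attach (D : Diagram k) (m : ℕ) (h : m + 1 ≤ k)
    (i : Fin (D.len (m + 1) h)) :
    (Σ' h : m ≤ k, Fin (D.len m h)) ⊕ (Σ' h : m + 1 ≤ k, Fin (D.len (m + 1) h)) :=
  if hp : ∃ p, IsGreatest {j | j ∈ Set.Iio i ∧ D.v m h j = D.v m h i} p then
    Sum.inr ⟨h, hp.choose⟩
  else Sum.inl ⟨Nat.le_of_succ_le h, D.v m h i⟩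

theorem Diagram.attach_spec (D : Diagram k) (m : ℕ) (h : m + 1 ≤ k)
    (i : Fin (D.len (m + 1) h)) :
    ((∀ j ∈ Set.Iio i, D.v m h j ≠ D.v m h i) ∧
      D.attach m h i = Sum.inl ⟨Nat.le_of_succ_le h, D.v m h i⟩) ∨
    ∃ p, IsGreatest {j | j ∈ Set.Iio i ∧ D.v m h j = D.v m h i} p ∧
      D.attach m h i = Sum.inr ⟨h, p⟩ := by
  by_cases hp : ∃ p, IsGreatest {j | j ∈ Set.Iio i ∧ D.v m h j = D.v m h i} p
  · exact Or.inr ⟨hp.choose, hp.choose_spec, dif_pos hp⟩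
  · refine Or.inl ⟨?_, dif_neg hp⟩
    rcases exists_isGreatest_or (D.v m h) (Set.Iio i) (D.v m h i) with h' | h'
    · exact h'
    · exact absurd h' hp

/-- The globular set of a simple string diagram, with its cells listed explicitly: attaching
an `m`-cell along its source adds a new `m`-cell (`Sum.inl`) and its target (`Sum.inr`). -/
noncomputable def Diagram.hat (D : Diagram k) : GlobSet.{0} k where
  cells m := (Σ' h : m ≤ k, Fin (D.len m h)) ⊕ (Σ' h : m + 1 ≤ k, Fin (D.len (m + 1) h))
  s m := Sum.elim (fun c => D.attach m c.1 c.2)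
    (fun c => D.attach m (Nat.le_of_succ_le c.1) (D.v (m + 1) c.1 c.2))
  t m := Sum.elim (fun c => Sum.inr c)
    (fun c => Sum.inr ⟨Nat.le_of_succ_le c.1, D.v (m + 1) c.1 c.2⟩)
  ss m c := by
    rcases c with ⟨h, i⟩ | ⟨h, i⟩
    · rcases D.attach_spec _ h i with ⟨-, e⟩ | ⟨p, hp, e⟩
      · simp [e]
      · simp [e, hp.1.2]
    · rcases D.attach_spec _ (Nat.le_of_succ_le h) (D.v _ h i) with ⟨-, e⟩ | ⟨p, hp, e⟩
      · simp [e]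
      · simp [e, hp.1.2]
  tt m c := by
    rcases c with ⟨h, i⟩ | ⟨h, i⟩
    · rcases D.attach_spec _ h i with ⟨-, e⟩ | ⟨p, hp, e⟩
      · simp [e]
      · simp [e, hp.1.2]
    · rcases D.attach_spec _ (Nat.le_of_succ_le h) (D.v _ h i) with ⟨-, e⟩ | ⟨p, hp, e⟩
      · simp [e]
      · simp [e, hp.1.2]
  isEmpty m hm := ⟨by rintro (⟨h, -⟩ | ⟨h, -⟩) <;> omega⟩

/-- An `X`-labelling of `D` is the same thing as a map of globular sets from `D.hat` to `X`. -/
noncomputable def Labelling.equivHom {n : ℕ} (D : Diagram k) (X : GlobSet.{u} n) :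
    Labelling D X ≃ GlobSet.Hom D.hat X where
  toFun l :=
    have hs : ∀ m h i, Sum.elim (fun c => l.x m c.1 c.2) (fun c => X.t m (l.x (m + 1) c.1 c.2))
        (D.attach m h i) = X.s m (l.x (m + 1) h i) := fun m h i => by
      refine IsSlotCell.unique ?_ (l.src m h i)
      rcases D.attach_spec m h i with ⟨hn, e⟩ | ⟨p, hp, e⟩
      · exact Or.inl ⟨hn, by rw [e]; rfl⟩
      · exact Or.inr ⟨p, hp, by rw [e]; rfl⟩
    { app m := Sum.elim (fun c => l.x m c.1 c.2) (fun c => X.t m (l.x (m + 1) c.1 c.2))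
      app_s m c := by
        rcases c with ⟨h, i⟩ | ⟨h, i⟩
        · exact hs m h i
        · refine (hs m _ _).trans ?_
          have := ((LDiagram.mk D l).parallel_aux m h i).1
          exact this.symm.trans (X.ss _ _)
      app_t m c := by
        rcases c with ⟨h, i⟩ | ⟨h, i⟩
        · rfl
        · have := ((LDiagram.mk D l).parallel_aux m h i).2
          exact this.symm.trans (X.tt _ _) }
  invFun f :=
    { x m h i := f.app m (Sum.inl ⟨h, i⟩)
      src m h i := by
        have hs : f.app m (D.attach m h i) = X.s m (f.app (m + 1) (Sum.inl ⟨h, i⟩)) :=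
          f.app_s m (Sum.inl ⟨h, i⟩)
        rw [← hs]
        rcases D.attach_spec m h i with ⟨hn, e⟩ | ⟨p, hp, e⟩
        · exact Or.inl ⟨hn, by rw [e]⟩
        · exact Or.inr ⟨p, hp, by rw [e]; exact f.app_t m (Sum.inl ⟨h, p⟩)⟩ }
  left_inv l := rfl
  right_inv f := by
    refine GlobSet.Hom.ext (funext fun m => funext fun c => ?_)
    rcases c with ⟨h, i⟩ | ⟨h, i⟩
    · rfl
    · exact (f.app_t m (Sum.inl ⟨h, i⟩)).symm

end Realization

/-- Globular sets presented by families: an `(n+1)`-globular set is a type of objects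
together with an `n`-globular set for every pair of objects. Every globular set is isomorphic to
one of this form (`Family.totalOfGlobSet`). In this presentation `X` is literally recovered
from its objects and the globular sets of cells between two objects, just as the morphisms of a
category are given by a family of hom types. -/
def Family : ℕ → Type (u + 1)
  | 0 => Type u
  | n + 1 => Σ V : Type u, V → V → Family n

namespace Family

/-- The `k`-cells of the globular set presented by a family. -/
def cells : ∀ {n : ℕ}, Family.{u} n → ℕ → Type u
  | 0, V, 0 => V
  | 0, _, _ + 1 => PEmpty
  | _ + 1, X, 0 => X.1
  | _ + 1, X, k + 1 => Σ x y : X.1, cells (X.2 x y) k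

/-- The source map. -/
def s : ∀ {n : ℕ} (X : Family.{u} n) (k : ℕ), X.cells (k + 1) → X.cells k
  | 0, _, _, z => PEmpty.elim z
  | _ + 1, _, 0, z => z.1
  | _ + 1, X, k + 1, z => ⟨z.1, z.2.1, s (X.2 z.1 z.2.1) k z.2.2⟩

/-- The target map. -/
def t : ∀ {n : ℕ} (X : Family.{u} n) (k : ℕ), X.cells (k + 1) → X.cells k
  | 0, _, _, z => PEmpty.elim z
  | _ + 1, _, 0, z => z.2.1
  | _ + 1, X, k + 1, z => ⟨z.1, z.2.1, t (X.2 z.1 z.2.1) k z.2.2⟩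

theorem ss : ∀ {n : ℕ} (X : Family.{u} n) (k : ℕ) (z : X.cells (k + 2)),
    X.s k (X.s (k + 1) z) = X.s k (X.t (k + 1) z)
  | 0, _, _, z => PEmpty.elim z
  | _ + 1, _, 0, _ => rfl
  | _ + 1, X, k + 1, z => congrArg
      (fun w => (⟨z.1, z.2.1, w⟩ : Σ x y : X.1, cells (X.2 x y) k)) (ss (X.2 z.1 z.2.1) k z.2.2)

theorem tt : ∀ {n : ℕ} (X : Family.{u} n) (k : ℕ) (z : X.cells (k + 2)),
    X.t k (X.s (k + 1) z) = X.t k (X.t (k + 1) z)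
  | 0, _, _, z => PEmpty.elim z
  | _ + 1, _, 0, _ => rfl
  | _ + 1, X, k + 1, z => congrArg
      (fun w => (⟨z.1, z.2.1, w⟩ : Σ x y : X.1, cells (X.2 x y) k)) (tt (X.2 z.1 z.2.1) k z.2.2)

theorem isEmpty : ∀ {n : ℕ} (X : Family.{u} n) (k : ℕ), n < k → IsEmpty (X.cells k)
  | _, _, 0, h => absurd h (Nat.not_lt_zero _)
  | 0, _, _ + 1, _ => inferInstanceAs (IsEmpty PEmpty)
  | _ + 1, X, k + 1, h => ⟨fun z =>
      (isEmpty (X.2 z.1 z.2.1) k (Nat.lt_of_succ_lt_succ h)).false z.2.2⟩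

/-- The globular set presented by a family. -/
def total {n : ℕ} (X : Family.{u} n) : GlobSet.{u} n := ⟨X.cells, X.s, X.t, X.ss, X.tt, X.isEmpty⟩

end Family

/-- An `n`-sesquicategory: an `n`-globular set, presented by its family of cells between given
objects, with the structure of an algebra over the monad `T n`. With the morphisms below this is
equivalent to the Eilenberg-Moore category of `T n`, see `Sesq.comparison`. -/
structure Sesq (n : ℕ) where
  fam : Family.{u} n
  act : (T n).obj fam.total ⟶ fam.total
  unit : (T n).η.app fam.total ≫ act = 𝟙 fam.total
  assoc : (T n).μ.app fam.total ≫ act = (T n).map act ≫ act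

/-- The underlying algebra. -/
noncomputable def Sesq.toAlgebra {n : ℕ} (A : Sesq.{u} n) : (T.{u} n).Algebra :=
  ⟨A.fam.total, A.act, A.unit, A.assoc⟩

/-- Morphisms of `n`-sesquicategories are the morphisms of algebras. -/
noncomputable instance (n : ℕ) : Category.{u} (Sesq.{u} n) where
  Hom A B := A.toAlgebra ⟶ B.toAlgebra
  id A := 𝟙 A.toAlgebra
  comp f g := CategoryStruct.comp (obj := (T.{u} n).Algebra) f g
  id_comp f := Category.id_comp (obj := (T.{u} n).Algebra) f
  comp_id f := Category.comp_id (obj := (T.{u} n).Algebra) f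
  assoc f g h := Category.assoc (obj := (T.{u} n).Algebra) f g h

/-- The functor taking an `n`-sesquicategory to its set of objects. -/
noncomputable def objects (n : ℕ) : Sesq.{u} n ⥤ Type u where
  obj A := A.fam.total.cells 0
  map f := TypeCat.ofHom (f.f.app 0)

/-- A functor `F : C ⥤ D` acts on morphisms by a natural transformation of hom functors. -/
def homMap {C D : Type u} [Category.{u} C] [Category.{u} D] (F : C ⥤ D) :
    Functor.hom C ⟶ F.op.prod F ⋙ Functor.hom D where
  app _ := TypeCat.ofHom fun f => F.map f
  naturality _ _ g := by
    ext f
    exact (F.map_comp _ _).trans (congrArg _ (F.map_comp _ _))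

/-- A small category with a lift of its hom functor (a strict equality of functors) through
`objects n : Sesq n ⥤ Type`. These are the objects of the category `(Sesq_n Cat)^♭`. -/
structure SesqCat (n : ℕ) where
  C : Type u
  [cat : Category.{u} C]
  hom : Cᵒᵖ × C ⥤ Sesq.{u} n
  lift : hom ⋙ objects n = Functor.hom C

attribute [instance] SesqCat.cat

namespace SesqCat

variable {n : ℕ}

/-- A functor together with a natural transformation between the lifted hom functors, which
becomes the action of the functor on morphisms after passing to sets of objects. -/
structure Hom (A B : SesqCat.{u} n) where
  F : A.C ⥤ B.C
  trans : A.hom ⟶ F.op.prod F ⋙ B.hom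
  compat : Functor.whiskerRight trans (objects n) ≫
      eqToHom (congrArg (fun H => F.op.prod F ⋙ H) B.lift) = eqToHom A.lift ≫ homMap F

theorem Hom.ext {A B : SesqCat.{u} n} {f g : Hom A B} (h : f.F = g.F)
    (h' : HEq f.trans g.trans) : f = g := by
  obtain ⟨F, τ, _⟩ := f
  obtain ⟨G, σ, _⟩ := g
  obtain rfl : F = G := h
  obtain rfl : τ = σ := eq_of_heq h'
  rfl

theorem Hom.compat_app {A B : SesqCat.{u} n} (f : Hom A B) (p : A.Cᵒᵖ × A.C) :
    (objects n).map (f.trans.app p) ≫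
      eqToHom (congrArg (fun H => H.obj ((f.F.op.prod f.F).obj p)) B.lift) =
    eqToHom (congrArg (fun H => H.obj p) A.lift) ≫ (homMap f.F).app p := by
  have h := congrArg (fun τ => τ.app p) f.compat
  simp only [NatTrans.comp_app, eqToHom_app] at h
  exact h

/-- The identity morphism. -/
noncomputable def Hom.id (A : SesqCat.{u} n) : Hom A A where
  F := 𝟭 A.C
  trans := 𝟙 A.hom
  compat := by
    apply NatTrans.ext
    funext p
    rw [NatTrans.comp_app, NatTrans.comp_app, eqToHom_app]
    have h1 : (objects n).map (𝟙 (A.hom.obj p)) = 𝟙 _ := (objects n).map_id _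
    have h2 : (homMap (𝟭 A.C)).app p = 𝟙 ((Functor.hom A.C).obj p) := rfl
    exact (congrArg (fun τ => τ ≫ eqToHom _) h1).trans
      ((Category.id_comp _).trans ((Category.comp_id _).symm.trans
        (congrArg (fun τ => eqToHom _ ≫ τ) h2.symm)))

/-- The composite of morphisms: compose the functors and paste the transformations. -/
noncomputable def Hom.comp {A B D : SesqCat.{u} n} (f : Hom A B) (g : Hom B D) : Hom A D where
  F := f.F ⋙ g.F
  trans := f.trans ≫ Functor.whiskerLeft (f.F.op.prod f.F) g.trans
  compat := by
    apply NatTrans.ext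
    funext p
    rw [NatTrans.comp_app, NatTrans.comp_app, eqToHom_app, eqToHom_app]
    have h1 : (objects n).map ((f.trans ≫ Functor.whiskerLeft (f.F.op.prod f.F) g.trans).app p) =
        (objects n).map (f.trans.app p) ≫
          (objects n).map (g.trans.app ((f.F.op.prod f.F).obj p)) := (objects n).map_comp _ _
    refine (congrArg (fun τ => τ ≫ eqToHom _) h1).trans ((Category.assoc _ _ _).trans ?_)
    refine (congrArg (fun τ => (objects n).map (f.trans.app p) ≫ τ)
      (g.compat_app ((f.F.op.prod f.F).obj p))).trans ?_
    refine (Category.assoc _ _ _).symm.trans ?_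
    refine (congrArg (fun τ => τ ≫ (homMap g.F).app ((f.F.op.prod f.F).obj p))
      (f.compat_app p)).trans ?_
    exact Category.assoc _ _ _

noncomputable instance : Category.{u} (SesqCat.{u} n) where
  Hom := Hom
  id := Hom.id
  comp := Hom.comp
  id_comp f := Hom.ext rfl (heq_of_eq (by
    ext p; exact Category.id_comp (obj := Sesq n) _))
  comp_id f := Hom.ext rfl (heq_of_eq (by
    ext p; exact Category.comp_id (obj := Sesq n) _))
  assoc f g h := Hom.ext rfl (heq_of_eq (by
    ext p; exact Category.assoc (obj := Sesq n) _ _ _))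

end SesqCat

section Comparison

variable {n : ℕ}

namespace GlobSet

/-- The globular set of cells between two `0`-cells. -/
def between (X : GlobSet.{u} (n + 1)) (x y : X.cells 0) : GlobSet.{u} n where
  cells k := {z : X.cells (k + 1) //
    X.s 0 (X.iterS z 1 (Nat.le_add_left 1 k)) = x ∧ X.t 0 (X.iterS z 1 (Nat.le_add_left 1 k)) = y}
  s k z := ⟨X.s (k + 1) z.1, by rw [X.iterS_s]; exact z.2⟩
  t k z := ⟨X.t (k + 1) z.1, by
    have hz := z.2
    rcases Nat.eq_zero_or_pos k with rfl | hk
    · rw [← X.iterS_s z.1 1 le_rfl, X.iterS_self, X.ss, X.tt] at hz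
      rwa [X.iterS_self]
    · rwa [X.iterS_t _ _ (by omega)]⟩
  ss k z := Subtype.ext (X.ss _ _)
  tt k z := Subtype.ext (X.tt _ _)
  isEmpty k hk := ⟨fun z => (X.isEmpty (k + 1) (by omega)).false z.1⟩

end GlobSet

/-- The family of an arbitrary globular set. -/
def Family.ofGlobSet : ∀ {n : ℕ}, GlobSet.{u} n → Family.{u} n
  | 0, X => X.cells 0
  | _ + 1, X => ⟨X.cells 0, fun x y => ofGlobSet (X.between x y)⟩

/-- The cell of `X` named by a cell of the family of `X`. -/
def Family.toCell : ∀ {n : ℕ} (X : GlobSet.{u} n) (k : ℕ), (ofGlobSet X).cells k → X.cells k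
  | 0, _, 0, z => z
  | 0, _, _ + 1, z => PEmpty.elim z
  | _ + 1, _, 0, z => z
  | _ + 1, X, k + 1, z => (toCell (X.between z.1 z.2.1) k z.2.2).1

theorem Family.toCell_s : ∀ {n : ℕ} (X : GlobSet.{u} n) (k : ℕ) (z : (ofGlobSet X).cells (k + 1)),
    toCell X k ((ofGlobSet X).s k z) = X.s k (toCell X (k + 1) z)
  | 0, _, _, z => PEmpty.elim z
  | n + 1, X, 0, z => by
    have h := (toCell (X.between z.1 z.2.1) 0 z.2.2).2.1
    rw [X.iterS_self] at h
    exact h.symm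
  | _ + 1, X, k + 1, z => congrArg Subtype.val (toCell_s (X.between z.1 z.2.1) k z.2.2)

theorem Family.toCell_t : ∀ {n : ℕ} (X : GlobSet.{u} n) (k : ℕ) (z : (ofGlobSet X).cells (k + 1)),
    toCell X k ((ofGlobSet X).t k z) = X.t k (toCell X (k + 1) z)
  | 0, _, _, z => PEmpty.elim z
  | n + 1, X, 0, z => by
    have h := (toCell (X.between z.1 z.2.1) 0 z.2.2).2.2
    rw [X.iterS_self] at h
    exact h.symm
  | _ + 1, X, k + 1, z => congrArg Subtype.val (toCell_t (X.between z.1 z.2.1) k z.2.2)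

theorem Family.toCell_bijective : ∀ {n : ℕ} (X : GlobSet.{u} n) (k : ℕ),
    Function.Bijective (toCell X k)
  | 0, _, 0 => Function.bijective_id
  | 0, X, k + 1 => ⟨fun z => PEmpty.elim z, fun z => ((X.isEmpty (k + 1) k.succ_pos).false z).elim⟩
  | _ + 1, _, 0 => Function.bijective_id
  | _ + 1, X, k + 1 => by
    constructor
    · rintro ⟨x, y, w⟩ ⟨x', y', w'⟩ h
      replace h : (toCell (X.between x y) k w).1 = (toCell (X.between x' y') k w').1 := h
      obtain rfl : x = x' := by
        rw [← (toCell (X.between x y) k w).2.1, ← (toCell (X.between x' y') k w').2.1, h]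
      obtain rfl : y = y' := by
        rw [← (toCell (X.between x y) k w).2.2, ← (toCell (X.between x y') k w').2.2, h]
      obtain rfl : w = w' := (toCell_bijective (X.between x y) k).1 (Subtype.ext h)
      rfl
    · intro z
      obtain ⟨w, hw⟩ := (toCell_bijective (X.between _ _) k).2 ⟨z, rfl, rfl⟩
      exact ⟨⟨_, _, w⟩, congrArg Subtype.val hw⟩

/-- A levelwise bijective map of globular sets is an isomorphism. -/
noncomputable def GlobSet.isoOfBijective {X Y : GlobSet.{u} n} (f : X ⟶ Y)
    (hf : ∀ k, Function.Bijective (f.app k)) : X ≅ Y where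
  hom := f
  inv :=
    { app k := (Equiv.ofBijective _ (hf k)).symm
      app_s k y := (hf k).1 (by
        have h1 := Equiv.apply_symm_apply (Equiv.ofBijective _ (hf k)) (Y.s k y)
        have h2 := Equiv.apply_symm_apply (Equiv.ofBijective _ (hf (k + 1))) y
        rw [f.app_s]
        exact h1.trans (congrArg (Y.s k) h2.symm))
      app_t k y := (hf k).1 (by
        have h1 := Equiv.apply_symm_apply (Equiv.ofBijective _ (hf k)) (Y.t k y)
        have h2 := Equiv.apply_symm_apply (Equiv.ofBijective _ (hf (k + 1))) y
        rw [f.app_t]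
        exact h1.trans (congrArg (Y.t k) h2.symm)) }
  hom_inv_id := GlobSet.hom_ext fun k x =>
    Equiv.symm_apply_apply (Equiv.ofBijective _ (hf k)) x
  inv_hom_id := GlobSet.hom_ext fun k y =>
    Equiv.apply_symm_apply (Equiv.ofBijective _ (hf k)) y

/-- Every globular set is isomorphic to one presented by a family. -/
noncomputable def Family.totalOfGlobSet (X : GlobSet.{u} n) : (ofGlobSet X).total ≅ X :=
  GlobSet.isoOfBijective (X := (ofGlobSet X).total) ⟨toCell X, toCell_s X, toCell_t X⟩
    (toCell_bijective X)

/-- The forgetful functor to the Eilenberg-Moore category of `T n`. -/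
noncomputable def Sesq.comparison (n : ℕ) : Sesq.{u} n ⥤ (T.{u} n).Algebra where
  obj A := A.toAlgebra
  map f := f

/-- `Sesq n` is equivalent to the Eilenberg-Moore category of the monad `T n`: presenting the
underlying globular set by a family is no restriction. -/
instance (n : ℕ) : (Sesq.comparison.{u} n).IsEquivalence where
  faithful := ⟨fun h => h⟩
  full := ⟨fun f => ⟨f, rfl⟩⟩
  essSurj := ⟨fun A => by
    let e := Family.totalOfGlobSet A.A
    have hm : (T n).map e.inv ≫ (T n).map e.hom = 𝟙 _ := by
      rw [← (T n).map_comp, e.inv_hom_id, (T n).map_id]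
    let B : Sesq n :=
      { fam := Family.ofGlobSet A.A
        act := (T n).map e.hom ≫ A.a ≫ e.inv
        unit := by
          have h := (T n).unit_naturality _ e.hom
          have h' : e.hom ≫ ((T n).η.app A.A ≫ A.a) ≫ e.inv = 𝟙 _ := by
            rw [A.unit, Category.id_comp, e.hom_inv_id]
          rw [Category.assoc] at h'
          exact ((Category.assoc _ _ _).symm.trans (congrArg (fun τ => τ ≫ A.a ≫ e.inv)
            h.symm)).trans ((Category.assoc _ _ _).trans h')
        assoc := by
          rw [← (T n).mu_naturality_assoc, A.assoc_assoc]
          simp only [Functor.map_comp, Category.assoc]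
          rw [reassoc_of% hm] }
    refine ⟨B, ⟨Monad.Algebra.isoMk (A := B.toAlgebra) (B := A) e ?_⟩⟩
    change (T n).map e.hom ≫ A.a = ((T n).map e.hom ≫ A.a ≫ e.inv) ≫ e.hom
    simp⟩

end Comparison

end Sesqui

/-! In a simple string diagram the cells of each level are attached one after the other, and a cell
of dimension 2 is attached to one letter of the string of 1-cells present at that moment. Whiskering
it by the remaining letters turns a (k+1)-diagram into a string, followed by a sequence of whiskered
2-cells each of which starts where the previous one ends, with the higher cells stacked on these.
This is a k-diagram labelled in the globular set `whiskSet X` of strings and whiskered cells. Since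
no interchange law identifies different orders of attachment, the decomposition is unique:
`assemble_bijective` identifies the positive-dimensional cells of T_{n+1} X with the cells of T_n
(`whiskSet X`).

Hence an action of T_{n+1} on X amounts to a category on the cells of dimensions 0 and 1, acting
from both sides on the cells of positive dimension, together with an action of T_n on the latter
which whiskering respects. This is `WhiskAlg`. Given such data, a diagram is evaluated by evaluating
its whiskered cells (`WhiskAlg.value`) and then applying the T_n-action (`WhiskAlg.actPos`). For
associativity (`WhiskAlg.act_assoc`) the outer diagram is decomposed, which leaves two cases: a
single string (`mult_actPos`) and a single whiskered cell (`mult_whiskDiagram`, which rests on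
`actPos_graft`). Conversely, an action whiskers a cell by evaluating the diagram obtained by adding
strings on its two sides, and the laws follow by evaluating nested diagrams in two ways
(`IsAction.app_graft`). The constructions are inverse to each other by `whiskAlg_isAction` and
`act_whiskAlg`.

All labels of a diagram of positive-dimensional cells have the same 0-dimensional endpoints. Sorting
cells by endpoints therefore turns a `WhiskAlg` into T_n-algebras H(x,y) whose 0-cells are the
morphisms of a category, acting bifunctorially by algebra maps (`TypedAlg`). This is exactly a lift
of the hom functor. The correspondence is bijective on objects, and not only essentially surjective,
because globular sets are given by families; morphisms are compared in the same way, and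
`nonempty_iso_of_bijective` concludes. For the first claim, T_0 is trivial, so that `objects 0` has
the strict inverse `discrete`, every category has a unique lift, and `SesqCat 0` is isomorphic to
Cat. -/

namespace Sesqui

/-! ### Endpoints in dimension 0 and composable sequences of 1-cells. -/

namespace GlobSet

variable {n : ℕ} (X : GlobSet.{u} n)

/-- The iterated source of a cell of positive dimension in dimension `1`. -/
def edge : ∀ k, X.cells (k + 1) → X.cells 1
  | 0, z => z
  | k + 1, z => edge k (X.s (k + 1) z)

/-- The `0`-dimensional source. -/
def bs (k : ℕ) (z : X.cells (k + 1)) : X.cells 0 := X.s 0 (X.edge k z)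

/-- The `0`-dimensional target. -/
def bt (k : ℕ) (z : X.cells (k + 1)) : X.cells 0 := X.t 0 (X.edge k z)

theorem iterS_one : ∀ (k : ℕ) (z : X.cells (k + 1)), X.iterS z 1 (Nat.le_add_left 1 k) = X.edge k z
  | 0, z => X.iterS_self z
  | k + 1, z => (X.iterS_s z 1 (Nat.le_add_left 1 k)).symm.trans (iterS_one k _)

theorem iterS_zero (k : ℕ) (z : X.cells (k + 1)) : X.iterS z 0 (Nat.zero_le _) = X.bs k z := by
  rw [bs, ← iterS_one, s_iterS]

theorem edge_t (k : ℕ) (z : X.cells (k + 3)) :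
    X.edge (k + 1) (X.t (k + 2) z) = X.edge (k + 2) z :=
  congrArg (X.edge k) (X.ss _ z).symm

theorem bs_t : ∀ (k : ℕ) (z : X.cells (k + 2)), X.bs k (X.t (k + 1) z) = X.bs (k + 1) z
  | 0, z => (X.ss 0 z).symm
  | k + 1, z => congrArg (X.s 0) (X.edge_t k z)

theorem bt_t : ∀ (k : ℕ) (z : X.cells (k + 2)), X.bt k (X.t (k + 1) z) = X.bt (k + 1) z
  | 0, z => (X.tt 0 z).symm
  | k + 1, z => congrArg (X.t 0) (X.edge_t k z)

theorem Hom.app_edge {m : ℕ} {X : GlobSet.{u} n} {Y : GlobSet.{w} m} (f : Hom X Y) :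
    ∀ (k : ℕ) (z : X.cells (k + 1)), f.app 1 (X.edge k z) = Y.edge k (f.app (k + 1) z)
  | 0, _ => rfl
  | k + 1, z => (app_edge f k _).trans (congrArg (Y.edge k) (f.app_s _ z))

theorem Hom.app_bs {m : ℕ} {X : GlobSet.{u} n} {Y : GlobSet.{w} m} (f : Hom X Y) (k : ℕ)
    (z : X.cells (k + 1)) : f.app 0 (X.bs k z) = Y.bs k (f.app (k + 1) z) := by
  rw [bs, f.app_s, f.app_edge, bs]

theorem Hom.app_bt {m : ℕ} {X : GlobSet.{u} n} {Y : GlobSet.{w} m} (f : Hom X Y) (k : ℕ)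
    (z : X.cells (k + 1)) : f.app 0 (X.bt k z) = Y.bt k (f.app (k + 1) z) := by
  rw [bt, f.app_t, f.app_edge, bt]

/-- A composable sequence of `1`-cells. -/
def IsWord : X.cells 0 → List (X.cells 1) → Prop
  | _, [] => True
  | x, f :: l => X.s 0 f = x ∧ IsWord (X.t 0 f) l

/-- The target of a composable sequence of `1`-cells. -/
def wordEnd : X.cells 0 → List (X.cells 1) → X.cells 0
  | x, [] => x
  | _, f :: l => wordEnd (X.t 0 f) l

variable {X}

@[simp] theorem isWord_nil (x : X.cells 0) : X.IsWord x [] := trivial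

@[simp] theorem isWord_cons (x : X.cells 0) (f : X.cells 1) (l) :
    X.IsWord x (f :: l) ↔ X.s 0 f = x ∧ X.IsWord (X.t 0 f) l := Iff.rfl

@[simp] theorem wordEnd_nil (x : X.cells 0) : X.wordEnd x [] = x := rfl

@[simp] theorem wordEnd_cons (x : X.cells 0) (f : X.cells 1) (l) :
    X.wordEnd x (f :: l) = X.wordEnd (X.t 0 f) l := rfl

@[simp] theorem isWord_append : ∀ (x : X.cells 0) (l l' : List (X.cells 1)),
    X.IsWord x (l ++ l') ↔ X.IsWord x l ∧ X.IsWord (X.wordEnd x l) l'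
  | _, [], _ => by simp
  | x, f :: l, l' => by simp [isWord_append _ l l', and_assoc]

@[simp] theorem wordEnd_append : ∀ (x : X.cells 0) (l l' : List (X.cells 1)),
    X.wordEnd x (l ++ l') = X.wordEnd (X.wordEnd x l) l'
  | _, [], _ => rfl
  | _, _ :: l, l' => wordEnd_append _ l l'

theorem isWord_map {m : ℕ} {Y : GlobSet.{w} m} (φ : Hom X Y) :
    ∀ (x : X.cells 0) (l : List (X.cells 1)), X.IsWord x l →
      Y.IsWord (φ.app 0 x) (l.map (φ.app 1))
  | _, [], _ => trivial
  | _, f :: l, h => ⟨by rw [← φ.app_s, h.1], by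
      have := isWord_map φ _ l h.2
      rwa [φ.app_t] at this⟩

theorem wordEnd_map {m : ℕ} {Y : GlobSet.{w} m} (φ : Hom X Y) :
    ∀ (x : X.cells 0) (l : List (X.cells 1)),
      Y.wordEnd (φ.app 0 x) (l.map (φ.app 1)) = φ.app 0 (X.wordEnd x l)
  | _, [] => rfl
  | _, f :: l => by
    rw [List.map_cons, wordEnd_cons, ← φ.app_t, wordEnd_map φ _ l, wordEnd_cons]

theorem isWord_iff : ∀ (x : X.cells 0) (l : List (X.cells 1)), X.IsWord x l ↔
    (∀ h : 0 < l.length, X.s 0 l[0] = x) ∧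
      ∀ i (h : i + 1 < l.length), X.s 0 l[i + 1] = X.t 0 l[i]
  | x, [] => by simp
  | x, f :: l => by
    rw [isWord_cons, isWord_iff _ l]
    constructor
    · rintro ⟨h1, h2, h3⟩
      refine ⟨fun _ => h1, fun i h => ?_⟩
      rcases i with _ | i
      · exact h2 (by simpa using h)
      · exact h3 i (by simpa using h)
    · rintro ⟨h1, h2⟩
      refine ⟨h1 (by simp), fun h => ?_, fun i h => ?_⟩
      · exact h2 0 (by simpa using h)
      · exact h2 (i + 1) (by simpa using h)

/-- Replacing a letter by a parallel one. -/
theorem isWord_set {x : X.cells 0} {l : List (X.cells 1)} (hl : X.IsWord x l) {q : ℕ}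
    (hq : q < l.length) {f : X.cells 1} (hs : X.s 0 f = X.s 0 l[q]) (ht : X.t 0 f = X.t 0 l[q]) :
    X.IsWord x (l.set q f) := by
  have e : l = l.take q ++ l[q] :: l.drop (q + 1) := by
    rw [List.getElem_cons_drop, List.take_append_drop]
  rw [List.set_eq_take_append_cons_drop, if_pos hq]
  rw [e] at hl
  simp only [isWord_append, isWord_cons] at hl ⊢
  rw [hs, ht]
  exact hl

/-- Over a single slot all cells form one fibre, so the predecessor of the cell `i + 1` is the cell
`i`. Composability is therefore the attaching rule in dimension 1. -/
theorem slot_of_isWord {x : X.cells 0} {l : List (X.cells 1)} (hl : X.IsWord x l)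
    (i : Fin l.length) :
    IsSlotCell (X.t 0) (fun _ => (0 : Fin 1)) l.get (fun _ => x) (Set.Iio i) 0
      (X.s 0 (l.get i)) := by
  rw [isWord_iff] at hl
  obtain ⟨i, hi⟩ := i
  rcases i with _ | i
  · exact Or.inl ⟨fun a ha => absurd ha (Nat.not_lt_zero _), hl.1 hi⟩
  · exact Or.inr ⟨⟨i, by omega⟩, ⟨⟨Nat.lt_succ_self i, rfl⟩, fun a ha => Nat.le_of_lt_succ ha.1⟩,
      hl.2 i hi⟩

/-- Used to compute the 0-dimensional target of a 1-diagram. The slots form a subsingleton `B` and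
not `Fin 1`, since level 0 of a diagram has length 1 only propositionally. -/
theorem slot_wordEnd {N : ℕ} {B : Type} [Subsingleton B] (v : Fin N → B) (f : Fin N → X.cells 1)
    (y : B → X.cells 0) (q : B) :
    IsSlotCell (X.t 0) v f y Set.univ q (X.wordEnd (y q) (List.ofFn f)) := by
  cases N with
  | zero => exact Or.inl ⟨fun a => a.elim0, by simp⟩
  | succ N =>
    refine Or.inr ⟨Fin.last N, ⟨⟨trivial, Subsingleton.elim _ _⟩, fun a _ => Fin.le_last a⟩, ?_⟩
    rw [List.ofFn_succ', List.concat_eq_append, wordEnd_append]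
    rfl

end GlobSet

/-! ### The base and the word of a labelled diagram. -/

namespace LDiagram

variable {n k : ℕ} {X Y : GlobSet.{u} n}

/-- The unique element of level `0`. -/
abbrev root (D : Diagram k) : Fin (D.len 0 (Nat.zero_le k)) :=
  ⟨0, by rw [D.len_zero]; exact Nat.one_pos⟩

instance (D : Diagram k) : Subsingleton (Fin (D.len 0 (Nat.zero_le k))) := by
  rw [D.len_zero]; infer_instance

/-- The label of dimension `0`. -/
def base (d : LDiagram k X) : X.cells 0 := d.lab.x 0 (Nat.zero_le k) (root d.shape)

theorem lab_zero (d : LDiagram k X) (i) : d.lab.x 0 (Nat.zero_le k) i = d.base :=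
  congrArg _ (Subsingleton.elim _ _)

/-- The labels of dimension `1`. -/
def word (d : LDiagram (k + 1) X) : List (X.cells 1) :=
  List.ofFn (d.lab.x 1 (Nat.le_add_left 1 k))

theorem length_word (d : LDiagram (k + 1) X) :
    d.word.length = d.shape.len 1 (Nat.le_add_left 1 k) := List.length_ofFn

theorem getElem_word (d : LDiagram (k + 1) X) (i : ℕ) (h : i < d.word.length) :
    d.word[i] = d.lab.x 1 (Nat.le_add_left 1 k) ⟨i, d.length_word ▸ h⟩ :=
  List.getElem_ofFn h

/-- Level 0 has one element, so level 1 is a single fibre and its attaching rule says that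
consecutive labels compose. -/
theorem isWord_word (d : LDiagram (k + 1) X) : X.IsWord d.base d.word := by
  rw [GlobSet.isWord_iff]
  refine ⟨fun h => ?_, fun i h => ?_⟩
  · rw [getElem_word]
    rcases d.lab.src 0 _ ⟨0, d.length_word ▸ h⟩ with ⟨-, hc⟩ | ⟨p, hp, hc⟩
    · exact hc.trans (d.lab_zero _)
    · exact absurd hp.1.1 (Nat.not_lt_zero _)
  · rw [getElem_word, getElem_word]
    rcases d.lab.src 0 _ ⟨i + 1, d.length_word ▸ h⟩ with ⟨hn, -⟩ | ⟨p, hp, hc⟩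
    · have hi : i < d.shape.len 1 (Nat.le_add_left 1 k) := d.length_word ▸ Nat.lt_of_succ_lt h
      exact (hn ⟨i, hi⟩ (Nat.lt_succ_self i) (Subsingleton.elim _ _)).elim
    · rw [hc]
      congr 2
      -- Every earlier index lies in the fibre, so the greatest one before `i + 1` is `i`.
      have h1 : p.val ≤ i := Nat.le_of_lt_succ hp.1.1
      have h2 : i ≤ p.val := @hp.2 ⟨i, d.length_word ▸ (Nat.lt_of_succ_lt h)⟩
        ⟨Nat.lt_succ_self i, Subsingleton.elim _ _⟩
      exact Fin.ext (le_antisymm h1 h2)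

/-- A labelled diagram is determined by its `1`-dimensional part and by the isomorphism class of
the rest. -/
theorem ext_word {d e : LDiagram (k + 1) X} (hb : d.base = e.base) (hw : d.word = e.word)
    (f : ∀ m (h : m + 2 ≤ k + 1), Fin (d.shape.len (m + 2) h) → Fin (e.shape.len (m + 2) h))
    (mono : ∀ m h, StrictMono (f m h)) (surj : ∀ m h, Function.Surjective (f m h))
    (hv0 : ∀ h i, (d.shape.v 1 h i).val = (e.shape.v 1 h (f 0 h i)).val)
    (hv : ∀ m h i, f m _ (d.shape.v (m + 2) h i) = e.shape.v (m + 2) h (f (m + 1) h i))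
    (hx : ∀ m h i, d.lab.x (m + 2) h i = e.lab.x (m + 2) h (f m h i)) : d = e := by
  have h0 : d.shape.len 0 (Nat.zero_le _) = e.shape.len 0 (Nat.zero_le _) := by
    rw [d.shape.len_zero, e.shape.len_zero]
  have h1 : d.shape.len 1 (Nat.le_add_left 1 k) = e.shape.len 1 (Nat.le_add_left 1 k) := by
    rw [← length_word, ← length_word, hw]
  refine eq_of_iso (fun m h => match m, h with
    | 0, _ => Fin.cast h0
    | 1, _ => Fin.cast h1
    | m + 2, h => f m h) ?_ ?_ ?_ ?_
  · intro m h
    match m, h with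
    | 0, _ => exact fun _ _ h => h
    | 1, _ => exact fun _ _ h => h
    | m + 2, h => exact mono m h
  · intro m h
    match m, h with
    | 0, _ => exact fun i => ⟨Fin.cast h0.symm i, rfl⟩
    | 1, _ => exact fun i => ⟨Fin.cast h1.symm i, rfl⟩
    | m + 2, h => exact surj m h
  · intro m h i
    match m, h with
    | 0, _ => exact Subsingleton.elim _ _
    | 1, _ => exact Fin.ext (hv0 _ i)
    | m + 2, h => exact hv m h i
  · intro m h i
    match m, h with
    | 0, _ => exact (d.lab_zero i).trans (hb.trans (e.lab_zero _).symm)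
    | 1, _ =>
      have := List.getElem_of_eq hw (i := i.val) (by rw [length_word]; exact i.2)
      rwa [getElem_word, getElem_word] at this
    | m + 2, h => exact hx m h i

theorem ext_word_one {d e : LDiagram 1 X} (hb : d.base = e.base) (hw : d.word = e.word) : d = e :=
  ext_word hb hw (fun _ h => absurd h (by omega)) (fun _ h => absurd h (by omega))
    (fun _ h => absurd h (by omega)) (fun h => absurd h (by omega)) (fun _ h => absurd h (by omega))
    (fun _ h => absurd h (by omega))

theorem ext_zero {d e : LDiagram 0 X} (hb : d.base = e.base) : d = e := by
  have h0 : d.shape.len 0 le_rfl = e.shape.len 0 le_rfl := by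
    rw [d.shape.len_zero, e.shape.len_zero]
  refine eq_of_iso (fun m h => match m, h with
    | 0, _ => Fin.cast h0) ?_ ?_ ?_ ?_
  · intro m h
    obtain rfl : m = 0 := by omega
    exact fun _ _ h => h
  · intro m h
    obtain rfl : m = 0 := by omega
    exact fun i => ⟨Fin.cast h0.symm i, rfl⟩
  · intro m h i
    omega
  · intro m h i
    obtain rfl : m = 0 := by omega
    exact (d.lab_zero i).trans (hb.trans (e.lab_zero _).symm)

end LDiagram

end Sesqui

/-! ### Strings, and adding strings on the two sides of a diagram. -/

namespace Sesqui

namespace LDiagram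

variable {n k : ℕ}

section

variable {X Y : GlobSet.{u} n}

/-- A composable sequence of `1`-cells as a labelled diagram. -/
def string (x : X.cells 0) (l : List (X.cells 1)) (hl : X.IsWord x l) : LDiagram 1 X where
  shape :=
    { len m _ := match m with
        | 0 => 1
        | _ + 1 => l.length
      v m _ _ := match m with
        | 0 => (0 : Fin 1)
        | _ + 1 => by omega
      len_zero := rfl }
  lab :=
    { x m h i := match m, h with
        | 0, _ => x
        | 1, _ => l.get i
      src m h i := by
        match m, h with
        | 0, _ => exact GlobSet.slot_of_isWord hl i }

theorem word_string (x : X.cells 0) (l : List (X.cells 1)) (hl : X.IsWord x l) :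
    (string x l hl).word = l := List.ofFn_get l

theorem string_base_word (d : LDiagram 1 X) : string d.base d.word d.isWord_word = d :=
  ext_word_one rfl (word_string _ _ _)

/-- The diagram obtained by adding strings on both sides. -/
def graft (x : X.cells 0) (l : List (X.cells 1)) (d : LDiagram (k + 1) X) (r : List (X.cells 1))
    (h : X.IsWord x (l ++ d.word ++ r)) : LDiagram (k + 1) X where
  shape :=
    { len m h := match m, h with
        | 0, _ => 1
        | 1, _ => (l ++ d.word ++ r).length
        | m + 2, h => d.shape.len (m + 2) h
      v m h := match m, h with
        | 0, _ => fun _ => (0 : Fin 1)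
        | 1, h => fun i => ⟨l.length + d.shape.v 1 h i, by
            have := (d.shape.v 1 h i).2
            have := d.length_word
            simp only [List.length_append]
            omega⟩
        | m + 2, h => d.shape.v (m + 2) h
      len_zero := rfl }
  lab :=
    { x m h := match m, h with
        | 0, _ => fun _ => x
        | 1, _ => (l ++ d.word ++ r).get
        | m + 2, h => d.lab.x (m + 2) h
      src m hm i := by
        match m, hm with
        | 0, _ => exact GlobSet.slot_of_isWord h i
        | 1, hm =>
          -- The letters of `d` reappear shifted by `l.length`, like the slots of the 2-cells; hence
          -- the attaching rule is inherited from `d`.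
          have hg : ∀ j : Fin (d.shape.len 1 (Nat.le_add_left 1 k)), ∀ hj,
              (l ++ d.word ++ r).get ⟨l.length + j, hj⟩ = d.lab.x 1 _ j := fun j hj => by
            have h1 : j.val < d.word.length := by rw [length_word]; exact j.2
            rw [List.get_eq_getElem, List.getElem_append_left (by simp [h1]),
              List.getElem_append_right (by simp)]
            simp [getElem_word]
          rcases d.lab.src 1 hm i with ⟨hn, hc⟩ | ⟨p, hp, hc⟩
          · refine Or.inl ⟨fun j hj e => hn j hj (Fin.ext ?_), hc.trans (hg _ _).symm⟩
            have := congrArg Fin.val e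
            simpa using this
          · refine Or.inr ⟨p, ⟨⟨hp.1.1, Fin.ext ?_⟩, fun j hj => hp.2 ⟨hj.1, Fin.ext ?_⟩⟩, hc⟩
            · exact congrArg (fun j => l.length + Fin.val j) hp.1.2
            · have := congrArg Fin.val hj.2
              simpa using this
        | m + 2, hm => exact d.lab.src (m + 2) hm i }

variable {x : X.cells 0} {l r : List (X.cells 1)}

theorem word_graft (d : LDiagram (k + 1) X) (h : X.IsWord x (l ++ d.word ++ r)) :
    (graft x l d r h).word = l ++ d.word ++ r := List.ofFn_get _

theorem graft_congr {x x' : X.cells 0} {l l' r r' : List (X.cells 1)} {d d' : LDiagram (k + 1) X}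
    (h : X.IsWord x (l ++ d.word ++ r)) (hx : x = x') (hl : l = l') (hd : d = d') (hr : r = r') :
    graft x l d r h = graft x' l' d' r' (by subst hx hl hd hr; exact h) := by
  subst hx hl hd hr; rfl

/-- A diagram with the same higher levels is a graft. -/
theorem eq_graft {d e : LDiagram (k + 1) X} (h : X.IsWord x (l ++ d.word ++ r))
    (hb : e.base = x) (hw : e.word = l ++ d.word ++ r)
    (f : ∀ m (h : m + 2 ≤ k + 1), Fin (e.shape.len (m + 2) h) → Fin (d.shape.len (m + 2) h))
    (mono : ∀ m h, StrictMono (f m h)) (surj : ∀ m h, Function.Surjective (f m h))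
    (hv0 : ∀ h i, (e.shape.v 1 h i).val = l.length + (d.shape.v 1 h (f 0 h i)).val)
    (hv : ∀ m h i, f m _ (e.shape.v (m + 2) h i) = d.shape.v (m + 2) h (f (m + 1) h i))
    (hx : ∀ m h i, e.lab.x (m + 2) h i = d.lab.x (m + 2) h (f m h i)) :
    e = graft x l d r h :=
  ext_word hb (hw.trans (word_graft d h).symm) f mono surj hv0 hv hx

theorem graft_nil (d : LDiagram (k + 1) X) (h : X.IsWord d.base ([] ++ d.word ++ [])) :
    graft d.base [] d [] h = d :=
  (eq_graft h rfl (by simp) (fun _ _ i => i) (fun _ _ _ _ h => h) (fun _ _ i => ⟨i, rfl⟩)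
    (fun _ _ => by simp) (fun _ _ _ => rfl) (fun _ _ _ => rfl)).symm

theorem graft_graft {x' : X.cells 0} {l' r' : List (X.cells 1)} (d : LDiagram (k + 1) X)
    (h : X.IsWord x (l ++ d.word ++ r)) (h')
    (h'' : X.IsWord x' ((l' ++ l) ++ d.word ++ (r ++ r'))) :
    graft x' l' (graft x l d r h) r' h' = graft x' (l' ++ l) d (r ++ r') h'' :=
  eq_graft h'' rfl (by rw [word_graft, word_graft]; simp) (fun _ _ i => i) (fun _ _ _ _ h => h)
    (fun _ _ i => ⟨i, rfl⟩) (fun _ _ => by rw [List.length_append]; exact (Nat.add_assoc _ _ _).symm)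
    (fun _ _ _ => rfl) (fun _ _ _ => rfl)

theorem word_map (f : X ⟶ Y) (d : LDiagram (k + 1) X) : (d.map f).word = d.word.map (f.app 1) :=
  (List.map_ofFn (f := d.lab.x 1 _) (g := f.app 1)).symm

theorem map_graft (f : X ⟶ Y) (d : LDiagram (k + 1) X) (h : X.IsWord x (l ++ d.word ++ r))
    (h' : Y.IsWord (f.app 0 x) (l.map (f.app 1) ++ (d.map f).word ++ r.map (f.app 1))) :
    (graft x l d r h).map f = graft (f.app 0 x) (l.map (f.app 1)) (d.map f) (r.map (f.app 1)) h' :=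
  eq_graft h' rfl (by rw [word_map, word_graft, word_map]; simp) (fun _ _ i => i)
    (fun _ _ _ _ h => h) (fun _ _ i => ⟨i, rfl⟩) (fun _ _ => by rw [List.length_map]; rfl)
    (fun _ _ _ => rfl) (fun _ _ _ => rfl)

theorem map_string (f : X ⟶ Y) (hl : X.IsWord x l) :
    (string x l hl).map f =
      string (f.app 0 x) (l.map (f.app 1)) (GlobSet.isWord_map f x l hl) :=
  ext_word_one rfl (by rw [word_map, word_string, word_string])

theorem word_source (d : LDiagram (k + 2) X) : d.source.word = d.word := rfl

theorem word_target (d : LDiagram (k + 3) X) : d.target.word = d.word :=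
  congrArg List.ofFn (funext fun i => d.targetLabel_lt 1 (by omega) i)

theorem base_target (d : LDiagram (k + 2) X) : d.target.base = d.base :=
  d.targetLabel_lt 0 (by omega) _

theorem source_graft (d : LDiagram (k + 2) X) (h : X.IsWord x (l ++ d.word ++ r)) :
    (graft x l d r h).source = graft x l d.source r h :=
  eq_graft (d := d.source) h rfl (word_graft d h) (fun _ _ i => i)
    (fun _ _ _ _ h => h) (fun _ _ i => ⟨i, rfl⟩) (fun _ _ => rfl) (fun _ _ _ => rfl)
    (fun _ _ _ => rfl)

/-- Only the fibre over the slot and its initial cell matter, so the index type of the slots may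
change. This allows slots to be shifted by a graft. -/
theorem finalCell_congr {A B B' : Type} {Y Z : Type*} [LinearOrder A] {t : Z → Y} {v : A → B}
    {v' : A → B'} {x : A → Z} {y : B → Y} {y' : B' → Y} {q : B} {q' : B'}
    (hv : ∀ a, v a = q ↔ v' a = q') (hy : y q = y' q') :
    finalCell t v x y q = finalCell t v' x y' q' := by
  have h : {a | v a = q} = {a | v' a = q'} := Set.ext hv
  by_cases hp : ∃ p, IsGreatest {a | v a = q} p
  · have hp' : ∃ p, IsGreatest {a | v' a = q'} p := by rw [← h]; exact hp
    have h2 : IsGreatest {a | v a = q} hp'.choose := by rw [h]; exact hp'.choose_spec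
    rw [finalCell_pos hp, finalCell_pos hp', hp.choose_spec.unique h2]
  · rw [finalCell_neg hp, finalCell_neg (by rwa [← h]), hy]

theorem length_word_target (d : LDiagram (k + 2) X) : d.target.word.length = d.word.length := by
  rw [length_word, length_word]; rfl

theorem getElem_word_target (d : LDiagram 2 X) (q : ℕ) (h : q < d.target.word.length) :
    d.target.word[q] = finalCell (X.t 1) (d.shape.v 1 le_rfl) (d.lab.x 2 le_rfl)
      (d.lab.x 1 (Nat.le_succ 1))
      ⟨q, h.trans_eq ((length_word_target d).trans d.length_word)⟩ :=
  (getElem_word _ _ _).trans (targetLabel_self d _)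

/-- In a 2-diagram the target changes letters of the word. The 2-cells of a graft are attached to
letters of `d` only, so the added strings survive unchanged. -/
theorem word_target_graft (d : LDiagram 2 X) (h : X.IsWord x (l ++ d.word ++ r)) :
    (graft x l d r h).target.word = l ++ d.target.word ++ r := by
  have hlen := length_word_target d
  have hlen' := length_word_target (graft x l d r h)
  rw [word_graft] at hlen'
  refine List.ext_getElem (by simp [hlen, hlen']) fun q h1 h2 => ?_
  rw [getElem_word_target]
  -- Inside the window of `d` the fibres are those of `d`; outside it they are empty, and the final
  -- cell is the original letter.
  by_cases hq : l.length ≤ q ∧ q < l.length + d.word.length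
  · rw [List.getElem_append_left (by simp [hlen]; omega), List.getElem_append_right (by omega),
      getElem_word_target]
    refine finalCell_congr (fun a => ?_) ?_
    · refine Fin.ext_iff.trans (Iff.trans ?_ Fin.ext_iff.symm)
      change l.length + _ = q ↔ _ = q - l.length
      omega
    · refine Eq.trans (b := (l ++ d.word ++ r)[q]'(by simp; omega)) rfl ?_
      rw [List.getElem_append_left (by simp; omega), List.getElem_append_right (by omega),
        getElem_word]
  · refine (finalCell_neg ?_).trans ?_
    · rintro ⟨p, hp, -⟩
      have h3 := congrArg Fin.val hp
      change l.length + (d.shape.v 1 _ p).val = q at h3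
      have h4 := (d.shape.v 1 le_rfl p).2
      have h5 := d.length_word
      omega
    · refine Eq.trans (b := (l ++ d.word ++ r)[q]'(by omega)) rfl ?_
      by_cases hq' : q < l.length
      · rw [List.getElem_append_left (by simp; omega), List.getElem_append_left (by omega),
          List.getElem_append_left (by simp; omega), List.getElem_append_left (by omega)]
      · rw [List.getElem_append_right (by simp; omega),
          List.getElem_append_right (by simp [hlen]; omega)]
        simp [hlen]

theorem target_graft (d : LDiagram (k + 2) X) (h : X.IsWord x (l ++ d.word ++ r))
    (h' : X.IsWord x (l ++ d.target.word ++ r)) :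
    (graft x l d r h).target = graft x l d.target r h' := by
  refine eq_graft h' ((base_target _).trans rfl) ?_ (fun _ _ i => i)
    (fun _ _ _ _ h => h) (fun _ _ i => ⟨i, rfl⟩) (fun _ _ => rfl) (fun _ _ _ => rfl) ?_
  -- Only targets of 2-diagrams alter the word; in higher dimensions it is unaffected.
  · cases k with
    | zero => exact word_target_graft d h
    | succ k => rw [word_target, word_target, word_graft]
  · intro m hm i
    rfl

theorem word_unit (z : X.cells (k + 1)) : (unit z).word = [X.edge k z] := by
  rw [← X.iterS_one]
  rfl

theorem base_unit (z : X.cells (k + 1)) : (unit z).base = X.bs k z := X.iterS_zero k z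

theorem unit_source (z : X.cells (k + 1)) : (unit z).source = unit (X.s k z) :=
  eq_of_shape (D := Diagram.one k) fun m h _ => (X.iterS_s z m h).symm

theorem map_unit (f : X ⟶ Y) (z : X.cells k) : (unit z).map f = unit (f.app k z) :=
  eq_of_shape (D := Diagram.one k) fun m h _ => f.app_iterS z m h

end

end LDiagram

end Sesqui

/-! ### Explicit positions in a composite, and its word. -/

namespace Sesqui

/-- Both lists are strictly increasing for the lexicographic order and have the same members. -/
theorem ofFn_sumIso {l : ℕ} (s : Fin l → ℕ) : List.ofFn (sumIso s) =
    (List.finRange l).flatMap fun i => (List.finRange (s i)).map fun j => toLex ⟨i, j⟩ := by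
  refine List.Pairwise.eq_of_mem_iff (r := (· < ·)) ?_ ?_ fun a => ?_
  · exact List.pairwise_ofFn.2 fun i j h => (sumIso s).strictMono h
  · rw [List.pairwise_flatMap]
    refine ⟨fun i _ => ?_, (List.sortedLT_finRange l).pairwise.imp fun {i i'} h x hx y hy => ?_⟩
    · rw [List.pairwise_map]
      exact (List.sortedLT_finRange (s i)).pairwise.imp fun h => Sigma.Lex.right _ _ h
    · obtain ⟨j, -, rfl⟩ := List.mem_map.1 hx
      obtain ⟨j', -, rfl⟩ := List.mem_map.1 hy
      exact Sigma.Lex.left _ _ h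
  · constructor
    · intro _
      exact List.mem_flatMap.2 ⟨a.1, List.mem_finRange _, List.mem_map.2
        ⟨a.2, List.mem_finRange _, rfl⟩⟩
    · intro _
      exact List.mem_ofFn.2 ((sumIso s).surjective a)

theorem Fin.val_eq_of_strictMono {N : ℕ} {f : Fin N → ℕ} (hf : StrictMono f) (hN : ∀ i, f i < N)
    (i : Fin N) : f i = i := by
  have h1 : StrictMono fun i => (⟨f i, hN i⟩ : Fin N) := fun _ _ h => hf h
  have h2 : (h1.orderIsoOfSurjective _ (Finite.surjective_of_injective h1.injective)) =
    OrderIso.refl _ := Subsingleton.elim _ _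
  exact congrArg (fun g => (g i).val) h2

theorem sum_take_ofFn_succ {l : ℕ} (s : Fin l → ℕ) (i : Fin l) :
    ((List.ofFn s).take (i + 1)).sum = ((List.ofFn s).take i).sum + s i := by
  rw [List.sum_take_succ _ _ (by simp)]
  simp

theorem sum_take_mono (L : List ℕ) {i j : ℕ} (h : i ≤ j) : (L.take i).sum ≤ (L.take j).sum := by
  obtain ⟨m, rfl⟩ := Nat.exists_eq_add_of_le h
  rw [List.take_add, List.sum_append]
  exact Nat.le_add_right _ _

/-- The formula is strictly increasing in the lexicographic order and stays below the total size.
Composed with `sumIso` it becomes a strictly monotone self-map of a finite ordinal, which is the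
identity. -/
theorem sumIso_symm_toLex {l : ℕ} (s : Fin l → ℕ) (i : Fin l) (j : Fin (s i)) :
    ((sumIso s).symm (toLex ⟨i, j⟩)).val = ((List.ofFn s).take i).sum + j := by
  let g : _root_.Lex (Σ i : Fin l, Fin (s i)) → ℕ := fun a => ((List.ofFn s).take a.1).sum + a.2
  have h1 : ∀ a, g a < ((List.ofFn s).take (a.1 + 1)).sum := fun a => by
    rw [sum_take_ofFn_succ]
    exact Nat.add_lt_add_left a.2.2 _
  have hg : StrictMono g := by
    rintro ⟨i, j⟩ ⟨i', j'⟩ h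
    rcases Sigma.lex_iff.1 h with h | ⟨h, h'⟩
    · exact (h1 _).trans_le ((sum_take_mono _ h).trans (Nat.le_add_right _ _))
    · obtain rfl : i = i' := h
      exact Nat.add_lt_add_left h' _
  have hN : ∀ a, g a < ∑ i, s i := fun a => by
    refine (h1 a).trans_le ((sum_take_mono _ a.1.2).trans ?_)
    rw [List.take_of_length_le (by simp), List.sum_ofFn]
  have h2 := Fin.val_eq_of_strictMono (hg.comp (sumIso s).strictMono) (fun p => hN _)
    ((sumIso s).symm (toLex ⟨i, j⟩))
  rw [← h2, Function.comp, OrderIso.apply_symm_apply]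
  rfl

namespace LDiagram

variable {n k : ℕ}

section

variable {X Y : GlobSet.{u} n}

/-- The `0`-dimensional label of a cell of `TObj X`. -/
def baseOf {k : ℕ} (p : (TObj X).cells k) : X.cells 0 := base p.1

/-- The `1`-dimensional labels of a cell of `TObj X`. -/
def wordOf {k : ℕ} (p : (TObj X).cells (k + 1)) : List (X.cells 1) := word p.1

theorem base_comp (d : LDiagram k (TObj X)) : d.comp.base = baseOf d.base := by
  change (d.block 0 _ (d.levelIso 0 _ _).1).lab.x 0 le_rfl _ = _
  rw [lab_zero]
  exact congrArg baseOf (d.lab_zero _)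

/-- Level 1 of the composite is the ordered union of the level-1 blocks, so the words of the labels
are concatenated. -/
theorem word_comp (d : LDiagram (k + 1) (TObj X)) :
    d.comp.word = d.word.flatMap wordOf := by
  have h1 : d.comp.word = (List.ofFn (sumIso (d.size 1 (Nat.le_add_left 1 k)))).map
      (d.levelLabel 1 _) := by
    rw [List.map_ofFn]
    rfl
  rw [h1, ofFn_sumIso, List.map_flatMap, word, List.ofFn_eq_map, List.flatMap_map]
  refine List.flatMap_congr fun i _ => ?_
  rw [List.map_map]
  exact (List.ofFn_eq_map).symm

/-- The standard way to recognise a composite below: levels 0 and 1 are compared through base and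
word, and only higher levels need an isomorphism. In `hv0` the slot of a 2-cell is the total length
of the words in front of its block plus its slot inside the block. -/
theorem comp_eq_of_word {d : LDiagram (k + 1) (TObj X)} {e : LDiagram (k + 1) X}
    (hb : baseOf d.base = e.base) (hw : (d.word.flatMap wordOf) = e.word)
    (f : ∀ m (h : m + 2 ≤ k + 1), d.Level (m + 2) h → Fin (e.shape.len (m + 2) h))
    (mono : ∀ m h, StrictMono (f m h)) (surj : ∀ m h, Function.Surjective (f m h))
    (hv0 : ∀ h (a : d.Level 2 h), ((d.word.map fun p => (wordOf p).length).take
      (d.shape.v 1 h a.1)).sum + ((d.block 2 h a.1).shape.v 1 le_rfl a.2).val =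
      (e.shape.v 1 h (f 0 h a)).val)
    (hv : ∀ m h a, f m _ (d.levelMap (m + 2) h a) = e.shape.v (m + 2) h (f (m + 1) h a))
    (hx : ∀ m h a, d.levelLabel (m + 2) h a = e.lab.x (m + 2) h (f m h a)) : d.comp = e := by
  refine ext_word ((base_comp d).trans hb) ((word_comp d).trans hw)
    (fun m h p => f m h (d.levelIso (m + 2) h p))
    (fun m h => (mono m h).comp (d.levelIso (m + 2) h).strictMono)
    (fun m h => (surj m h).comp (d.levelIso (m + 2) h).surjective) (fun h i => ?_)
    (fun m h i => ?_) (fun m h i => hx m h _)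
  · rw [← hv0]
    refine (sumIso_symm_toLex _ _ _).trans ?_
    refine congrArg (fun L : List ℕ => (L.take (d.shape.v 1 h (d.levelIso 2 h i).1).val).sum +
      ((d.block 2 h (d.levelIso 2 h i).1).shape.v 1 le_rfl (d.levelIso 2 h i).2).val) ?_
    rw [word, List.map_ofFn]
    exact congrArg List.ofFn (funext fun i => (length_word _).symm)
  · change f m _ (d.levelIso _ _ ((d.levelIso _ _).symm _)) = _
    rw [OrderIso.apply_symm_apply, hv]

theorem ofFn_root {α : Type*} (D : Diagram k) (g : Fin (D.len 0 (Nat.zero_le k)) → α) :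
    List.ofFn g = [g (root D)] := by
  have key : ∀ (N : ℕ) (g : Fin N → α) (h : N = 1) (r : Fin N), List.ofFn g = [g r] := by
    rintro _ g rfl r
    obtain rfl : r = 0 := Subsingleton.elim _ _
    simp
  exact key _ g D.len_zero _

end

end LDiagram

/-! ### Shifting dimensions, and diagrams with a single string. -/

/-- The cells of positive dimension, with their dimension lowered by one. -/
def GlobSet.shift {n : ℕ} (X : GlobSet.{u} (n + 1)) : GlobSet.{u} n where
  cells k := X.cells (k + 1)
  s k := X.s (k + 1)
  t k := X.t (k + 1)
  ss k := X.ss (k + 1)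
  tt k := X.tt (k + 1)
  isEmpty k h := X.isEmpty (k + 1) (Nat.succ_lt_succ h)

/-- The action of a map of globular sets on the cells of positive dimension. -/
def GlobSet.shiftMap {n : ℕ} {X Y : GlobSet.{u} (n + 1)} (f : X ⟶ Y) : X.shift ⟶ Y.shift where
  app k := f.app (k + 1)
  app_s k := f.app_s (k + 1)
  app_t k := f.app_t (k + 1)

namespace LDiagram

variable {n k : ℕ} {X Y : GlobSet.{u} (n + 1)}

/-- A diagram labelled by cells of positive dimension as a diagram with a single string. -/
def susp (d : LDiagram k X.shift) : LDiagram (k + 1) X where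
  shape :=
    { len m h := match m, h with
        | 0, _ => 1
        | m + 1, h => d.shape.len m (Nat.le_of_succ_le_succ h)
      v m h := match m, h with
        | 0, _ => fun _ => (0 : Fin 1)
        | m + 1, h => d.shape.v m (Nat.le_of_succ_le_succ h)
      len_zero := rfl }
  lab :=
    { x m h := match m, h with
        | 0, _ => fun _ => X.s 0 d.base
        | m + 1, h => d.lab.x m (Nat.le_of_succ_le_succ h)
      src m h i := by
        match m, h with
        | 0, _ => exact Or.inl ⟨fun a ha => absurd ha (by
            rw [show a = i from Subsingleton.elim (α := Fin (d.shape.len 0 _)) a i]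
            exact lt_irrefl i), congrArg (X.s 0) (d.lab_zero i)⟩
        | m + 1, h => exact d.lab.src m (Nat.le_of_succ_le_succ h) i }

theorem base_susp (d : LDiagram k X.shift) : (susp d).base = X.s 0 d.base := rfl

theorem word_susp (d : LDiagram k X.shift) : (susp d).word = [d.base] :=
  ofFn_root d.shape (d.lab.x 0 _)

theorem susp_source (d : LDiagram (k + 1) X.shift) : (susp d).source = susp d.source :=
  ext_word rfl rfl (fun _ _ i => i) (fun _ _ _ _ h => h) (fun _ _ i => ⟨i, rfl⟩) (fun _ _ => rfl)
    (fun _ _ _ => rfl) (fun _ _ _ => rfl)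

theorem susp_targetLabel (d : LDiagram (k + 1) X.shift) (m : ℕ) (h : m ≤ k) (i) :
    (susp d).targetLabel (m + 1) (Nat.succ_le_succ h) i = d.targetLabel m h i := by
  rcases h.lt_or_eq with h' | rfl
  · exact (targetLabel_lt (susp d) _ (Nat.succ_lt_succ h') i).trans (targetLabel_lt d _ h' i).symm
  · exact (targetLabel_self (susp d) i).trans (targetLabel_self d i).symm

theorem susp_target (d : LDiagram (k + 1) X.shift) : (susp d).target = susp d.target := by
  have hw : (susp d).target.word = (susp d.target).word := by
    rw [word_susp]
    refine (ofFn_root d.shape _).trans ?_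
    exact congrArg (fun z => [z]) (susp_targetLabel d 0 (Nat.zero_le k) _)
  refine ext_word ?_ hw (fun _ _ i => i) (fun _ _ _ _ h => h) (fun _ _ i => ⟨i, rfl⟩)
    (fun _ _ => rfl) (fun _ _ _ => rfl)
    (fun m h i => susp_targetLabel d (m + 1) (Nat.le_of_succ_le_succ h) i)
  -- The base of the target is read off as the source of the only letter of its word, which is
  -- already known.
  have h1 := (susp d).target.isWord_word
  rw [hw, word_susp] at h1
  exact h1.1.symm

theorem susp_map (f : X ⟶ Y) (d : LDiagram k X.shift) :
    susp (d.map (GlobSet.shiftMap f)) = (susp d).map f :=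
  ext_word (f.app_s 0 d.base).symm (by rw [word_map, word_susp, word_susp]; rfl)
    (fun _ _ i => i) (fun _ _ _ _ h => h) (fun _ _ i => ⟨i, rfl⟩) (fun _ _ => rfl)
    (fun _ _ _ => rfl) (fun _ _ _ => rfl)

theorem susp_unit (z : X.cells (k + 1)) : susp (unit (X := X.shift) z) = unit (k := k + 1) z := by
  -- Iterated sources in `X.shift` are those of `X`, one dimension higher.
  have e : ∀ m (h : m ≤ k), X.shift.iterS (k := k) z m h =
      X.iterS (k := k + 1) z (m + 1) (Nat.succ_le_succ h) := by
    intro m h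
    induction h using Nat.decreasingInduction with
    | self => exact (X.shift.iterS_self (k := k) z).trans (X.iterS_self (k := k + 1) z).symm
    | of_succ m h ih =>
      exact (X.shift.s_iterS (k := k) z m h).symm.trans ((congrArg (X.s (m + 1)) ih).trans
        (X.s_iterS (k := k + 1) z (m + 1) (Nat.succ_le_succ h)))
  have h0 : (unit (X := X.shift) z).base = X.edge k z :=
    (e 0 (Nat.zero_le k)).trans (X.iterS_one k z)
  refine ext_word ?_ ?_ (fun _ _ i => i) (fun _ _ _ _ h => h) (fun _ _ i => ⟨i, rfl⟩)
    (fun _ _ => rfl) (fun _ _ _ => rfl) (fun m h i => e (m + 1) (Nat.le_of_succ_le_succ h))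
  · rw [base_susp, h0, base_unit]
    rfl
  · exact (word_susp _).trans ((congrArg (fun f => [f]) h0).trans (word_unit z).symm)

end LDiagram

/-- `LDiagram.susp` as a map of globular sets. -/
noncomputable def suspHom {n : ℕ} (X : GlobSet.{u} (n + 1)) :
    TObj X.shift ⟶ (TObj X).shift where
  app _ d := ⟨d.1.susp, Nat.succ_le_succ d.2⟩
  app_s _ d := Subtype.ext d.1.susp_source.symm
  app_t _ d := Subtype.ext d.1.susp_target.symm

namespace LDiagram

variable {n k : ℕ} {X Y : GlobSet.{u} (n + 1)}

/-- Suspension raises each level by one and adds a single point below, so blocks and their order are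
untouched. This makes an action on `X` restrict to an action on `X.shift`. -/
theorem comp_susp_susp (d : LDiagram k (TObj X.shift)) :
    (susp (d.map (suspHom X))).comp = susp d.comp := by
  refine comp_eq_of_word ?_ ?_ (fun m h => (d.levelIso (m + 1) (Nat.le_of_succ_le_succ h)).symm)
    (fun m h => OrderIso.strictMono _) (fun m h => OrderIso.surjective _) ?_ ?_ ?_
  · rw [base_susp, base_susp, base_comp]
    rfl
  · rw [word_susp, word_susp, base_comp]
    refine (List.flatMap_singleton _ _).trans ?_
    exact word_susp d.base.1
  · intro h a
    -- All 2-cells sit on the only letter, so every slot involved has index 0.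
    have h1 : ∀ b, ((d.levelIso 0 (Nat.zero_le k)).symm b).val = 0 := fun b => by
      have h2 : (d.comp.shape.len 0 (Nat.zero_le k)) = 1 := d.comp.shape.len_zero
      have h3 : ((d.levelIso 0 (Nat.zero_le k)).symm b).val < d.comp.shape.len 0 (Nat.zero_le k) :=
        Fin.isLt _
      omega
    refine Eq.trans ?_ (h1 _).symm
    have h2 : ∀ (D : Diagram (0 + 1)) (b : Fin (D.len 0 (Nat.zero_le _))), b.val = 0 := fun D b => by
      have := b.2
      have := D.len_zero
      omega
    have h3 : ((susp (d.map (suspHom X))).shape.v 1 h a.1).val = 0 := by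
      have h4 := (d.shape.v 0 (Nat.le_of_succ_le_succ h) a.1).2
      have h5 := d.shape.len_zero
      refine Nat.lt_one_iff.1 (lt_of_lt_of_eq h4 h5)
    rw [h3]
    simp only [List.take_zero, List.sum_nil, zero_add]
    exact h2 (d.block 1 (Nat.le_of_succ_le_succ h) a.1).shape _
  · intro m h a
    refine congrArg (d.levelIso (m + 1) _).symm ?_
    refine congrArg (d.levelMap (m + 1) (Nat.le_of_succ_le_succ h)) ?_
    exact (OrderIso.apply_symm_apply (d.levelIso (m + 2) _) a).symm
  · intro m h a
    refine congrArg (d.levelLabel (m + 1) (Nat.le_of_succ_le_succ h)) ?_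
    exact (OrderIso.apply_symm_apply (d.levelIso (m + 1) _) a).symm

end LDiagram

end Sesqui

/-! ### Composites of grafts, and rigidity of labels. -/

namespace Sesqui

namespace LDiagram

section

variable {n k : ℕ} {X : GlobSet.{u} n}

theorem base_target_one (d : LDiagram 1 X) : d.target.base = X.wordEnd d.base d.word := by
  refine (targetLabel_self d _).trans ?_
  exact (finalCell_spec _ _ _ _ _).unique (GlobSet.slot_wordEnd (d.shape.v 0 le_rfl)
    (d.lab.x 1 le_rfl) (d.lab.x 0 (Nat.le_succ 0)) _)

theorem base_edge : ∀ (k : ℕ) (p : (TObj X).cells (k + 1)),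
    baseOf ((TObj X).edge k p) = baseOf p
  | 0, _ => rfl
  | k + 1, p => base_edge k ((TObj X).s (k + 1) p)

theorem word_edge : ∀ (k : ℕ) (p : (TObj X).cells (k + 1)),
    wordOf ((TObj X).edge k p) = wordOf p
  | 0, _ => rfl
  | k + 1, p => word_edge k ((TObj X).s (k + 1) p)

theorem base_bs (k : ℕ) (p : (TObj X).cells (k + 1)) :
    baseOf ((TObj X).bs k p) = baseOf p := base_edge k p

theorem base_bt (k : ℕ) (p : (TObj X).cells (k + 1)) :
    baseOf ((TObj X).bt k p) = X.wordEnd (baseOf p) (wordOf p) := by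
  refine (base_target_one _).trans ?_
  exact congrArg₂ X.wordEnd (base_edge k p) (word_edge k p)

theorem TObj_ext_zero {p q : (TObj X).cells 0} (h : baseOf p = baseOf q) : p = q :=
  Subtype.ext (ext_zero h)

/-- By `base_bt` the 0-dimensional target of a letter of `U` is the end of its word, and this is the
base of the next letter; so the concatenated words compose. -/
theorem isWord_flatMap : ∀ (x : (TObj X).cells 0) (U : List ((TObj X).cells 1)),
    (TObj X).IsWord x U → X.IsWord (baseOf x) (U.flatMap wordOf) ∧
      X.wordEnd (baseOf x) (U.flatMap wordOf) = baseOf ((TObj X).wordEnd x U)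
  | _, [], _ => ⟨trivial, rfl⟩
  | x, p :: U, h => by
    obtain ⟨h1, h2⟩ := isWord_flatMap _ U h.2
    have h3 : baseOf x = baseOf p := congrArg baseOf h.1.symm
    have h4 : X.wordEnd (baseOf p) (wordOf p) = baseOf ((TObj X).t 0 p) := (base_bt 0 p).symm
    have h5 : X.IsWord (baseOf p) (wordOf p) := isWord_word p.1
    rw [List.flatMap_cons, GlobSet.isWord_append, GlobSet.wordEnd_append, h3, h4]
    exact ⟨⟨h5, h1⟩, h2⟩

theorem comp_v_one (d : LDiagram (k + 1) (TObj X)) (h) (a : d.Level 2 h) :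
    (d.comp.shape.v 1 h ((d.levelIso 2 h).symm a)).val =
      ((d.word.map fun p => (wordOf p).length).take (d.shape.v 1 h a.1)).sum +
        ((d.block 2 h a.1).shape.v 1 le_rfl a.2).val := by
  refine (congrArg (fun b => ((d.levelIso 1 _).symm (d.levelMap 1 h b)).val)
    (OrderIso.apply_symm_apply (d.levelIso 2 h) a)).trans ?_
  refine (sumIso_symm_toLex _ _ _).trans ?_
  refine congrArg (fun L : List ℕ => (L.take (d.shape.v 1 h a.1).val).sum +
    ((d.block 2 h a.1).shape.v 1 le_rfl a.2).val) ?_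
  rw [word, List.map_ofFn]
  exact congrArg List.ofFn (funext fun i => (length_word _).symm)

theorem comp_v_succ (d : LDiagram k (TObj X)) (m : ℕ) (h) (a : d.Level (m + 1) h) :
    d.comp.shape.v m h ((d.levelIso (m + 1) h).symm a) =
      (d.levelIso m _).symm (d.levelMap m h a) :=
  congrArg (fun b => (d.levelIso m _).symm (d.levelMap m h b))
    (OrderIso.apply_symm_apply (d.levelIso (m + 1) h) a)

theorem comp_lab (d : LDiagram k (TObj X)) (m : ℕ) (h) (a : d.Level m h) :
    d.comp.lab.x m h ((d.levelIso m h).symm a) = d.levelLabel m h a :=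
  congrArg (d.levelLabel m h) (OrderIso.apply_symm_apply (d.levelIso m h) a)

theorem isWord_flatMap_graft {x : (TObj X).cells 0} {U V : List ((TObj X).cells 1)}
    (D : LDiagram (k + 1) (TObj X)) (h : (TObj X).IsWord x (U ++ D.word ++ V)) :
    X.IsWord (baseOf x) (U.flatMap wordOf ++ D.comp.word ++ V.flatMap wordOf) := by
  have := (isWord_flatMap _ _ h).1
  rwa [List.flatMap_append, List.flatMap_append, ← word_comp] at this

/-- Composing a graft. -/
theorem comp_graft {x : (TObj X).cells 0} {U V : List ((TObj X).cells 1)}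
    (D : LDiagram (k + 1) (TObj X)) (h : (TObj X).IsWord x (U ++ D.word ++ V)) :
    (graft x U D V h).comp = graft (baseOf x) (U.flatMap wordOf) D.comp (V.flatMap wordOf)
      (isWord_flatMap_graft D h) := by
  refine comp_eq_of_word rfl ?_ (fun m h => (D.levelIso (m + 2) h).symm)
    (fun m h => OrderIso.strictMono _) (fun m h => OrderIso.surjective _) ?_ ?_ ?_
  · rw [word_graft, word_graft, List.flatMap_append, List.flatMap_append, word_comp]
  · intro h a
    rw [word_graft]
    have h1 : (D.shape.v 1 h a.1).val ≤ (D.word.map fun p => (wordOf p).length).length := by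
      rw [List.length_map, length_word]
      exact (Fin.isLt _).le
    have h2 : ((graft x U D V ‹_›).shape.v 1 h a.1).val = U.length + (D.shape.v 1 h a.1).val := rfl
    have h3 := comp_v_one D h a
    rw [h2]
    refine Eq.trans ?_ (congrArg (fun j => (U.flatMap wordOf).length + j) h3).symm
    -- The first `U.length` summands add up to the length of `U.flatMap wordOf`, which is the shift
    -- of slots in the grafted composite.
    rw [List.map_append, List.map_append, List.append_assoc, List.take_append, List.length_map,
      Nat.add_sub_cancel_left, List.take_of_length_le (by simp), List.take_append_of_le_length h1,
      List.sum_append, List.length_flatMap, Nat.add_assoc]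
    rfl
  · intro m h a
    exact (comp_v_succ D (m + 2) h a).symm
  · intro m h a
    exact (comp_lab D (m + 2) h a).symm

/-- Labelled diagrams whose labels are determined by their sources. -/
theorem eq_of_rigid {d e : LDiagram k X}
    (f : ∀ m (h : m ≤ k), Fin (d.shape.len m h) → Fin (e.shape.len m h))
    (mono : ∀ m h, StrictMono (f m h)) (surj : ∀ m h, Function.Surjective (f m h))
    (hv : ∀ m h i, f m _ (d.shape.v m h i) = e.shape.v m h (f (m + 1) h i))
    (h0 : d.base = e.base)
    (hx : ∀ m h i, X.s m (d.lab.x (m + 1) h i) = X.s m (e.lab.x (m + 1) h (f (m + 1) h i)) →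
      d.lab.x (m + 1) h i = e.lab.x (m + 1) h (f (m + 1) h i)) : d = e := by
  refine eq_of_iso f mono surj hv fun m => ?_
  -- Outer induction on the dimension, inner induction on the position: the source of a label is
  -- determined by labels of lower dimension and by earlier labels of its level, so the sources
  -- agree and `hx` applies.
  induction m with
  | zero => exact fun h i => (d.lab_zero i).trans (h0.trans (e.lab_zero _).symm)
  | succ m ih =>
    intro h i
    induction i using WellFoundedLT.induction with
    | ind i ihi =>
      refine hx m h i ((?_ : IsSlotCell _ _ _ _ _ _ _).unique (e.lab.src m h (f (m + 1) h i)))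
      rcases d.lab.src m h i with ⟨hn, hc⟩ | ⟨p, hp, hc⟩
      · refine Or.inl ⟨fun a ha he => ?_, ?_⟩
        · obtain ⟨a, rfl⟩ := surj _ _ a
          rw [← hv, ← hv] at he
          exact hn a ((mono _ _).lt_iff_lt.1 ha) ((mono _ _).injective he)
        · rw [hc, ih, hv]
      · refine Or.inr ⟨f (m + 1) h p, ⟨⟨mono _ _ hp.1.1, ?_⟩, fun a ha => ?_⟩, ?_⟩
        · rw [← hv, hp.1.2, hv]
        · obtain ⟨a, rfl⟩ := surj _ _ a
          have he := ha.2
          rw [← hv, ← hv] at he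
          exact (mono _ _).monotone (hp.2 ⟨(mono _ _).lt_iff_lt.1 ha.1, (mono _ _).injective he⟩)
        · rw [hc, ihi p hp.1.1]

end

section

variable {n k : ℕ} {X : GlobSet.{u} (n + 1)} {Y : GlobSet.{u} n}

/-- Adding strings to a family of diagrams. -/
noncomputable def graftHom (i : Y ⟶ (TObj X).shift) (x : X.cells 0) (l r : List (X.cells 1))
    (h : ∀ k (y : Y.cells k), X.IsWord x (l ++ wordOf (i.app k y) ++ r)) :
    Y ⟶ (TObj X).shift where
  app k y := ⟨graft x l (i.app k y).1 r (h k y), (i.app k y).2⟩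
  app_s k y := Subtype.ext ((graft_congr (h k _) rfl rfl (congrArg Subtype.val (i.app_s k y)) rfl).trans
    (source_graft (i.app (k + 1) y).1 (h (k + 1) y)).symm)
  app_t k y := Subtype.ext ((graft_congr (h k _) rfl rfl (congrArg Subtype.val (i.app_t k y)) rfl).trans
    (target_graft (i.app (k + 1) y).1 (h (k + 1) y) _).symm)

theorem susp_v_one (d : LDiagram k X.shift) (h) (i) : ((susp d).shape.v 1 h i).val = 0 := by
  have h4 := (d.shape.v 0 (Nat.le_of_succ_le_succ h) i).2
  have h5 := d.shape.len_zero
  exact Nat.lt_one_iff.1 (lt_of_lt_of_eq h4 h5)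

theorem word_comp_susp (D : LDiagram k (TObj X).shift) :
    (susp D).comp.word = wordOf (k := 0) D.base := by
  rw [word_comp, word_susp]
  exact List.flatMap_singleton _ _

theorem base_comp_susp (D : LDiagram k (TObj X).shift) :
    (susp D).comp.base = baseOf (k := 1) D.base := base_comp _

theorem isWord_graft_comp_susp (i : Y ⟶ (TObj X).shift) (x : X.cells 0) (l r : List (X.cells 1))
    (h : ∀ k (y : Y.cells k), X.IsWord x (l ++ wordOf (i.app k y) ++ r)) (D : LDiagram k Y) :
    X.IsWord x (l ++ (susp (D.map i)).comp.word ++ r) := by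
  rw [word_comp_susp]
  exact h 0 D.base

/-- Adding strings to a composite of diagrams with a single string. -/
theorem graft_comp_susp (i : Y ⟶ (TObj X).shift) (x : X.cells 0) (l r : List (X.cells 1))
    (h : ∀ k (y : Y.cells k), X.IsWord x (l ++ wordOf (i.app k y) ++ r)) (D : LDiagram k Y) :
    (susp (D.map (graftHom i x l r h))).comp =
      graft x l (susp (D.map i)).comp r (isWord_graft_comp_susp i x l r h D) := by
  refine comp_eq_of_word rfl ?_ (fun m h a => ((susp (D.map i)).levelIso (m + 2) h).symm a)
    (fun m h => OrderIso.strictMono _) (fun m h => OrderIso.surjective _) ?_ ?_ ?_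
  · rw [← word_comp, word_comp_susp, word_graft, word_comp_susp]
    exact word_graft (i.app 0 D.base).1 (h 0 D.base)
  · intro h a
    refine Eq.trans ?_
      (congrArg (fun j => l.length + j) (comp_v_one (susp (D.map i)) h a)).symm
    -- All blocks stand over the only string, so no words precede them, and the shift by `l.length`
    -- already takes place inside each grafted label.
    rw [susp_v_one, susp_v_one]
    simp only [List.take_zero, List.sum_nil, zero_add]
    rfl
  · intro m h a
    exact (comp_v_succ (susp (D.map i)) (m + 2) h a).symm
  · intro m h a
    exact (comp_lab (susp (D.map i)) (m + 2) h a).symm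

end

end LDiagram

end Sesqui

/-! ### Whiskered cells and their assembly into diagrams. -/

namespace Sesqui

variable {n : ℕ}

/-- A composable sequence of `1`-cells. -/
@[ext]
structure Str (X : GlobSet.{u} n) where
  base : X.cells 0
  word : List (X.cells 1)
  isWord : X.IsWord base word

/-- A cell of dimension at least `2`, whiskered by composable sequences of `1`-cells. -/
@[ext]
structure Whisk (X : GlobSet.{u} n) (k : ℕ) where
  base : X.cells 0
  left : List (X.cells 1)
  cell : X.cells (k + 2)
  right : List (X.cells 1)
  isWord : X.IsWord base (left ++ [X.edge (k + 1) cell] ++ right)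

/-- Replacing the whiskered cell by its source. -/
def Whisk.src {X : GlobSet.{u} n} {k : ℕ} (z : Whisk X (k + 1)) : Whisk X k :=
  ⟨z.base, z.left, X.s (k + 2) z.cell, z.right, z.isWord⟩

/-- Replacing the whiskered cell by its target. -/
def Whisk.tgt {X : GlobSet.{u} n} {k : ℕ} (z : Whisk X (k + 1)) : Whisk X k :=
  ⟨z.base, z.left, X.t (k + 2) z.cell, z.right, by rw [X.edge_t]; exact z.isWord⟩

/-- The source of a whiskered `2`-cell. -/
def Whisk.srcStr {X : GlobSet.{u} n} (z : Whisk X 0) : Str X :=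
  ⟨z.base, z.left ++ [X.s 1 z.cell] ++ z.right, z.isWord⟩

/-- The target of a whiskered `2`-cell. -/
def Whisk.tgtStr {X : GlobSet.{u} n} (z : Whisk X 0) : Str X :=
  ⟨z.base, z.left ++ [X.t 1 z.cell] ++ z.right, by
    have h := z.isWord
    simp only [GlobSet.isWord_append, GlobSet.isWord_cons, GlobSet.wordEnd_append,
      GlobSet.wordEnd_cons, GlobSet.edge] at h ⊢
    rwa [← X.ss, ← X.tt]⟩

/-- The globular set of formal composites of `1`-cells and of formally whiskered cells. -/
def whiskSet (X : GlobSet.{u} (n + 1)) : GlobSet.{u} n where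
  cells k := match k with
    | 0 => Str X
    | k + 1 => Whisk X k
  s k := match k with
    | 0 => Whisk.srcStr
    | _ + 1 => Whisk.src
  t k := match k with
    | 0 => Whisk.tgtStr
    | _ + 1 => Whisk.tgt
  ss k z := match k with
    | 0 => Str.ext rfl (congrArg (fun c => z.left ++ [c] ++ z.right) (X.ss 1 z.cell))
    | k + 1 => Whisk.ext rfl rfl (X.ss (k + 2) z.cell) rfl
  tt k z := match k with
    | 0 => Str.ext rfl (congrArg (fun c => z.left ++ [c] ++ z.right) (X.tt 1 z.cell))
    | k + 1 => Whisk.ext rfl rfl (X.tt (k + 2) z.cell) rfl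
  isEmpty k hk := match k with
    | 0 => absurd hk (Nat.not_lt_zero _)
    | k + 1 => ⟨fun z => (X.isEmpty (k + 2) (Nat.succ_lt_succ hk)).false z.cell⟩

/-- The action of maps of globular sets on whiskered cells. -/
def whiskSetMap {X Y : GlobSet.{u} (n + 1)} (f : X ⟶ Y) : whiskSet X ⟶ whiskSet Y where
  app k := match k with
    | 0 => fun z : Str X => (⟨_, _, GlobSet.isWord_map f z.base z.word z.isWord⟩ : Str Y)
    | k + 1 => fun z : Whisk X k =>
      (⟨f.app 0 z.base, z.left.map (f.app 1), f.app (k + 2) z.cell, z.right.map (f.app 1), by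
        have := GlobSet.isWord_map f z.base _ z.isWord
        rw [List.map_append, List.map_append] at this
        rw [← f.app_edge]
        exact this⟩ : Whisk Y k)
  app_s k z := match k with
    | 0 => Str.ext rfl (by
        change List.map _ (z.left ++ [X.s 1 z.cell] ++ z.right) =
          z.left.map _ ++ [Y.s 1 (f.app 2 z.cell)] ++ z.right.map _
        rw [List.map_append, List.map_append, ← f.app_s]
        rfl)
    | k + 1 => Whisk.ext rfl rfl (f.app_s (k + 2) z.cell) rfl
  app_t k z := match k with
    | 0 => Str.ext rfl (by
        change List.map _ (z.left ++ [X.t 1 z.cell] ++ z.right) =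
          z.left.map _ ++ [Y.t 1 (f.app 2 z.cell)] ++ z.right.map _
        rw [List.map_append, List.map_append, ← f.app_t]
        rfl)
    | k + 1 => Whisk.ext rfl rfl (f.app_t (k + 2) z.cell) rfl

/-- A cell of positive dimension as a whiskered cell. -/
def whiskUnit (X : GlobSet.{u} (n + 1)) : X.shift ⟶ whiskSet X where
  app k := match k with
    | 0 => fun z : X.cells 1 => (⟨X.s 0 z, [z], rfl, trivial⟩ : Str X)
    | k + 1 => fun z : X.cells (k + 2) =>
      (⟨X.bs (k + 1) z, [], z, [], rfl, trivial⟩ : Whisk X k)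
  app_s k _ := match k with
    | 0 => rfl
    | _ + 1 => rfl
  app_t k z := match k with
    | 0 => Str.ext (X.ss 0 z).symm rfl
    | k + 1 => Whisk.ext (X.bs_t (k + 1) z) rfl rfl rfl

open LDiagram

/-- The diagram of a composable sequence. -/
noncomputable def Str.diagram {X : GlobSet.{u} n} (z : Str X) : LDiagram 1 X :=
  string z.base z.word z.isWord

theorem Str.word_diagram {X : GlobSet.{u} n} (z : Str X) : z.diagram.word = z.word :=
  word_string _ _ _

/-- The diagram of a whiskered cell. -/
noncomputable def Whisk.diagram {X : GlobSet.{u} n} {k : ℕ} (z : Whisk X k) : LDiagram (k + 2) X :=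
  graft z.base z.left (unit z.cell) z.right (by rw [word_unit]; exact z.isWord)

theorem Whisk.diagram_srcStr {X : GlobSet.{u} n} (z : Whisk X 0) :
    z.srcStr.diagram = z.diagram.source := by
  refine ext_word_one rfl ((word_string _ _ _).trans ?_)
  rw [word_source, diagram, word_graft, word_unit]
  rfl

theorem Whisk.diagram_tgtStr {X : GlobSet.{u} n} (z : Whisk X 0) :
    z.tgtStr.diagram = z.diagram.target := by
  refine ext_word_one (base_target z.diagram).symm ((word_string _ _ _).trans ?_)
  rw [diagram, word_target_graft, unit_target, word_unit]
  rfl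

theorem Whisk.diagram_src {X : GlobSet.{u} n} {k : ℕ} (z : Whisk X (k + 1)) :
    z.src.diagram = z.diagram.source :=
  ((source_graft _ _).trans (graft_congr _ rfl rfl (unit_source z.cell) rfl)).symm

theorem Whisk.diagram_tgt {X : GlobSet.{u} n} {k : ℕ} (z : Whisk X (k + 1)) :
    z.tgt.diagram = z.diagram.target :=
  ((target_graft _ _ (by rw [word_target, word_unit]; exact z.isWord)).trans
    (graft_congr _ rfl rfl (unit_target z.cell) rfl)).symm

/-- The inclusion of whiskered cells into labelled diagrams. -/
noncomputable def whiskDiagram (X : GlobSet.{u} (n + 1)) : whiskSet X ⟶ (TObj X).shift where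
  app k := match k with
    | 0 => fun z : Str X => ⟨z.diagram, Nat.le_add_left _ _⟩
    | k + 1 => fun z : Whisk X k => ⟨z.diagram,
        not_lt.1 fun h => (X.isEmpty (k + 2) h).false z.cell⟩
  app_s k z := match k with
    | 0 => Subtype.ext (Whisk.diagram_srcStr z)
    | _ + 1 => Subtype.ext (Whisk.diagram_src z)
  app_t k z := match k with
    | 0 => Subtype.ext (Whisk.diagram_tgtStr z)
    | _ + 1 => Subtype.ext (Whisk.diagram_tgt z)

theorem whiskDiagram_natural {X Y : GlobSet.{u} (n + 1)} (f : X ⟶ Y) :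
    whiskDiagram X ≫ GlobSet.shiftMap (TMap f) = whiskSetMap f ≫ whiskDiagram Y := by
  refine GlobSet.hom_ext fun k z => ?_
  match k with
  | 0 =>
    refine Subtype.ext ?_
    exact map_string f (Str.isWord z)
  | k + 1 =>
    have h := Whisk.isWord ((whiskSetMap f).app (k + 1) z)
    refine Subtype.ext ?_
    refine (map_graft f _ (by rw [word_unit]; exact Whisk.isWord z) ?_).trans (graft_congr _ rfl rfl (map_unit f (Whisk.cell z)) rfl)
    rw [map_unit, word_unit]
    exact h

theorem whiskUnit_diagram (X : GlobSet.{u} (n + 1)) :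
    whiskUnit X ≫ whiskDiagram X = GlobSet.shiftMap (TUnit X) := by
  refine GlobSet.hom_ext fun k z => Subtype.ext ?_
  match k with
  | 0 =>
    refine ext_word_one ?_ ?_
    · exact (base_unit (X := X) (k := 0) z).symm
    · exact (Str.word_diagram _).trans (word_unit (X := X) (k := 0) z).symm
  | k + 1 =>
    refine Eq.trans ?_ (graft_nil (unit (X := X) (k := k + 2) z) (by simpa using isWord_word _))
    exact graft_congr (by rw [word_unit]; exact Whisk.isWord ((whiskUnit X).app (k + 1) z))
      (base_unit _).symm rfl rfl rfl

/-- Assembling a diagram labelled by whiskered cells. -/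
noncomputable def assemble (X : GlobSet.{u} (n + 1)) : TObj (whiskSet X) ⟶ (TObj X).shift :=
  TMap (whiskDiagram X) ≫ suspHom (TObj X) ≫ GlobSet.shiftMap (TMult X)

theorem assemble_natural {X Y : GlobSet.{u} (n + 1)} (f : X ⟶ Y) :
    assemble X ≫ GlobSet.shiftMap (TMap f) = TMap (whiskSetMap f) ≫ assemble Y := by
  refine GlobSet.hom_ext fun k e => Subtype.ext ?_
  have h1 : (e.1.map (whiskDiagram X)).map (GlobSet.shiftMap (TMap f)) =
      (e.1.map (whiskSetMap f)).map (whiskDiagram Y) :=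
    congrArg e.1.map (whiskDiagram_natural f)
  refine (comp_map f _).symm.trans (congrArg comp ?_)
  exact (susp_map (TMap f) _).symm.trans (congrArg susp h1)

/-- Assembling a single whiskered cell. -/
theorem assemble_unit (X : GlobSet.{u} (n + 1)) (k : ℕ) (z : (whiskSet X).cells k) :
    (assemble X).app k ((TUnit (whiskSet X)).app k z) = (whiskDiagram X).app k z := by
  refine Subtype.ext ?_
  have h1 : (susp ((unit z).map (whiskDiagram X))).comp =
      (unit (X := TObj X) (k := k + 1) ((whiskDiagram X).app k z)).comp :=
    congrArg comp ((congrArg susp (map_unit (whiskDiagram X) z)).trans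
      (susp_unit (X := TObj X) ((whiskDiagram X).app k z)))
  exact h1.trans (comp_unit _ ((whiskDiagram X).app k z).2)

/-- A diagram with a single string, assembled from unwhiskered cells. -/
theorem assemble_susp (X : GlobSet.{u} (n + 1)) :
    TMap (whiskUnit X) ≫ assemble X = suspHom X := by
  refine GlobSet.hom_ext fun k d => Subtype.ext ?_
  have h1 : (d.1.map (whiskUnit X)).map (whiskDiagram X) =
      d.1.map (GlobSet.shiftMap (TUnit X)) := congrArg d.1.map (whiskUnit_diagram X)
  refine (congrArg (fun e => (susp e).comp) h1).trans ?_
  refine (congrArg comp (susp_map (TUnit X) d.1)).trans ?_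
  exact comp_map_unit _

/-- Assembling is compatible with composition. -/
theorem assemble_comp (X : GlobSet.{u} (n + 1)) :
    TMap (assemble X) ≫ suspHom (TObj X) ≫ GlobSet.shiftMap (TMult X) =
      TMult (whiskSet X) ≫ assemble X := by
  refine GlobSet.hom_ext fun k e => Subtype.ext ?_
  change (susp (e.1.map (assemble X))).comp = (susp (e.1.comp.map (whiskDiagram X))).comp
  have h1 : e.1.comp.map (whiskDiagram X) = (e.1.map (TMap (whiskDiagram X))).comp :=
    (comp_map (whiskDiagram X) e.1).symm
  -- Once the inner composition is written as the composite of a suspension, the claim is the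
  -- associativity `comp_comp`.
  rw [h1, ← comp_susp_susp, comp_comp, ← susp_map]
  rfl

end Sesqui

/-! ### Unique decomposition of diagrams into whiskered cells. -/

namespace Sesqui

open LDiagram

variable {n k : ℕ}

namespace LDiagram

section

variable {X : GlobSet.{u} n}

/-- The composable sequence of `1`-cells which is present before the `a`-th cell of dimension `2`
is attached. -/
def env (d : LDiagram (k + 2) X) : ℕ → List (X.cells 1)
  | 0 => d.word
  | a + 1 => if h : a < d.shape.len 2 (Nat.le_add_left 2 k) then
      (env d a).set (d.shape.v 1 _ ⟨a, h⟩) (X.t 1 (d.lab.x 2 _ ⟨a, h⟩)) else env d a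

theorem length_env (d : LDiagram (k + 2) X) (a : ℕ) :
    (env d a).length = d.shape.len 1 (Nat.le_add_left 1 _) := by
  induction a with
  | zero => exact d.length_word
  | succ a ih =>
    rw [env]
    split_ifs
    · rw [List.length_set, ih]
    · exact ih

/-- The list is updated in the order of attachment, so its letter at `q` is what the slot `q`
carries after the first `a` cells. -/
theorem env_slot (d : LDiagram (k + 2) X) (a : ℕ) (ha : a ≤ d.shape.len 2 (Nat.le_add_left 2 k))
    (q : Fin (d.shape.len 1 (Nat.le_add_left 1 _))) :
    IsSlotCell (X.t 1) (d.shape.v 1 (Nat.le_add_left 2 k)) (d.lab.x 2 _) (d.lab.x 1 _)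
      {j | j.val < a} q ((env d a)[q.val]'(by rw [length_env]; exact q.2)) := by
  induction a with
  | zero =>
    exact Or.inl ⟨fun j hj => absurd hj (Nat.not_lt_zero _), d.getElem_word _ _⟩
  | succ a ih =>
    have e : env d (a + 1) = _ := dif_pos ha
    simp only [e]
    by_cases hq : (d.shape.v 1 _ ⟨a, ha⟩) = q
    · subst hq
      exact Or.inr ⟨⟨a, ha⟩, ⟨⟨Nat.lt_succ_self a, rfl⟩, fun j hj => Nat.le_of_lt_succ hj.1⟩,
        by rw [List.getElem_set_self]⟩
    · rw [List.getElem_set_ne (fun h => hq (Fin.ext h))]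
      refine (ih (Nat.le_of_succ_le ha)).extend (fun j hj => Nat.lt_succ_of_lt hj)
        fun j hj hv => lt_of_le_of_ne (Nat.le_of_lt_succ hj) fun h => hq ?_
      rw [← hv]
      exact congrArg _ (Fin.ext h.symm)

theorem getElem_env (d : LDiagram (k + 2) X) (a : Fin (d.shape.len 2 (Nat.le_add_left 2 k))) :
    (env d a)[(d.shape.v 1 (Nat.le_add_left 2 k) a).val]'(by rw [length_env]; exact Fin.isLt _) =
      X.s 1 (d.lab.x 2 (Nat.le_add_left 2 k) a) :=
  (env_slot d a a.2.le _).unique (d.lab.src 1 _ a)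

theorem env_succ (d : LDiagram (k + 2) X) (a : Fin (d.shape.len 2 (Nat.le_add_left 2 k))) :
    env d (a + 1) = (env d a).set (d.shape.v 1 _ a) (X.t 1 (d.lab.x 2 _ a)) :=
  dif_pos a.2

/-- Each update replaces the source of a 2-cell by its target, which is parallel to it by
globularity. -/
theorem isWord_env (d : LDiagram (k + 2) X) (a : ℕ) : X.IsWord d.base (env d a) := by
  induction a with
  | zero => exact d.isWord_word
  | succ a ih =>
    by_cases h : a < d.shape.len 2 (Nat.le_add_left 2 k)
    · rw [env_succ d ⟨a, h⟩]
      refine GlobSet.isWord_set ih (by rw [length_env]; exact Fin.isLt _) ?_ ?_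
      · rw [getElem_env d ⟨a, h⟩, X.ss]
      · rw [getElem_env d ⟨a, h⟩, X.tt]
    · rw [env, dif_neg h]
      exact ih

/-- The cell of dimension `2` on which a cell of higher dimension is stacked. -/
def anc (d : LDiagram (k + 2) X) : ∀ m (h : m + 2 ≤ k + 2), Fin (d.shape.len (m + 2) h) →
    Fin (d.shape.len 2 (Nat.le_add_left 2 k))
  | 0, _, i => i
  | m + 1, h, i => anc d m (Nat.le_of_succ_le h) (d.shape.v (m + 2) h i)

/-- The source of a cell is parallel to the cell labelling its slot (`parallel_aux`), so the
iterated source in dimension 1 is inherited down to the 2-cell at the bottom of the stack. Hence the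
whole stack can carry the same whiskers. -/
theorem edge_lab (d : LDiagram (k + 2) X) : ∀ m (h : m + 2 ≤ k + 2) (i),
    X.edge (m + 1) (d.lab.x (m + 2) h i) = X.s 1 (d.lab.x 2 _ (anc d m h i))
  | 0, _, _ => rfl
  | m + 1, h, i => (congrArg (X.edge m) (d.parallel_aux (m + 1) h i).1).trans
      (edge_lab d m (Nat.le_of_succ_le h) (d.shape.v (m + 2) h i))

/-- The list `env d a`, split at the slot of the `a`-th cell of dimension `2`. -/
theorem env_split (d : LDiagram (k + 2) X) (a : Fin (d.shape.len 2 (Nat.le_add_left 2 k))) :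
    (env d a).take (d.shape.v 1 (Nat.le_add_left 2 k) a) ++ [X.s 1 (d.lab.x 2 _ a)] ++
      (env d a).drop ((d.shape.v 1 (Nat.le_add_left 2 k) a) + 1) = env d a := by
  rw [← getElem_env, List.append_assoc, List.singleton_append, List.getElem_cons_drop,
    List.take_append_drop]

/-- A cell stacked on the `a`-th cell of dimension `2`, whiskered by the other `1`-cells which are
present. -/
def whiskAt (d : LDiagram (k + 2) X) (a : Fin (d.shape.len 2 (Nat.le_add_left 2 k))) (m : ℕ)
    (z : X.cells (m + 2)) (hz : X.edge (m + 1) z = X.s 1 (d.lab.x 2 _ a)) : Whisk X m where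
  base := d.base
  left := (env d a).take (d.shape.v 1 _ a)
  cell := z
  right := (env d a).drop ((d.shape.v 1 (Nat.le_add_left 2 k) a) + 1)
  isWord := by
    rw [hz, env_split]
    exact d.isWord_env a

theorem whiskAt_srcStr (d : LDiagram (k + 2) X) (a) (z : X.cells 2) (hz) :
    (whiskAt d a 0 z hz).srcStr = ⟨d.base, env d a, isWord_env d a⟩ :=
  Str.ext rfl ((congrArg (fun f => (env d a).take _ ++ [f] ++ (env d a).drop _) hz).trans
    (env_split d a))

/-- Together with `whiskAt_srcStr`: the `a`-th whiskered 2-cell leads from the string before its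
attachment to the string after it, so consecutive whiskered 2-cells compose. -/
theorem whiskAt_tgtStr (d : LDiagram (k + 2) X) (a) :
    (whiskAt d a 0 (d.lab.x 2 _ a) rfl).tgtStr = ⟨d.base, env d (a + 1), isWord_env d _⟩ := by
  refine Str.ext rfl (Eq.trans ?_ (env_succ d a).symm)
  rw [List.set_eq_take_append_cons_drop, if_pos (by rw [length_env]; exact Fin.isLt _)]
  exact List.append_assoc _ _ _

end

section

variable {X : GlobSet.{u} (n + 1)}

/-- A diagram as a diagram of whiskered cells. -/
def flatten (d : LDiagram (k + 2) X) : LDiagram (k + 1) (whiskSet X) where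
  shape :=
    { len m h := match m, h with
        | 0, _ => 1
        | m + 1, h => d.shape.len (m + 2) (Nat.succ_le_succ h)
      v m h := match m, h with
        | 0, _ => fun _ => (0 : Fin 1)
        | m + 1, h => d.shape.v (m + 2) (Nat.succ_le_succ h)
      len_zero := rfl }
  lab :=
    { x m h := match m, h with
        | 0, _ => fun _ => (⟨d.base, d.word, d.isWord_word⟩ : Str X)
        | m + 1, h => fun i => whiskAt d (anc d m (Nat.succ_le_succ h) i) m (d.lab.x (m + 2) _ i)
            (edge_lab d m _ i)
      src m h i := by
        match m, h with
        | 0, h =>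
          -- All whiskered 2-cells form one fibre over the initial string, so the predecessor of `a
          -- + 1` is `a`.
          obtain ⟨_ | a, ha⟩ := i
          · exact Or.inl ⟨fun j hj => absurd hj (Nat.not_lt_zero _), whiskAt_srcStr d _ _ _⟩
          · refine Or.inr ⟨⟨a, Nat.lt_of_succ_lt ha⟩, ⟨⟨Nat.lt_succ_self a, rfl⟩, fun j hj =>
              Nat.le_of_lt_succ hj.1⟩, ?_⟩
            exact (whiskAt_srcStr d _ _ _).trans (whiskAt_tgtStr d ⟨a, Nat.lt_of_succ_lt ha⟩).symm
        | m + 1, h =>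
          rcases d.lab.src (m + 2) (Nat.succ_le_succ h) i with ⟨hn, hc⟩ | ⟨p, hp, hc⟩
          · exact Or.inl ⟨hn, Whisk.ext rfl rfl hc rfl⟩
          · refine Or.inr ⟨p, hp, ?_⟩
            -- Cells of one fibre rest on the same 2-cell, so their whiskers agree.
            have h1 : anc d (m + 1) (Nat.succ_le_succ h) i = anc d (m + 1) _ p :=
              congrArg (anc d m _) hp.1.2.symm
            change (whiskAt d (anc d (m + 1) _ i) (m + 1) _ _).src =
              (whiskAt d (anc d (m + 1) _ p) (m + 1) _ _).tgt
            refine Whisk.ext rfl ?_ hc ?_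
            · exact congrArg (fun a : Fin (d.shape.len 2 _) => (env d a).take (d.shape.v 1 _ a)) h1
            · exact congrArg (fun a : Fin (d.shape.len 2 _) => (env d a).drop ((d.shape.v 1 _ a).val + 1)) h1 }

/-- Whiskers add 1-cells only, so each label above the bottom contributes exactly one top cell and
the levels of the composite are those of `d`. -/
theorem comp_susp_flatten (d : LDiagram (k + 2) X) :
    (susp ((flatten d).map (whiskDiagram X))).comp = d := by
  have hw : (susp ((flatten d).map (whiskDiagram X))).comp.word = d.word :=
    (word_comp_susp _).trans (Str.word_diagram ⟨d.base, d.word, d.isWord_word⟩)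
  rw [word_comp] at hw
  refine comp_eq_of_word rfl hw (fun m h a => a.1) ?_ ?_ ?_ ?_ ?_
  · rintro m h ⟨i, r⟩ ⟨i', r'⟩ hlt
    rcases Sigma.lex_iff.1 hlt with hlt | ⟨heq, hlt⟩
    · exact hlt
    · obtain rfl : i = i' := heq
      obtain rfl : r = r' := Subsingleton.elim (α := Fin 1) r r'
      exact absurd hlt (lt_irrefl r)
  · intro m h r
    exact ⟨toLex ⟨r, (0 : Fin 1)⟩, rfl⟩
  · rintro h ⟨i, r⟩
    rw [susp_v_one]
    simp only [List.take_zero, List.sum_nil, zero_add]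
    obtain rfl : r = (0 : Fin 1) := Subsingleton.elim (α := Fin 1) _ _
    -- The slot in a whiskered cell is the length of its left whisker, which was cut at the slot in
    -- `d`.
    refine Eq.trans (b := ((env d i).take (d.shape.v 1 h i)).length) rfl ?_
    rw [List.length_take, length_env, Nat.min_eq_left (Fin.isLt _).le]
  · rintro m h ⟨i, r⟩
    rfl
  · rintro m h ⟨i, r⟩
    exact X.iterS_self _

/-- The length of the left whisker cannot be dropped: the source of the cell may occur several times
in the source string. -/
theorem _root_.Sesqui.Whisk.ext_srcStr {X : GlobSet.{u} n} {z z' : Whisk X 0}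
    (h : z.srcStr = z'.srcStr) (hc : z.cell = z'.cell) (hl : z.left.length = z'.left.length) :
    z = z' := by
  have h1 : z.left ++ ([X.s 1 z.cell] ++ z.right) = z'.left ++ ([X.s 1 z'.cell] ++ z'.right) := by
    rw [← List.append_assoc, ← List.append_assoc]
    exact congrArg Str.word h
  obtain ⟨h2, h3⟩ := List.append_inj h1 hl
  exact Whisk.ext (congrArg Str.base h :) h2 hc (List.append_inj h3 rfl).2

theorem _root_.Sesqui.Whisk.ext_src {X : GlobSet.{u} n} {z z' : Whisk X (k + 1)}
    (h : z.src = z'.src) (hc : z.cell = z'.cell) : z = z' :=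
  Whisk.ext (congrArg Whisk.base h :) (congrArg Whisk.left h :) hc (congrArg Whisk.right h :)

/-- By `eq_of_rigid` the whiskers need no separate comparison: a whiskered cell is determined by its
source, its cell and, in the lowest dimension, the length of its left whisker. The cell is the top
label of the composite and the length is its slot. -/
theorem flatten_comp_susp (e : LDiagram (k + 1) (whiskSet X)) :
    flatten (susp (e.map (whiskDiagram X))).comp = e := by
  set D := susp (e.map (whiskDiagram X)) with hD
  have hcell : ∀ m (h : m + 2 ≤ k + 2) (p : Fin (D.comp.shape.len (m + 2) h)),
      D.comp.lab.x (m + 2) h p = Whisk.cell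
        (e.lab.x (m + 1) (Nat.le_of_succ_le_succ h) (D.levelIso (m + 2) h p).1) :=
    fun m h p => X.iterS_self _
  refine eq_of_rigid (fun m h => match m, h with
    | 0, _ => Fin.cast e.shape.len_zero.symm
    | m + 1, h => fun p => (D.levelIso (m + 2) (Nat.succ_le_succ h) p).1) ?_ ?_ ?_ ?_ ?_
  · intro m h
    match m, h with
    | 0, _ => exact fun _ _ h => h
    | m + 1, h =>
      intro p p' hlt
      rcases Sigma.lex_iff.1 ((D.levelIso (m + 2) (Nat.succ_le_succ h)).strictMono hlt) with
        hlt | ⟨heq, hlt⟩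
      · exact hlt
      · revert hlt heq
        generalize (D.levelIso (m + 2) (Nat.succ_le_succ h)) p = a
        generalize (D.levelIso (m + 2) (Nat.succ_le_succ h)) p' = b
        obtain ⟨i, r⟩ := a
        obtain ⟨i', r'⟩ := b
        intro heq hlt
        obtain rfl : i = i' := heq
        obtain rfl : r = r' := Subsingleton.elim (α := Fin 1) r r'
        exact absurd hlt (lt_irrefl r)
  · intro m h
    match m, h with
    | 0, _ => exact fun i => ⟨Fin.cast e.shape.len_zero i, rfl⟩
    | m + 1, h =>
      intro i
      obtain ⟨p, hp⟩ := (D.levelIso (m + 2) (Nat.succ_le_succ h)).surjective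
        (toLex ⟨i, (0 : Fin 1)⟩)
      exact ⟨p, congrArg Sigma.fst hp⟩
  · intro m h p
    match m, h with
    | 0, _ => exact Subsingleton.elim _ _
    | m + 1, h =>
      exact congrArg Sigma.fst (OrderIso.apply_symm_apply (D.levelIso (m + 2) _) _)
  · refine Str.ext (base_comp_susp (e.map (whiskDiagram X))) ?_
    exact (word_comp_susp (e.map (whiskDiagram X))).trans (Str.word_diagram (X := X) e.base)
  · intro m h p hs
    match m, h with
    | 0, h =>
      refine Whisk.ext_srcStr hs (hcell 0 _ p) ?_
      refine (List.length_take ..).trans ?_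
      rw [length_env, Nat.min_eq_left (Fin.isLt _).le]
      -- The slot of a 2-cell in the composite is the slot inside its block, that is, the length of
      -- the left whisker of the label of `e`.
      have h1 := comp_v_one D (Nat.succ_le_succ h) (D.levelIso 2 (Nat.succ_le_succ h) p)
      refine (congrArg (fun q => (D.comp.shape.v 1 _ q).val)
        (OrderIso.symm_apply_apply (D.levelIso 2 _) p)).symm.trans (h1.trans ?_)
      rw [susp_v_one (e.map (whiskDiagram X)) (Nat.succ_le_succ h)
        (D.levelIso 2 (Nat.succ_le_succ h) p).1]
      simp only [List.take_zero, List.sum_nil, zero_add]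
      generalize (D.levelIso 2 (Nat.succ_le_succ h)) p = a
      obtain ⟨i, r⟩ := a
      obtain rfl : r = (0 : Fin 1) := Subsingleton.elim (α := Fin 1) _ _
      rfl
    | m + 1, h => exact Whisk.ext_src hs (hcell (m + 1) _ p)

end

end LDiagram

theorem str_surjective {X : GlobSet.{u} n} (d : LDiagram 1 X) : ∃ z : Str X, z.diagram = d :=
  ⟨⟨d.base, d.word, d.isWord_word⟩, string_base_word d⟩

theorem str_injective {X : GlobSet.{u} n} {z z' : Str X} (h : z.diagram = z'.diagram) : z = z' :=
  Str.ext (congrArg LDiagram.base h :) (by rw [← z.word_diagram, h, z'.word_diagram])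

theorem eq_unit {X : GlobSet.{u} n} (d : LDiagram 0 X) : d = LDiagram.unit d.base :=
  ext_zero (X.iterS_self _).symm

/-- The combinatorial core. In dimension 0 both sides are strings; above, `flatten` is a two-sided
inverse. -/
theorem assemble_bijective (X : GlobSet.{u} (n + 1)) :
    ∀ k, Function.Bijective ((assemble X).app k)
  | 0 => by
    have h0 : ∀ e : (TObj (whiskSet X)).cells 0,
        (assemble X).app 0 e = (whiskDiagram X).app 0 e.1.base := fun e => by
      refine Eq.trans ?_ (assemble_unit X 0 e.1.base)
      exact congrArg ((assemble X).app 0) (Subtype.ext (eq_unit e.1))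
    constructor
    · intro e e' h
      rw [h0, h0] at h
      exact Subtype.ext (ext_zero (str_injective (congrArg Subtype.val h)))
    · intro d
      obtain ⟨z, hz⟩ := str_surjective d.1
      refine ⟨(TUnit (whiskSet X)).app 0 z, (assemble_unit X 0 z).trans (Subtype.ext hz)⟩
  | k + 1 => by
    constructor
    · intro e e' h
      have h1 := congrArg flatten (congrArg Subtype.val h)
      exact Subtype.ext ((flatten_comp_susp e.1).symm.trans (h1.trans (flatten_comp_susp e'.1)))
    · intro d
      exact ⟨⟨flatten d.1, Nat.le_of_succ_le_succ d.2⟩, Subtype.ext (comp_susp_flatten d.1)⟩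

end Sesqui

/-! ### Invariant properties of cells, and the calculus of whiskering algebras. -/

namespace Sesqui

variable {n : ℕ}

namespace GlobSet

/-- A property of cells which is invariant under sources and targets. -/
structure Invariant (Y : GlobSet.{u} n) where
  prop : ∀ k, Y.cells k → Prop
  prop_s : ∀ k y, prop k (Y.s k y) ↔ prop (k + 1) y
  prop_t : ∀ k y, prop k (Y.t k y) ↔ prop (k + 1) y

theorem Invariant.prop_iterS {Y : GlobSet.{u} n} (P : Y.Invariant) {k : ℕ} (y : Y.cells k)
    (m : ℕ) (h : m ≤ k) : P.prop m (Y.iterS y m h) ↔ P.prop k y := by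
  induction h using Nat.decreasingInduction with
  | self => rw [Y.iterS_self]
  | of_succ m h ih => rw [← Y.s_iterS _ _ h, P.prop_s, ih]

/-- The cells with an invariant property. -/
def Invariant.sub {Y : GlobSet.{u} n} (P : Y.Invariant) : GlobSet.{u} n where
  cells k := {y : Y.cells k // P.prop k y}
  s k y := ⟨Y.s k y.1, (P.prop_s k _).2 y.2⟩
  t k y := ⟨Y.t k y.1, (P.prop_t k _).2 y.2⟩
  ss k y := Subtype.ext (Y.ss k y.1)
  tt k y := Subtype.ext (Y.tt k y.1)
  isEmpty k h := ⟨fun y => (Y.isEmpty k h).false y.1⟩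

/-- The inclusion of the cells with an invariant property. -/
def Invariant.incl {Y : GlobSet.{u} n} (P : Y.Invariant) : P.sub ⟶ Y where
  app _ y := y.1
  app_s _ _ := rfl
  app_t _ _ := rfl

/-- The property of having given endpoints in dimension `0`. -/
def endpoints (X : GlobSet.{u} (n + 1)) (p : X.cells 0 → X.cells 0 → Prop) : X.shift.Invariant where
  prop k z := p (X.bs k z) (X.bt k z)
  prop_s k z := Iff.rfl
  prop_t k z := by
    exact iff_of_eq (congrArg₂ p (X.bs_t k z) (X.bt_t k z))

theorem shift_iterS {X : GlobSet.{u} (n + 1)} : ∀ (k : ℕ) (z : X.shift.cells k),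
    X.shift.iterS z 0 (Nat.zero_le k) = X.edge k z
  | 0, z => X.shift.iterS_self (k := 0) z
  | k + 1, z => (X.shift.iterS_s z 0 (Nat.zero_le k)).symm.trans (shift_iterS k _)

theorem shift_app_edge {X Y : GlobSet.{u} (n + 1)} (φ : X.shift ⟶ Y.shift) :
    ∀ (k : ℕ) (z : X.shift.cells k), Y.edge k (φ.app k z) = φ.app 0 (X.edge k z)
  | 0, _ => rfl
  | k + 1, z => (congrArg (Y.edge k) (φ.app_s k z).symm).trans (shift_app_edge φ k _)

end GlobSet

namespace LDiagram

/-- The attaching rule links every label to the base by sources and targets, which preserve `P`.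
With `endpoints` this shows that all labels of a diagram in `X.shift` have the same 0-dimensional
endpoints. -/
theorem prop_lab {k : ℕ} {Y : GlobSet.{u} n} (P : Y.Invariant) (d : LDiagram k Y)
    (h0 : P.prop 0 d.base) : ∀ m h i, P.prop m (d.lab.x m h i)
  | 0, h, i => by rw [d.lab_zero]; exact h0
  | m + 1, h, i => by
    induction i using WellFoundedLT.induction with
    | ind i ih =>
      rw [← P.prop_s]
      rcases d.lab.src m h i with ⟨-, hc⟩ | ⟨p, hp, hc⟩
      · rw [hc]
        exact prop_lab P d h0 m _ _
      · rw [hc, P.prop_t]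
        exact ih p hp.1.1

theorem exists_map_incl {k : ℕ} {Y : GlobSet.{u} n} (P : Y.Invariant) (d : LDiagram k Y)
    (h0 : P.prop 0 d.base) : ∃ e : LDiagram k P.sub, e.map P.incl = d :=
  ⟨⟨d.shape, fun m h i => ⟨d.lab.x m h i, prop_lab P d h0 m h i⟩, fun m h i => by
    rcases d.lab.src m h i with ⟨hn, hc⟩ | ⟨p, hp, hc⟩
    · exact Or.inl ⟨hn, Subtype.ext hc⟩
    · exact Or.inr ⟨p, hp, Subtype.ext hc⟩⟩, rfl⟩

theorem map_eq_self {k : ℕ} {Y : GlobSet.{u} n} (P : Y.Invariant) (f : Y ⟶ Y) (d : LDiagram k Y)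
    (h0 : P.prop 0 d.base) (hf : ∀ m y, P.prop m y → f.app m y = y) : d.map f = d :=
  eq_of_shape fun m h i => hf m _ (prop_lab P d h0 m h i)

end LDiagram

open LDiagram

theorem iterS_TObj_zero {Y : GlobSet.{u} n} {k : ℕ} (d : (TObj Y).cells k) :
    (TObj Y).iterS d 0 (Nat.zero_le k) = (TUnit Y).app 0 (baseOf d) :=
  Subtype.ext ((LDiagram.iterS_TObj d 0 _).trans (eq_unit _))

/-- The iterated source of `d` in dimension 0 is the unit diagram on its base; `a` preserves
iterated sources and fixes units. -/
theorem edge_app_of_unit {X : GlobSet.{u} (n + 1)} {a : TObj X.shift ⟶ X.shift}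
    (ha : TUnit X.shift ≫ a = 𝟙 X.shift) (k : ℕ) (d : (TObj X.shift).cells k) :
    X.edge k (a.app k d) = baseOf d := by
  rw [← GlobSet.shift_iterS, ← a.app_iterS, iterS_TObj_zero]
  exact congrArg (fun φ : X.shift ⟶ X.shift => φ.app 0 (baseOf d)) ha

/-- The structure of a category on the cells of dimensions `0` and `1`, acting on both sides on
the cells of positive dimension, which form an algebra. The whiskering operations are the identity
on cells which are not composable. -/
structure WhiskAlg (X : GlobSet.{u} (n + 1)) where
  one : X.cells 0 → X.cells 1
  R : X.cells 1 → (X.shift ⟶ X.shift)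
  L : X.cells 1 → (X.shift ⟶ X.shift)
  a : TObj X.shift ⟶ X.shift
  s_one : ∀ x, X.s 0 (one x) = x
  t_one : ∀ x, X.t 0 (one x) = x
  s_R : ∀ f z, X.t 0 z = X.s 0 f → X.s 0 ((R f).app 0 z) = X.s 0 z
  t_R : ∀ f z, X.t 0 z = X.s 0 f → X.t 0 ((R f).app 0 z) = X.t 0 f
  s_L : ∀ f z, X.t 0 f = X.s 0 z → X.s 0 ((L f).app 0 z) = X.s 0 f
  t_L : ∀ f z, X.t 0 f = X.s 0 z → X.t 0 ((L f).app 0 z) = X.t 0 z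
  R_of_ne : ∀ f k z, X.bt k z ≠ X.s 0 f → (R f).app k z = z
  L_of_ne : ∀ f k z, X.t 0 f ≠ X.bs k z → (L f).app k z = z
  R_one : ∀ x k z, X.bt k z = x → (R (one x)).app k z = z
  L_one : ∀ x k z, x = X.bs k z → (L (one x)).app k z = z
  R_R : ∀ f h k z, X.t 0 h = X.s 0 f → X.bt k z = X.s 0 h →
    (R ((R f).app 0 h)).app k z = (R f).app k ((R h).app k z)
  L_R : ∀ f h k z, X.t 0 h = X.s 0 f → X.t 0 f = X.bs k z →
    (L ((R f).app 0 h)).app k z = (L h).app k ((L f).app k z)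
  L_comm : ∀ f g k z, X.t 0 f = X.bs k z → X.bt k z = X.s 0 g →
    (L f).app k ((R g).app k z) = (R g).app k ((L f).app k z)
  R_eq_L : ∀ f h, X.t 0 h = X.s 0 f → (R f).app 0 h = (L h).app 0 f
  a_unit : TUnit X.shift ≫ a = 𝟙 X.shift
  a_assoc : TMult X.shift ≫ a = TMap a ≫ a
  a_R : ∀ f k (d : (TObj X.shift).cells k), X.t 0 (baseOf d) = X.s 0 f →
    a.app k ((TMap (R f)).app k d) = (R f).app k (a.app k d)
  a_L : ∀ f k (d : (TObj X.shift).cells k), X.t 0 f = X.s 0 (baseOf d) →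
    a.app k ((TMap (L f)).app k d) = (L f).app k (a.app k d)

namespace WhiskAlg

variable {X : GlobSet.{u} (n + 1)} (A : WhiskAlg X)

theorem bs_R (f : X.cells 1) (k : ℕ) (z : X.cells (k + 1)) :
    X.bs k ((A.R f).app k z) = X.bs k z := by
  by_cases h : X.bt k z = X.s 0 f
  · exact (congrArg (X.s 0) (GlobSet.shift_app_edge (A.R f) k z)).trans (A.s_R f _ h)
  · rw [A.R_of_ne f k z h]

theorem bt_L (f : X.cells 1) (k : ℕ) (z : X.cells (k + 1)) :
    X.bt k ((A.L f).app k z) = X.bt k z := by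
  by_cases h : X.t 0 f = X.bs k z
  · exact (congrArg (X.t 0) (GlobSet.shift_app_edge (A.L f) k z)).trans (A.t_L f _ h)
  · rw [A.L_of_ne f k z h]

theorem bt_R (f : X.cells 1) (k : ℕ) (z : X.cells (k + 1)) (h : X.bt k z = X.s 0 f) :
    X.bt k ((A.R f).app k z) = X.t 0 f :=
  (congrArg (X.t 0) (GlobSet.shift_app_edge (A.R f) k z)).trans (A.t_R f _ h)

theorem bs_L (f : X.cells 1) (k : ℕ) (z : X.cells (k + 1)) (h : X.t 0 f = X.bs k z) :
    X.bs k ((A.L f).app k z) = X.s 0 f :=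
  (congrArg (X.s 0) (GlobSet.shift_app_edge (A.L f) k z)).trans (A.s_L f _ h)

/-- The convention on non-composable cells makes the law unconditional: right whiskering keeps the
0-dimensional source and left whiskering the 0-dimensional target, so neither affects whether the
other acts. -/
theorem L_comm_R (f g : X.cells 1) : A.R g ≫ A.L f = A.L f ≫ A.R g := by
  refine GlobSet.hom_ext fun k z => ?_
  change (A.L f).app k ((A.R g).app k z) = (A.R g).app k ((A.L f).app k z)
  by_cases h : X.t 0 f = X.bs k z
  · by_cases h' : X.bt k z = X.s 0 g
    · exact A.L_comm f g k z h h'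
    · rw [A.R_of_ne g k z h']
      exact (A.R_of_ne g k _ fun e => h' ((A.bt_L f k z).symm.trans e)).symm
  · rw [A.L_of_ne f k z h]
    exact A.L_of_ne f k _ fun e => h (e.trans (A.bs_R g k z))

/-- If `f` does not compose with the base of a diagram, it composes with none of its labels and not
with its value, and nothing is changed on either side. -/
theorem map_R (f : X.cells 1) : TMap (A.R f) ≫ A.a = A.a ≫ A.R f := by
  refine GlobSet.hom_ext fun k d => ?_
  by_cases h : X.t 0 (baseOf d) = X.s 0 f
  · exact A.a_R f k d h
  · have h1 : (TMap (A.R f)).app k d = d := Subtype.ext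
      (LDiagram.map_eq_self (X.endpoints fun _ y => y ≠ X.s 0 f) _ _ h fun m y => A.R_of_ne f m y)
    change A.a.app k ((TMap (A.R f)).app k d) = (A.R f).app k (A.a.app k d)
    rw [h1]
    exact (A.R_of_ne f k _ fun e => h
      ((congrArg (X.t 0) (edge_app_of_unit A.a_unit k d)).symm.trans e)).symm

theorem map_L (f : X.cells 1) : TMap (A.L f) ≫ A.a = A.a ≫ A.L f := by
  refine GlobSet.hom_ext fun k d => ?_
  by_cases h : X.t 0 f = X.s 0 (baseOf d)
  · exact A.a_L f k d h
  · have h1 : (TMap (A.L f)).app k d = d := Subtype.ext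
      (LDiagram.map_eq_self (X.endpoints fun x _ => X.t 0 f ≠ x) _ _ h fun m y => A.L_of_ne f m y)
    change A.a.app k ((TMap (A.L f)).app k d) = (A.L f).app k (A.a.app k d)
    rw [h1]
    exact (A.L_of_ne f k _ fun e => h
      (e.trans (congrArg (X.s 0) (edge_app_of_unit A.a_unit k d)))).symm

/-- Whiskering on the right by a sequence. -/
def Rs : List (X.cells 1) → (X.shift ⟶ X.shift)
  | [] => 𝟙 _
  | f :: l => A.R f ≫ Rs l

/-- Whiskering on the left by a sequence. -/
def Ls : List (X.cells 1) → (X.shift ⟶ X.shift)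
  | [] => 𝟙 _
  -- The last letter is the nearest to the cell and acts first.
  | f :: l => Ls l ≫ A.L f

theorem Rs_append : ∀ l l' : List (X.cells 1), A.Rs (l ++ l') = A.Rs l ≫ A.Rs l'
  | [], _ => (Category.id_comp _).symm
  | f :: l, l' => (congrArg (fun φ => A.R f ≫ φ) (Rs_append l l')).trans
      (Category.assoc _ _ _).symm

theorem Ls_append : ∀ l l' : List (X.cells 1), A.Ls (l ++ l') = A.Ls l' ≫ A.Ls l
  | [], _ => (Category.comp_id _).symm
  | f :: l, l' => (congrArg (fun φ => φ ≫ A.L f) (Ls_append l l')).trans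
      (Category.assoc _ _ _)

theorem Rs_comm_L (f : X.cells 1) : ∀ l : List (X.cells 1), A.Rs l ≫ A.L f = A.L f ≫ A.Rs l
  | [] => (Category.id_comp _).trans (Category.comp_id _).symm
  | g :: l => by
    rw [Rs, Category.assoc, Rs_comm_L f l, ← Category.assoc, A.L_comm_R, Category.assoc]

theorem Rs_comm_Ls (l : List (X.cells 1)) : ∀ l' : List (X.cells 1),
    A.Rs l ≫ A.Ls l' = A.Ls l' ≫ A.Rs l
  | [] => (Category.comp_id _).trans (Category.id_comp _).symm
  | g :: l' => by
    rw [Ls, ← Category.assoc, Rs_comm_Ls l l', Category.assoc, A.Rs_comm_L, Category.assoc]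

theorem map_Rs : ∀ l : List (X.cells 1), TMap (A.Rs l) ≫ A.a = A.a ≫ A.Rs l
  | [] => (Category.comp_id _).symm
  | f :: l => by
    change TMap (A.R f) ≫ TMap (A.Rs l) ≫ A.a = A.a ≫ A.R f ≫ A.Rs l
    rw [map_Rs l, ← Category.assoc, A.map_R, Category.assoc]

theorem map_Ls : ∀ l : List (X.cells 1), TMap (A.Ls l) ≫ A.a = A.a ≫ A.Ls l
  | [] => (Category.comp_id _).symm
  | f :: l => by
    change TMap (A.Ls l) ≫ TMap (A.L f) ≫ A.a = A.a ≫ A.Ls l ≫ A.L f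
    rw [A.map_L, ← Category.assoc, map_Ls l, Category.assoc]

theorem bs_Rs : ∀ (l : List (X.cells 1)) (k : ℕ) (z : X.cells (k + 1)),
    X.bs k ((A.Rs l).app k z) = X.bs k z
  | [], _, _ => rfl
  | f :: l, k, z => (bs_Rs l k _).trans (A.bs_R f k z)

theorem bt_Ls : ∀ (l : List (X.cells 1)) (k : ℕ) (z : X.cells (k + 1)),
    X.bt k ((A.Ls l).app k z) = X.bt k z
  | [], _, _ => rfl
  | f :: l, k, z => (A.bt_L f k _).trans (bt_Ls l k z)

theorem bt_Rs : ∀ (l : List (X.cells 1)) (k : ℕ) (z : X.cells (k + 1)), X.IsWord (X.bt k z) l →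
    X.bt k ((A.Rs l).app k z) = X.wordEnd (X.bt k z) l
  | [], _, _, _ => rfl
  | f :: l, k, z, h => by
    have h1 := A.bt_R f k z h.1.symm
    exact (bt_Rs l k ((A.R f).app k z) (h1 ▸ h.2)).trans (congrArg (fun y => X.wordEnd y l) h1)

theorem bs_Ls : ∀ (x : X.cells 0) (l : List (X.cells 1)) (k : ℕ) (z : X.cells (k + 1)),
    X.IsWord x l → X.wordEnd x l = X.bs k z → X.bs k ((A.Ls l).app k z) = x
  | _, [], _, _, _, h => h.symm
  | _, f :: l, k, z, h, h' => (A.bs_L f k _ (bs_Ls _ l k z h.2 h').symm).trans h.1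

/-- Composing a sequence from the left or from the right. -/
theorem Ls_one : ∀ (x : X.cells 0) (l : List (X.cells 1)), X.IsWord x l →
    (A.Ls l).app 0 (A.one (X.wordEnd x l)) = (A.Rs l).app 0 (A.one x)
  | _, [], _ => rfl
  | x, f :: l, h => by
    have h1 := Ls_one _ l h.2
    -- Left and right whiskering commute, and whiskering an identity by `f` gives `f` from either
    -- side.
    have h2 : (A.L f).app 0 ((A.Rs l).app 0 (A.one (X.t 0 f))) =
        (A.Rs l).app 0 ((A.L f).app 0 (A.one (X.t 0 f))) :=
      congrArg (fun φ : X.shift ⟶ X.shift => φ.app 0 (A.one (X.t 0 f))) (A.Rs_comm_L f l)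
    have h3 : (A.L f).app 0 (A.one (X.t 0 f)) = f :=
      (A.R_eq_L _ f (A.s_one _).symm).symm.trans (A.R_one _ 0 f rfl)
    have h4 : (A.R f).app 0 (A.one x) = f :=
      (A.R_eq_L f (A.one x) ((A.t_one x).trans h.1.symm)).trans (A.L_one x 0 f h.1.symm)
    change (A.L f).app 0 ((A.Ls l).app 0 (A.one (X.wordEnd (X.t 0 f) l))) =
      (A.Rs l).app 0 ((A.R f).app 0 (A.one x))
    rw [h1, h2, h3, h4]

/-- Iterates `R_R`; with `h` an identity it becomes `R_compose`, whiskering by a composite one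
letter at a time. -/
theorem R_Rs : ∀ (h : X.cells 1) (l : List (X.cells 1)) (k : ℕ) (z : X.cells (k + 1)),
    X.IsWord (X.t 0 h) l → X.bt k z = X.s 0 h →
    (A.R ((A.Rs l).app 0 h)).app k z = (A.Rs l).app k ((A.R h).app k z)
  | _, [], _, _, _, _ => rfl
  | h, f :: l, k, z, hl, hz => by
    have h1 := R_Rs ((A.R f).app 0 h) l k z (by rw [A.t_R f h hl.1.symm]; exact hl.2)
      (hz.trans (A.s_R f h hl.1.symm).symm)
    exact h1.trans (congrArg ((A.Rs l).app k) (A.R_R f h k z hl.1.symm hz))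

theorem L_Rs : ∀ (h : X.cells 1) (l : List (X.cells 1)) (k : ℕ) (z : X.cells (k + 1)),
    X.IsWord (X.t 0 h) l → X.wordEnd (X.t 0 h) l = X.bs k z →
    (A.L ((A.Rs l).app 0 h)).app k z = (A.L h).app k ((A.Ls l).app k z)
  | _, [], _, _, _, _ => rfl
  | h, f :: l, k, z, hl, hz => by
    have h1 := L_Rs ((A.R f).app 0 h) l k z (by rw [A.t_R f h hl.1.symm]; exact hl.2)
      (by rw [A.t_R f h hl.1.symm]; exact hz)
    exact h1.trans (A.L_R f h k _ hl.1.symm (A.bs_Ls _ l k z hl.2 hz).symm)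

/-- The composite of a sequence. -/
def compose (x : X.cells 0) (l : List (X.cells 1)) : X.cells 1 := (A.Rs l).app 0 (A.one x)

theorem s_compose (x : X.cells 0) (l : List (X.cells 1)) : X.s 0 (A.compose x l) = x :=
  (A.bs_Rs l 0 (A.one x)).trans (A.s_one x)

theorem t_compose (x : X.cells 0) (l : List (X.cells 1)) (hl : X.IsWord x l) :
    X.t 0 (A.compose x l) = X.wordEnd x l := by
  have h1 : X.bt 0 (A.one x) = x := A.t_one x
  exact (A.bt_Rs l 0 (A.one x) (by rwa [h1])).trans (congrArg (fun y => X.wordEnd y l) h1)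

theorem R_compose (x : X.cells 0) (l : List (X.cells 1)) (hl : X.IsWord x l) (k : ℕ)
    (z : X.cells (k + 1)) (h : X.bt k z = x) : (A.R (A.compose x l)).app k z = (A.Rs l).app k z :=
  (A.R_Rs (A.one x) l k z (by rwa [A.t_one]) (h.trans (A.s_one x).symm)).trans
    (congrArg ((A.Rs l).app k) (A.R_one x k z h))

theorem L_compose (x : X.cells 0) (l : List (X.cells 1)) (hl : X.IsWord x l) (k : ℕ)
    (z : X.cells (k + 1)) (h : X.wordEnd x l = X.bs k z) :
    (A.L (A.compose x l)).app k z = (A.Ls l).app k z :=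
  (A.L_Rs (A.one x) l k z (by rwa [A.t_one]) (by rwa [A.t_one])).trans
    (A.L_one x k _ (A.bs_Ls x l k z hl h).symm)

theorem R_compose_eq (x : X.cells 0) (l : List (X.cells 1)) (hl : X.IsWord x l) (f : X.cells 1)
    (h : X.wordEnd x l = X.s 0 f) : (A.R f).app 0 (A.compose x l) = (A.Ls l).app 0 f := by
  rw [A.R_eq_L f _ ((A.t_compose x l hl).trans h), A.L_compose x l hl 0 f h]

/-- A string may be composed outwards from any of its letters. This gives the value of a whiskered
2-cell the values of its source and target strings as source and target. -/
theorem compose_whisk (x : X.cells 0) (l r : List (X.cells 1)) (f : X.cells 1)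
    (h : X.IsWord x (l ++ [f] ++ r)) :
    A.compose x (l ++ [f] ++ r) = (A.Rs r).app 0 ((A.Ls l).app 0 f) := by
  simp only [GlobSet.isWord_append, GlobSet.isWord_cons] at h
  rw [← A.R_compose_eq x l h.1.1 f h.1.2.1.symm]
  unfold compose
  rw [A.Rs_append, A.Rs_append]
  rfl

/-- The value of a whiskered cell. -/
def value : whiskSet X ⟶ X.shift where
  app k := match k with
    | 0 => fun z : Str X => A.compose z.base z.word
    | k + 1 => fun z : Whisk X k => (A.Rs z.right).app (k + 1) ((A.Ls z.left).app (k + 1) z.cell)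
  app_s k := match k with
    | 0 => fun z : Whisk X 0 => (A.compose_whisk _ _ _ _ z.srcStr.isWord).trans
        ((congrArg ((A.Rs z.right).app 0) ((A.Ls z.left).app_s 0 z.cell)).trans
          ((A.Rs z.right).app_s 0 _))
    | k + 1 => fun z : Whisk X (k + 1) => (congrArg ((A.Rs z.right).app (k + 1))
        ((A.Ls z.left).app_s (k + 1) z.cell)).trans ((A.Rs z.right).app_s (k + 1) _)
  app_t k := match k with
    | 0 => fun z : Whisk X 0 => (A.compose_whisk _ _ _ _ z.tgtStr.isWord).trans
        ((congrArg ((A.Rs z.right).app 0) ((A.Ls z.left).app_t 0 z.cell)).trans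
          ((A.Rs z.right).app_t 0 _))
    | k + 1 => fun z : Whisk X (k + 1) => (congrArg ((A.Rs z.right).app (k + 1))
        ((A.Ls z.left).app_t (k + 1) z.cell)).trans ((A.Rs z.right).app_t (k + 1) _)

theorem whiskUnit_value : whiskUnit X ≫ A.value = 𝟙 X.shift := by
  refine GlobSet.hom_ext fun k z => ?_
  match k with
  | 0 => exact (A.R_eq_L z _ (A.t_one _)).trans (A.L_one _ 0 z rfl)
  | k + 1 => rfl

end WhiskAlg

end Sesqui

/-! ### Evaluation of diagrams in a whiskering algebra. -/

namespace Sesqui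

open LDiagram

variable {n : ℕ}

/-- The preimage of an invariant property. -/
def GlobSet.Invariant.comap {Y Z : GlobSet.{u} n} (f : Y ⟶ Z) (P : Z.Invariant) : Y.Invariant where
  prop k y := P.prop k (f.app k y)
  prop_s k y := by rw [f.app_s, P.prop_s]
  prop_t k y := by rw [f.app_t, P.prop_t]

section

variable {X : GlobSet.{u} (n + 1)} (x : X.cells 0) (l r : List (X.cells 1))

/-- The property of diagrams that strings can be added on both sides. -/
noncomputable def graftable : (TObj X).shift.Invariant :=
  (TObj X).endpoints fun p q => baseOf p = X.wordEnd x l ∧ X.IsWord (baseOf q) r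

variable {x l r}

theorem isWord_of_graftable (hl : X.IsWord x l) {k : ℕ} {p : (TObj X).cells (k + 1)}
    (h : (graftable x l r).prop k p) : X.IsWord x (l ++ wordOf p ++ r) := by
  obtain ⟨h1, h2⟩ := h
  rw [base_bs] at h1
  rw [base_bt] at h2
  simp only [GlobSet.isWord_append, GlobSet.wordEnd_append, ← h1]
  exact ⟨⟨hl, p.1.isWord_word⟩, h2⟩

theorem graftable_of_isWord {k : ℕ} {p : (TObj X).cells (k + 1)} (hp : baseOf p = X.wordEnd x l)
    (h : X.IsWord x (l ++ wordOf p ++ r)) : (graftable x l r).prop k p := by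
  refine ⟨(base_bs k p).trans hp, ?_⟩
  rw [base_bt, hp]
  simp only [GlobSet.isWord_append, GlobSet.wordEnd_append] at h
  exact h.2

theorem wordOf_whiskDiagram_zero (z : Str X) :
    wordOf (k := 0) ((whiskDiagram X).app 0 z) = z.word := Str.word_diagram z

theorem wordOf_whiskDiagram_succ {k : ℕ} (z : Whisk X k) :
    wordOf (k := k + 1) ((whiskDiagram X).app (k + 1) z) =
      z.left ++ [X.edge (k + 1) z.cell] ++ z.right := by
  refine (word_graft (unit z.cell) (by rw [word_unit]; exact z.isWord)).trans ?_
  rw [word_unit]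

variable (hl : X.IsWord x l)

/-- Whiskered cells which can be whiskered further. -/
noncomputable abbrev extendable (x : X.cells 0) (l r : List (X.cells 1)) : (whiskSet X).Invariant :=
  (graftable x l r).comap (whiskDiagram X)

/-- Whiskering on both sides. -/
noncomputable def extend : (extendable x l r).sub ⟶ whiskSet X where
  app k := match k with
    | 0 => fun z => (⟨x, l ++ Str.word z.1 ++ r, by
        have h1 : wordOf (k := 0) ((whiskDiagram X).app 0 z.1) = Str.word z.1 :=
          wordOf_whiskDiagram_zero z.1
        rw [← h1]
        exact isWord_of_graftable hl z.2⟩ : Str X)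
    | k + 1 => fun z => (⟨x, l ++ Whisk.left z.1, Whisk.cell z.1, Whisk.right z.1 ++ r, by
        have h1 : wordOf (k := k + 1) ((whiskDiagram X).app (k + 1) z.1) = _ :=
          wordOf_whiskDiagram_succ z.1
        have h2 := isWord_of_graftable hl z.2
        rw [h1] at h2
        simpa using h2⟩ : Whisk X k)
  app_s k z := match k with
    | 0 => Str.ext rfl (show l ++ (Whisk.left z.1 ++ [X.s 1 (Whisk.cell z.1)] ++ Whisk.right z.1) ++
        r = (l ++ Whisk.left z.1) ++ [X.s 1 (Whisk.cell z.1)] ++ (Whisk.right z.1 ++ r) by simp)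
    | _ + 1 => rfl
  app_t k z := match k with
    | 0 => Str.ext rfl (show l ++ (Whisk.left z.1 ++ [X.t 1 (Whisk.cell z.1)] ++ Whisk.right z.1) ++
        r = (l ++ Whisk.left z.1) ++ [X.t 1 (Whisk.cell z.1)] ++ (Whisk.right z.1 ++ r) by simp)
    | _ + 1 => rfl

theorem extend_whiskDiagram : extend (r := r) hl ≫ whiskDiagram X =
    graftHom ((extendable x l r).incl ≫ whiskDiagram X) x l r
      fun _ y => isWord_of_graftable hl y.2 := by
  refine GlobSet.hom_ext fun k z => Subtype.ext ?_
  match k with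
  | 0 =>
    refine ext_word_one rfl ((Str.word_diagram _).trans ?_)
    refine Eq.trans ?_ (word_graft ((whiskDiagram X).app 0 z.1).1
      (isWord_of_graftable hl z.2)).symm
    exact congrArg (fun w => l ++ w ++ r) (wordOf_whiskDiagram_zero z.1).symm
  | k + 1 =>
    refine (graft_graft (unit (Whisk.cell z.1)) (by rw [word_unit]; exact Whisk.isWord z.1)
      (isWord_of_graftable hl z.2) ?_).symm
    rw [word_unit]
    exact Whisk.isWord ((extend hl).app (k + 1) z)

/-- Adding strings to an assembled diagram is the same as lengthening the whiskers of every label.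
-/
theorem graft_assemble {k : ℕ} (e : (TObj (extendable x l r).sub).cells k) (h) :
    ((assemble X).app k ((TMap (extend hl)).app k e)).1 =
      graft x l ((assemble X).app k ((TMap (extendable x l r).incl).app k e)).1 r h := by
  have h1 : (e.1.map (extend hl)).map (whiskDiagram X) = _ :=
    congrArg e.1.map (extend_whiskDiagram hl)
  exact (congrArg (fun d => (susp d).comp) h1).trans (graft_comp_susp _ x l r _ e.1)

end

/-- Decomposition of diagrams into whiskered cells. -/
noncomputable def assembleIso (X : GlobSet.{u} (n + 1)) : TObj (whiskSet X) ≅ (TObj X).shift :=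
  GlobSet.isoOfBijective (assemble X) (assemble_bijective X)

namespace WhiskAlg

variable {X : GlobSet.{u} (n + 1)} (A : WhiskAlg X)

/-- The value of a diagram of positive dimension. -/
noncomputable def actPos : (TObj X).shift ⟶ X.shift := (assembleIso X).inv ≫ TMap A.value ≫ A.a

theorem assemble_actPos : assemble X ≫ A.actPos = TMap A.value ≫ A.a :=
  (assembleIso X).hom_inv_id_assoc _

theorem TMap_comp {X Y Z : GlobSet.{u} n} (f : X ⟶ Y) (g : Y ⟶ Z) :
    TMap (f ≫ g) = TMap f ≫ TMap g := rfl

/-- A single whiskered cell is assembled from a unit diagram, on which the unit law of `a` leaves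
its value. -/
theorem whiskDiagram_actPos : whiskDiagram X ≫ A.actPos = A.value := by
  have h1 : whiskDiagram X = TUnit (whiskSet X) ≫ assemble X :=
    GlobSet.hom_ext fun k z => (assemble_unit X k z).symm
  have h2 : TUnit (whiskSet X) ≫ TMap A.value = A.value ≫ TUnit X.shift :=
    ((T n).η.naturality A.value).symm
  rw [h1, Category.assoc, A.assemble_actPos, ← Category.assoc, h2, Category.assoc, A.a_unit,
    Category.comp_id]

theorem suspHom_actPos : suspHom X ≫ A.actPos = A.a := by
  rw [← assemble_susp, Category.assoc, A.assemble_actPos, ← Category.assoc, ← TMap_comp,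
    A.whiskUnit_value]
  exact Category.id_comp _

/-- Associativity when the outer diagram has a single string. After precomposition with the
isomorphism `TMap (assemble X)`, `assemble_comp` reduces it to the associativity of `a`. -/
theorem mult_actPos : suspHom (TObj X) ≫ GlobSet.shiftMap (TMult X) ≫ A.actPos =
    TMap A.actPos ≫ A.a := by
  have h0 : TMap (assembleIso X).inv ≫ TMap (assemble X) = 𝟙 _ := by
    rw [← TMap_comp]
    exact congrArg TMap (assembleIso X).inv_hom_id
  have h1 := congrArg (fun φ => TMap (assembleIso X).inv ≫ φ ≫ A.actPos) (assemble_comp X)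
  simp only [Category.assoc] at h1
  rw [← Category.assoc, h0, Category.id_comp, A.assemble_actPos] at h1
  have h2 : TMult (whiskSet X) ≫ TMap A.value = TMap (TMap A.value) ≫ TMult X.shift :=
    ((T n).μ.naturality A.value).symm
  rw [h1, ← Category.assoc (TMult _), h2, Category.assoc, A.a_assoc]
  rfl

theorem actPos_string (x : X.cells 0) (l : List (X.cells 1)) (hl : X.IsWord x l) (h) :
    A.actPos.app 0 ⟨string x l hl, h⟩ = A.compose x l :=
  congrArg (fun φ : whiskSet X ⟶ X.shift => φ.app 0 (⟨x, l, hl⟩ : Str X)) A.whiskDiagram_actPos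

theorem actPos_zero (d : (TObj X).cells 1) :
    A.actPos.app 0 d = A.compose (baseOf d) (wordOf d) :=
  (congrArg (A.actPos.app 0) (Subtype.ext (string_base_word d.1).symm)).trans
    (A.actPos_string (baseOf d) (wordOf d) d.1.isWord_word d.2)

/-- Longer whiskers mean further whiskering of the value, because the two sides commute. For
strings, `Ls_one` moves the left extension through the identity. -/
theorem extend_value {x : X.cells 0} {l r : List (X.cells 1)} (hl : X.IsWord x l) :
    extend (r := r) hl ≫ A.value = (extendable x l r).incl ≫ A.value ≫ A.Ls l ≫ A.Rs r := by
  refine GlobSet.hom_ext fun k z => ?_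
  match k with
  | 0 =>
    have hb : Str.base z.1 = X.wordEnd x l := z.2.1
    change A.compose x (l ++ Str.word z.1 ++ r) =
      (A.Rs r).app 0 ((A.Ls l).app 0 (A.compose (Str.base z.1) (Str.word z.1)))
    have h1 : (A.Ls l).app 0 (A.compose (Str.base z.1) (Str.word z.1)) =
        (A.Rs (Str.word z.1)).app 0 ((A.Ls l).app 0 (A.one (Str.base z.1))) :=
      congrArg (fun φ : X.shift ⟶ X.shift => φ.app 0 (A.one (Str.base z.1)))
        (A.Rs_comm_Ls (Str.word z.1) l)
    rw [h1, hb, A.Ls_one x l hl]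
    unfold compose
    rw [A.Rs_append, A.Rs_append]
    rfl
  | k + 1 =>
    change (A.Rs (Whisk.right z.1 ++ r)).app (k + 1) ((A.Ls (l ++ Whisk.left z.1)).app (k + 1)
      (Whisk.cell z.1)) = (A.Rs r).app (k + 1) ((A.Ls l).app (k + 1)
        ((A.Rs (Whisk.right z.1)).app (k + 1) ((A.Ls (Whisk.left z.1)).app (k + 1)
          (Whisk.cell z.1))))
    rw [A.Rs_append, A.Ls_append]
    exact congrArg (fun φ : X.shift ⟶ X.shift => (A.Rs r).app (k + 1)
      (φ.app (k + 1) ((A.Ls (Whisk.left z.1)).app (k + 1) (Whisk.cell z.1))))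
        (A.Rs_comm_Ls (Whisk.right z.1) l).symm

theorem map_ctx (l r : List (X.cells 1)) :
    TMap (A.Ls l ≫ A.Rs r) ≫ A.a = A.a ≫ A.Ls l ≫ A.Rs r := by
  rw [TMap_comp, Category.assoc, A.map_Rs, ← Category.assoc, A.map_Ls, Category.assoc]

/-- The added strings are distributed over the labels of the decomposition (`graft_assemble`),
become whiskerings of their values, and pass through `a`, which commutes with whiskering
(`map_ctx`). -/
theorem actPos_graft {k : ℕ} (x : X.cells 0) (l r : List (X.cells 1)) (d : (TObj X).cells (k + 1))
    (h : X.IsWord x (l ++ wordOf d ++ r)) (hd : baseOf d = X.wordEnd x l) :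
    A.actPos.app k ⟨graft x l d.1 r h, d.2⟩ = (A.Ls l ≫ A.Rs r).app k (A.actPos.app k d) := by
  have hl : X.IsWord x l := by
    simp only [GlobSet.isWord_append] at h
    exact h.1.1
  obtain ⟨e, rfl⟩ := (assemble_bijective X k).2 d
  -- Being graftable is invariant under sources and targets, so it passes from the assembled diagram
  -- to the base of `e`, and from there to all labels of `e`.
  have h0 : (extendable x l r).prop 0 e.1.base := by
    have h1 := (((graftable x l r).comap (assemble X)).prop_iterS e 0 (Nat.zero_le k)).2
      (graftable_of_isWord hd h)
    rw [iterS_TObj_zero] at h1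
    exact Eq.mp (congrArg ((graftable x l r).prop 0) (assemble_unit X 0 e.1.base)) h1
  obtain ⟨e', rfl⟩ : ∃ e', (TMap (extendable x l r).incl).app k e' = e := by
    obtain ⟨e', he⟩ := exists_map_incl (extendable x l r) e.1 h0
    exact ⟨⟨e', e.2⟩, Subtype.ext he⟩
  refine (congrArg (A.actPos.app k) (Subtype.ext (graft_assemble hl e' h).symm)).trans ?_
  have h1 : TMap (extend hl) ≫ assemble X ≫ A.actPos =
      TMap (extendable x l r).incl ≫ assemble X ≫ A.actPos ≫ A.Ls l ≫ A.Rs r := by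
    rw [A.assemble_actPos, ← Category.assoc (assemble X), A.assemble_actPos, Category.assoc,
      ← A.map_ctx]
    exact congrArg (fun φ => TMap φ ≫ A.a) (A.extend_value hl)
  exact congrArg (fun φ => GlobSet.Hom.app φ k e') h1

end WhiskAlg

end Sesqui

/-! ### The evaluation is an action of the monad. -/

namespace Sesqui

open LDiagram

variable {n : ℕ}

namespace WhiskAlg

variable {X : GlobSet.{u} (n + 1)} (A : WhiskAlg X)

/-- The value of a diagram. -/
noncomputable def act : TObj X ⟶ X where
  app k := match k with
    | 0 => baseOf
    | k + 1 => A.actPos.app k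
  app_s k d := match k with
    | 0 => ((congrArg (X.s 0) (A.actPos_zero d)).trans (A.s_compose _ _)).symm
    | k + 1 => A.actPos.app_s k d
  app_t k d := match k with
    | 0 => (base_bt 0 d).trans ((congrArg (X.t 0) (A.actPos_zero d)).trans
        (A.t_compose _ _ d.1.isWord_word)).symm
    | k + 1 => A.actPos.app_t k d

theorem act_unit : TUnit X ≫ A.act = 𝟙 X := by
  have h1 : GlobSet.shiftMap (TUnit X) ≫ A.actPos = 𝟙 X.shift := by
    rw [← whiskUnit_diagram, Category.assoc, A.whiskDiagram_actPos, A.whiskUnit_value]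
  refine GlobSet.hom_ext fun k x => ?_
  match k with
  | 0 => exact X.iterS_self x
  | k + 1 => exact congrArg (fun φ : X.shift ⟶ X.shift => φ.app k x) h1

/-- Whiskering by the value of a string is whiskering by its letters (`R_compose`), applied to each
member of `W`. -/
theorem Rs_flatMap : ∀ (p : (TObj X).cells 0) (W : List ((TObj X).cells 1)), (TObj X).IsWord p W →
    ∀ (k : ℕ) (z : X.cells (k + 1)), X.bt k z = baseOf p →
      (A.Rs (W.flatMap wordOf)).app k z = (A.Rs (W.map (A.actPos.app 0))).app k z
  | _, [], _, _, _, _ => rfl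
  | p, q :: W, h, k, z, hz => by
    have hq : X.bt k z = baseOf q := hz.trans (congrArg baseOf h.1.symm)
    have h1 : (A.R (A.actPos.app 0 q)).app k z = (A.Rs (wordOf q)).app k z := by
      rw [A.actPos_zero]
      exact A.R_compose _ _ q.1.isWord_word k z hq
    have h2 : X.bt k ((A.Rs (wordOf q)).app k z) = baseOf ((TObj X).t 0 q) := by
      refine (A.bt_Rs _ k z (by rw [hq]; exact q.1.isWord_word)).trans ?_
      rw [hq]
      exact (base_bt 0 q).symm
    rw [List.flatMap_cons, A.Rs_append]
    refine (Rs_flatMap _ W h.2 k _ h2).trans ?_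
    exact congrArg ((A.Rs (W.map (A.actPos.app 0))).app k) h1.symm

theorem Ls_flatMap : ∀ (p : (TObj X).cells 0) (W : List ((TObj X).cells 1)), (TObj X).IsWord p W →
    ∀ (k : ℕ) (z : X.cells (k + 1)), baseOf ((TObj X).wordEnd p W) = X.bs k z →
      (A.Ls (W.flatMap wordOf)).app k z = (A.Ls (W.map (A.actPos.app 0))).app k z
  | _, [], _, _, _, _ => rfl
  | p, q :: W, h, k, z, hz => by
    obtain ⟨h3, h4⟩ := isWord_flatMap _ W h.2
    have h2 : X.bs k ((A.Ls (W.flatMap wordOf)).app k z) = baseOf ((TObj X).t 0 q) :=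
      A.bs_Ls _ _ k z h3 (h4.trans hz)
    have h1 := A.L_compose (baseOf q) (wordOf q) q.1.isWord_word k _
      ((base_bt 0 q).symm.trans h2.symm)
    rw [← A.actPos_zero] at h1
    rw [List.flatMap_cons, A.Ls_append]
    refine h1.symm.trans ?_
    exact congrArg ((A.L (A.actPos.app 0 q)).app k) (Ls_flatMap _ W h.2 k z hz)

/-- Associativity when the outer diagram is a string or a single whiskered cell. In the second case
the composite is a graft of the inner diagram, and `actPos_graft` evaluates it. -/
theorem mult_whiskDiagram : whiskDiagram (TObj X) ≫ GlobSet.shiftMap (TMult X) ≫ A.actPos =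
    whiskSetMap A.act ≫ A.value := by
  refine GlobSet.hom_ext fun k z => ?_
  match k with
  | 0 =>
    have hz := Str.isWord z
    refine (A.actPos_zero _).trans ?_
    have h1 : ((Str.diagram z).comp.base) = baseOf (Str.base z) := base_comp _
    have h2 : (Str.diagram z).comp.word = (Str.word z).flatMap wordOf :=
      (word_comp _).trans (congrArg (List.flatMap wordOf) (Str.word_diagram z))
    refine (congrArg₂ A.compose h1 h2).trans ?_
    exact A.Rs_flatMap _ _ hz 0 _ (A.t_one _)
  | k + 1 =>
    have hz : (TObj X).IsWord (Whisk.base z)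
        (Whisk.left z ++ (unit (Whisk.cell z)).word ++ Whisk.right z) := by
      rw [word_unit]
      exact Whisk.isWord z
    have hc : (unit (Whisk.cell z)).comp = (Whisk.cell z).1 := comp_unit _ (Whisk.cell z).2
    have h1 := (comp_graft (unit (Whisk.cell z)) hz).trans
      (graft_congr (isWord_flatMap_graft _ hz) rfl rfl hc rfl)
    have hz' := Whisk.isWord z
    simp only [GlobSet.isWord_append, GlobSet.isWord_cons, GlobSet.wordEnd_append,
      GlobSet.wordEnd_cons, GlobSet.wordEnd_nil] at hz'
    obtain ⟨⟨hl, he, -⟩, hr⟩ := hz'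
    have hb : baseOf (Whisk.cell z) = baseOf ((TObj X).wordEnd (Whisk.base z) (Whisk.left z)) :=
      (base_bs _ _).symm.trans (congrArg baseOf he)
    have h4 : (TMult X).app (k + 2) ((whiskDiagram (TObj X)).app (k + 1) z) =
        ⟨graft (baseOf (Whisk.base z)) ((Whisk.left z).flatMap wordOf) (Whisk.cell z).1
          ((Whisk.right z).flatMap wordOf) (by
            rw [← hc]
            exact isWord_flatMap_graft _ hz), (Whisk.cell z).2⟩ := Subtype.ext h1
    refine (congrArg (A.actPos.app (k + 1)) h4).trans ?_
    refine (A.actPos_graft _ _ _ (Whisk.cell z) _ (hb.trans (isWord_flatMap _ _ hl).2.symm)).trans ?_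
    have h2 := A.Ls_flatMap _ _ hl (k + 1) (A.actPos.app (k + 1) (Whisk.cell z))
      (hb.symm.trans ((base_bs _ _).symm.trans (A.act.app_bs (k + 1) (Whisk.cell z))))
    have h3 := A.Rs_flatMap _ _ hr (k + 1) ((A.Ls ((Whisk.left z).map (A.actPos.app 0))).app (k + 1)
      (A.actPos.app (k + 1) (Whisk.cell z)))
      ((A.bt_Ls _ (k + 1) _).trans (A.act.app_bt (k + 1) (Whisk.cell z)).symm)
    exact (congrArg ((A.Rs ((Whisk.right z).flatMap wordOf)).app (k + 1)) h2).trans h3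

theorem suspHom_natural {X Y : GlobSet.{u} (n + 1)} (f : X ⟶ Y) :
    suspHom X ≫ GlobSet.shiftMap (TMap f) = TMap (GlobSet.shiftMap f) ≫ suspHom Y :=
  GlobSet.hom_ext fun _ d => Subtype.ext (susp_map f d.1).symm

theorem shiftMap_mult : GlobSet.shiftMap (TMult (TObj X)) ≫ GlobSet.shiftMap (TMult X) =
    GlobSet.shiftMap (TMap (TMult X)) ≫ GlobSet.shiftMap (TMult X) :=
  GlobSet.hom_ext fun _ d => Subtype.ext (comp_comp d.1)

/-- In positive dimension it suffices to test outer diagrams of the form `assemble`. Such a diagram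
has a single string whose labels are whiskered cells, so `mult_actPos` and `mult_whiskDiagram`
together cover it. -/
theorem act_assoc : TMult X ≫ A.act = TMap A.act ≫ A.act := by
  have h1 : GlobSet.shiftMap (TMult X) ≫ A.actPos = GlobSet.shiftMap (TMap A.act) ≫ A.actPos := by
    rw [← cancel_epi (assembleIso (TObj X)).hom]
    change assemble (TObj X) ≫ _ = assemble (TObj X) ≫ _
    rw [← Category.assoc (assemble (TObj X)) (GlobSet.shiftMap (TMap A.act)), assemble_natural,
      Category.assoc, A.assemble_actPos, ← Category.assoc (TMap _), ← TMap_comp,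
      ← A.mult_whiskDiagram, assemble, Category.assoc, Category.assoc, TMap_comp, Category.assoc]
    refine congrArg (fun φ => TMap (whiskDiagram (TObj X)) ≫ φ) ?_
    rw [TMap_comp, Category.assoc, ← A.mult_actPos,
      ← Category.assoc (GlobSet.shiftMap (TMult (TObj X))), shiftMap_mult, Category.assoc,
      ← Category.assoc (suspHom _), suspHom_natural, Category.assoc]
  refine GlobSet.hom_ext fun k x => ?_
  match k with
  | 0 => exact base_comp x.1
  | k + 1 => exact congrArg (fun φ : (TObj (TObj X)).shift ⟶ X.shift => φ.app k x) h1

end WhiskAlg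

end Sesqui

/-! ### Composing cells with strings by means of an action. -/

namespace Sesqui

open LDiagram

variable {n : ℕ} {X : GlobSet.{u} (n + 1)}

/-- A cell of positive dimension between two sequences of strings. -/
noncomputable def graftCell {k : ℕ} (x : X.cells 0) (l : List (X.cells 1)) (z : X.cells (k + 1))
    (r : List (X.cells 1)) (h : X.IsWord x (l ++ [X.edge k z] ++ r)) : (TObj X).cells (k + 1) :=
  ⟨graft x l (unit z) r (by rw [word_unit]; exact h), ((TUnit X).app (k + 1) z).2⟩

theorem isWord_parallel {x : X.cells 0} {l r : List (X.cells 1)} {f g : X.cells 1}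
    (hs : X.s 0 f = X.s 0 g) (ht : X.t 0 f = X.t 0 g) :
    X.IsWord x (l ++ [f] ++ r) ↔ X.IsWord x (l ++ [g] ++ r) := by
  simp only [GlobSet.isWord_append, GlobSet.isWord_cons, GlobSet.wordEnd_append,
    GlobSet.wordEnd_cons, GlobSet.wordEnd_nil, GlobSet.isWord_nil, hs, ht]

theorem graftCell_congr {k : ℕ} {x x' : X.cells 0} {l l' r r' : List (X.cells 1)}
    {z z' : X.cells (k + 1)} (h : X.IsWord x (l ++ [X.edge k z] ++ r)) (hx : x = x') (hl : l = l')
    (hz : z = z') (hr : r = r') (h') : graftCell x l z r h = graftCell x' l' z' r' h' := by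
  subst hx hl hz hr; rfl

theorem graftCell_source {k : ℕ} {x : X.cells 0} {l r : List (X.cells 1)} {z : X.cells (k + 2)}
    (h : X.IsWord x (l ++ [X.edge (k + 1) z] ++ r)) :
    (TObj X).s (k + 1) (graftCell x l z r h) = graftCell x l (X.s (k + 1) z) r h := by
  have h' : X.IsWord x (l ++ (unit z).word ++ r) := by
    rw [word_unit]
    exact h
  exact Subtype.ext ((source_graft (unit z) h').trans (graft_congr _ rfl rfl (unit_source z) rfl))

theorem graftCell_target {k : ℕ} {x : X.cells 0} {l r : List (X.cells 1)} {z : X.cells (k + 2)}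
    (h : X.IsWord x (l ++ [X.edge (k + 1) z] ++ r))
    (h' : X.IsWord x (l ++ [X.edge k (X.t (k + 1) z)] ++ r)) :
    (TObj X).t (k + 1) (graftCell x l z r h) = graftCell x l (X.t (k + 1) z) r h' := by
  refine Subtype.ext ((target_graft (unit z) (by rw [word_unit]; exact h) ?_).trans
    (graft_congr _ rfl rfl (unit_target z) rfl))
  rw [unit_target, word_unit]
  exact h'

theorem isWord_edge_t {k : ℕ} {x : X.cells 0} {l r : List (X.cells 1)} {z : X.cells (k + 2)} :
    X.IsWord x (l ++ [X.edge k (X.t (k + 1) z)] ++ r) ↔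
      X.IsWord x (l ++ [X.edge (k + 1) z] ++ r) :=
  isWord_parallel (X.bs_t k z) (X.bt_t k z)

open Classical in
/-- Composition with sequences of `1`-cells on both sides, where it makes sense. -/
noncomputable def ctxApp (u : TObj X ⟶ X) (x : X.cells 0 → X.cells 0) (l r : List (X.cells 1))
    (k : ℕ) (z : X.cells (k + 1)) : X.cells (k + 1) :=
  -- The initial object is a function of the 0-dimensional source of `z`: the identity serves right
  -- whiskering, a constant function left whiskering.
  if h : X.IsWord (x (X.bs k z)) (l ++ [X.edge k z] ++ r) then
    u.app (k + 1) (graftCell (x (X.bs k z)) l z r h) else z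

section

variable {u : TObj X ⟶ X} {x : X.cells 0 → X.cells 0} {l r : List (X.cells 1)} {k : ℕ}

theorem ctxApp_pos {z : X.cells (k + 1)} (h : X.IsWord (x (X.bs k z)) (l ++ [X.edge k z] ++ r)) :
    ctxApp u x l r k z = u.app (k + 1) (graftCell (x (X.bs k z)) l z r h) := dif_pos h

theorem ctxApp_neg {z : X.cells (k + 1)} (h : ¬ X.IsWord (x (X.bs k z)) (l ++ [X.edge k z] ++ r)) :
    ctxApp u x l r k z = z := dif_neg h

theorem ctxApp_s (z : X.cells (k + 2)) :
    ctxApp u x l r k (X.s (k + 1) z) = X.s (k + 1) (ctxApp u x l r (k + 1) z) := by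
  by_cases h : X.IsWord (x (X.bs (k + 1) z)) (l ++ [X.edge (k + 1) z] ++ r)
  · rw [ctxApp_pos h, ← u.app_s, graftCell_source]
    exact ctxApp_pos (z := X.s (k + 1) z) h
  · rw [ctxApp_neg h]
    exact ctxApp_neg (z := X.s (k + 1) z) h

theorem ctxApp_t (z : X.cells (k + 2)) :
    ctxApp u x l r k (X.t (k + 1) z) = X.t (k + 1) (ctxApp u x l r (k + 1) z) := by
  by_cases h : X.IsWord (x (X.bs (k + 1) z)) (l ++ [X.edge (k + 1) z] ++ r)
  · have h' := isWord_edge_t.2 h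
    rw [ctxApp_pos h, ← u.app_t, graftCell_target h h', ctxApp_pos (by rw [X.bs_t]; exact h')]
    exact congrArg (u.app (k + 1)) (graftCell_congr _ (congrArg x (X.bs_t k z)) rfl rfl rfl _)
  · rw [ctxApp_neg h, ctxApp_neg]
    rw [isWord_edge_t, X.bs_t]
    exact h

end

/-- `ctxApp` as a map of globular sets. -/
noncomputable def ctxHom (u : TObj X ⟶ X) (x : X.cells 0 → X.cells 0) (l r : List (X.cells 1)) :
    X.shift ⟶ X.shift where
  app := ctxApp u x l r
  app_s _ := ctxApp_s
  app_t _ := ctxApp_t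

/-- The laws of an action of the monad. -/
structure IsAction {n : ℕ} {X : GlobSet.{u} n} (u : TObj X ⟶ X) : Prop where
  unit_comp : TUnit X ≫ u = 𝟙 X
  mult_comp : TMult X ≫ u = TMap u ≫ u

namespace IsAction

variable {u : TObj X ⟶ X}

theorem app_unit (hu : IsAction u) (k : ℕ) (z : X.cells k) (h) : u.app k ⟨unit z, h⟩ = z :=
  congrArg (fun φ : X ⟶ X => φ.app k z) hu.unit_comp

theorem app_zero (hu : IsAction u) (p : (TObj X).cells 0) : u.app 0 p = baseOf p :=
  (congrArg (u.app 0) (show p = ⟨unit (baseOf p), p.2⟩ from Subtype.ext (eq_unit p.1))).trans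
    (hu.app_unit 0 _ p.2)

/-- Every 0-diagram is a unit, so `u` is forced in dimension 0 and the endpoints of a value are
those of the diagram. -/
theorem bs_app (hu : IsAction u) (k : ℕ) (p : (TObj X).cells (k + 1)) :
    X.bs k (u.app (k + 1) p) = baseOf p := by
  rw [← u.app_bs, hu.app_zero, base_bs]

theorem bt_app (hu : IsAction u) (k : ℕ) (p : (TObj X).cells (k + 1)) :
    X.bt k (u.app (k + 1) p) = X.wordEnd (baseOf p) (wordOf p) := by
  rw [← u.app_bt, hu.app_zero, base_bt]

theorem isWord_app (hu : IsAction u) {x : X.cells 0} {l r : List (X.cells 1)} {k : ℕ} {p : (TObj X).cells (k + 1)}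
    (h : X.IsWord x (l ++ wordOf p ++ r)) (hp : baseOf p = X.wordEnd x l) :
    X.IsWord x (l ++ [X.edge k (u.app (k + 1) p)] ++ r) := by
  have h1 := hu.bs_app k p
  have h2 := hu.bt_app k p
  simp only [GlobSet.isWord_append, GlobSet.isWord_cons, GlobSet.wordEnd_append,
    GlobSet.wordEnd_cons, GlobSet.wordEnd_nil, GlobSet.isWord_nil] at h ⊢
  refine ⟨⟨h.1.1, h1.trans hp, trivial⟩, ?_⟩
  have h3 : X.t 0 (X.edge k (u.app (k + 1) p)) = X.wordEnd (X.wordEnd x l) (wordOf p) := by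
    rw [← hp]
    exact h2
  rw [h3]
  exact h.2

/-- Associativity for grafts of diagrams. -/
theorem app_graft_flatMap (hu : IsAction u) {k : ℕ} (x : (TObj X).cells 0) (U V : List ((TObj X).cells 1))
    (p : (TObj X).cells (k + 1)) (h : (TObj X).IsWord x (U ++ [(TObj X).edge k p] ++ V))
    (h1 : X.IsWord (baseOf x) (U.flatMap wordOf ++ wordOf p ++ V.flatMap wordOf))
    (h2 : X.IsWord (baseOf x) (U.map (u.app 1) ++ [X.edge k (u.app (k + 1) p)] ++
      V.map (u.app 1))) :
    u.app (k + 1) ⟨graft (baseOf x) (U.flatMap wordOf) p.1 (V.flatMap wordOf) h1, p.2⟩ =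
      u.app (k + 1) (graftCell (baseOf x) (U.map (u.app 1)) (u.app (k + 1) p) (V.map (u.app 1)) h2) := by
  have hw : (TObj X).IsWord x (U ++ (unit p).word ++ V) := by
    rw [word_unit]
    exact h
  have e1 : (graft x U (unit p) V hw).comp =
      graft (baseOf x) (U.flatMap wordOf) p.1 (V.flatMap wordOf) h1 :=
    (comp_graft (unit p) hw).trans (graft_congr _ rfl rfl (comp_unit p.1 p.2) rfl)
  have e2 : (graft x U (unit p) V hw).map u = graft (baseOf x) (U.map (u.app 1))
      (unit (u.app (k + 1) p)) (V.map (u.app 1)) (by rw [word_unit]; exact h2) := by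
    have hx := hu.app_zero x
    refine (map_graft u (unit p) hw ?_).trans (graft_congr _ hx rfl (map_unit u p) rfl)
    rw [map_unit, word_unit, hx]
    exact h2
  -- The associativity law is evaluated on the unit diagram on `p` with the strings `U` and `V`
  -- added: multiplying gives a graft of `p`, applying `u` to the labels gives a graft of its value.
  have e3 := congrArg (fun φ => GlobSet.Hom.app φ (k + 1)
    (⟨graft x U (unit p) V hw, p.2⟩ : (TObj (TObj X)).cells (k + 1))) hu.mult_comp
  refine (congrArg (u.app (k + 1)) (Subtype.ext e1.symm)).trans (e3.trans ?_)
  exact congrArg (u.app (k + 1)) (Subtype.ext e2)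

/-- The inner diagram may be evaluated before the strings are added. The strings are taken as unit
diagrams on single letters, which are unchanged by flattening and by evaluation. -/
theorem app_graft (hu : IsAction u) {k : ℕ} (x : X.cells 0) (l r : List (X.cells 1)) (p : (TObj X).cells (k + 1))
    (hp : baseOf p = X.wordEnd x l) (h : X.IsWord x (l ++ wordOf p ++ r)) :
    u.app (k + 1) ⟨graft x l p.1 r h, p.2⟩ =
      u.app (k + 1) (graftCell x l (u.app (k + 1) p) r (hu.isWord_app h hp)) := by
  have h1 : ∀ l : List (X.cells 1), (l.map ((TUnit X).app 1)).flatMap wordOf = l := fun l => by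
    rw [List.flatMap_map]
    exact (List.flatMap_congr fun f _ => word_unit (X := X) (k := 0) f).trans
      (List.flatMap_singleton' l)
  have h2 : ∀ l : List (X.cells 1), (l.map ((TUnit X).app 1)).map (u.app 1) = l := fun l => by
    rw [List.map_map]
    exact (List.map_congr_left fun f _ => hu.app_unit 1 f _).trans (List.map_id l)
  have h3 : baseOf ((TUnit X).app 0 x) = x := X.iterS_self x
  have h4 : (TObj X).IsWord ((TUnit X).app 0 x) (l.map ((TUnit X).app 1) ++ [(TObj X).edge k p] ++
      r.map ((TUnit X).app 1)) := by
    simp only [GlobSet.isWord_append, GlobSet.isWord_cons, GlobSet.wordEnd_append,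
      GlobSet.wordEnd_cons, GlobSet.wordEnd_nil, GlobSet.isWord_nil, GlobSet.wordEnd_map] at h ⊢
    refine ⟨⟨GlobSet.isWord_map _ _ _ h.1.1, ?_, trivial⟩, ?_⟩
    · exact TObj_ext_zero ((base_bs k p).trans (hp.trans (X.iterS_self _).symm))
    · have h5 : (TObj X).t 0 ((TObj X).edge k p) =
          (TUnit X).app 0 (X.wordEnd (X.wordEnd x l) (wordOf p)) := by
        refine TObj_ext_zero ((base_bt k p).trans (Eq.trans ?_ (X.iterS_self _).symm))
        rw [hp]
        rfl
      rw [h5]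
      exact GlobSet.isWord_map _ _ _ h.2
  have h5 := hu.app_graft_flatMap _ _ _ p h4 (by rw [h1, h1, h3]; exact h)
    (by rw [h2, h2, h3]; exact hu.isWord_app h hp)
  refine Eq.trans (congrArg (u.app (k + 1)) (Subtype.ext ?_)) (h5.trans (congrArg (u.app (k + 1))
    (graftCell_congr _ h3 (h2 l) rfl (h2 r) _)))
  exact graft_congr h h3.symm (h1 l).symm rfl (h1 r).symm

/-- By `app_graft` the outer strings may be added before the inner evaluation, and grafts of grafts
are grafts. The laws of whiskering follow by concatenating strings. -/
theorem ctxApp_comp (hu : IsAction u) {x x' : X.cells 0 → X.cells 0} {l l' r r' : List (X.cells 1)} {k : ℕ}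
    {z : X.cells (k + 1)} (h : X.IsWord (x (X.bs k z)) (l ++ [X.edge k z] ++ r))
    (hx : x (X.bs k z) = X.wordEnd (x' (x (X.bs k z))) l')
    (h' : X.IsWord (x' (x (X.bs k z))) ((l' ++ l) ++ [X.edge k z] ++ (r ++ r'))) :
    ctxApp u x' l' r' k (ctxApp u x l r k z) =
      u.app (k + 1) (graftCell (x' (x (X.bs k z))) (l' ++ l) z (r ++ r') h') := by
  have h1 : wordOf (graftCell (x (X.bs k z)) l z r h) = l ++ [X.edge k z] ++ r := by
    refine (word_graft (unit z) (by rw [word_unit]; exact h)).trans ?_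
    rw [word_unit]
  have h2 : X.IsWord (x' (x (X.bs k z))) (l' ++ wordOf (graftCell (x (X.bs k z)) l z r h) ++ r') := by
    rw [h1]
    simpa using h'
  have h3 := hu.app_graft _ l' r' (graftCell (x (X.bs k z)) l z r h) hx h2
  have h4 : X.bs k (u.app (k + 1) (graftCell (x (X.bs k z)) l z r h)) = x (X.bs k z) :=
    hu.bs_app k _
  rw [ctxApp_pos h, ctxApp_pos (by rw [h4]; exact hu.isWord_app h2 hx)]
  refine (congrArg (u.app (k + 1)) (graftCell_congr _ (congrArg x' h4) rfl rfl rfl _)).trans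
    (h3.symm.trans ?_)
  refine congrArg (u.app (k + 1)) (Subtype.ext (graft_graft (unit z) ?_ h2 ?_))
  · rw [word_unit]
    exact h
  · rw [word_unit]
    exact h'

/-- Both sides are the value of the suspended diagram with the strings `l` and `r` added: on one
side they are added to every label (`graft_comp_susp`), on the other to the whole diagram
(`app_graft`). -/
theorem susp_ctxHom (hu : IsAction u) (x : X.cells 0 → X.cells 0) (l r : List (X.cells 1)) {k : ℕ}
    (d : (TObj X.shift).cells k) (h : X.IsWord (x (X.s 0 (baseOf d))) (l ++ [X.edge 0 (baseOf d)] ++ r)) :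
    u.app (k + 1) ((suspHom X).app k ((TMap (ctxHom u x l r)).app k d)) =
      (ctxHom u x l r).app k (u.app (k + 1) ((suspHom X).app k d)) := by
  set b := X.s 0 (baseOf d) with hb
  -- All labels share the endpoints of the base, so after restriction to such cells the context
  -- applies everywhere and the default branch disappears.
  set P := X.endpoints fun p q => p = b ∧ q = X.t 0 (baseOf d) with hP
  obtain ⟨d', hd⟩ := exists_map_incl P d.1 ⟨rfl, rfl⟩
  have hz : ∀ k (z : P.sub.cells k), X.IsWord (x b) (l ++ [X.edge k z.1] ++ r) := fun k z =>
    (isWord_parallel z.2.1.symm z.2.2.symm).1 h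
  set i : P.sub ⟶ (TObj X).shift := P.incl ≫ GlobSet.shiftMap (TUnit X) with hi
  have hw : ∀ k (z : P.sub.cells k), X.IsWord (x b) (l ++ wordOf (i.app k z) ++ r) := fun k z => by
    have h1 : wordOf (i.app k z) = [X.edge k z.1] := word_unit (X := X) (k := k) z.1
    rw [h1]
    exact hz k z
  have h1 : P.incl ≫ ctxHom u x l r = graftHom i (x b) l r hw ≫ GlobSet.shiftMap u := by
    refine GlobSet.hom_ext fun k z => ?_
    have hbz : X.bs k z.1 = b := z.2.1
    refine (ctxApp_pos (z := z.1) (by rw [hbz]; exact hz k z)).trans ?_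
    exact congrArg (u.app (k + 1)) (graftCell_congr _ (congrArg x hbz) rfl rfl rfl (hz k z))
  have h2 : (susp (d'.map i)).comp = susp d.1 := by
    have h3 : d'.map i = (d'.map P.incl).map (GlobSet.shiftMap (TUnit X)) := rfl
    rw [h3, hd, susp_map, comp_map_unit]
  have hp : baseOf ((suspHom X).app k d) = X.wordEnd (x b) l := by
    simp only [GlobSet.isWord_append, GlobSet.isWord_cons] at h
    exact h.1.2.1
  have hs : X.IsWord (x b) (l ++ wordOf ((suspHom X).app k d) ++ r) := by
    have h3 : wordOf ((suspHom X).app k d) = [baseOf d] := word_susp d.1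
    rw [h3]
    exact h
  have hbs : X.bs k (u.app (k + 1) ((suspHom X).app k d)) = b := hu.bs_app k _
  refine Eq.trans ?_ ((hu.app_graft (x b) l r ((suspHom X).app k d) hp hs).trans
    (Eq.trans ?_ (ctxApp_pos (x := x) (l := l) (r := r) (u := u)
      (by rw [hbs]; exact hu.isWord_app hs hp)).symm))
  · have e1 : d.1.map (ctxHom u x l r) = (d'.map (graftHom i (x b) l r hw)).map
        (GlobSet.shiftMap u) := by
      rw [← hd]
      exact congrArg d'.map h1
    have e2 := congrArg (fun φ => GlobSet.Hom.app φ (k + 1)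
      (⟨susp (d'.map (graftHom i (x b) l r hw)), Nat.succ_le_succ d.2⟩ :
        (TObj (TObj X)).cells (k + 1))) hu.mult_comp
    refine (congrArg (u.app (k + 1)) (Subtype.ext ((congrArg susp e1).trans
      (susp_map u _)))).trans (e2.symm.trans (congrArg (u.app (k + 1)) (Subtype.ext ?_)))
    exact (graft_comp_susp i (x b) l r hw d').trans (graft_congr _ rfl rfl h2 rfl)
  · exact congrArg (u.app (k + 1)) (graftCell_congr _ (congrArg x hbs).symm rfl rfl rfl _)

end IsAction

end Sesqui

/-! ### The whiskering algebra of an action. -/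

namespace Sesqui

open LDiagram

variable {n : ℕ} {X : GlobSet.{u} (n + 1)}

/-- The diagram of a composable sequence as a cell. -/
noncomputable def stringCell (x : X.cells 0) (l : List (X.cells 1)) (h : X.IsWord x l) :
    (TObj X).cells 1 := ⟨string x l h, Nat.le_add_left 1 n⟩

theorem wordOf_stringCell {x : X.cells 0} {l : List (X.cells 1)} (h : X.IsWord x l) :
    wordOf (k := 0) (stringCell x l h) = l := word_string x l h

theorem eq_stringCell {p : (TObj X).cells 1} {x : X.cells 0} {l : List (X.cells 1)}
    (h : X.IsWord x l) (hx : baseOf p = x) (hl : wordOf p = l) : p = stringCell x l h :=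
  Subtype.ext (ext_word_one hx (Eq.trans hl (word_string x l h).symm))

theorem graftCell_zero {x : X.cells 0} {l r : List (X.cells 1)} {z : X.cells 1}
    (h : X.IsWord x (l ++ [X.edge 0 z] ++ r)) : graftCell (k := 0) x l z r h =
      stringCell x (l ++ [z] ++ r) h :=
  eq_stringCell h rfl ((word_graft _ (by rw [word_unit]; exact h)).trans (by rw [word_unit]))

namespace IsAction

variable {u : TObj X ⟶ X}

theorem isWord_R {k : ℕ} {z : X.cells (k + 1)} {f : X.cells 1} :
    X.IsWord (X.bs k z) ([] ++ [X.edge k z] ++ [f]) ↔ X.bt k z = X.s 0 f :=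
  ⟨fun h => h.2.1.symm, fun h => ⟨rfl, h.symm, trivial⟩⟩

theorem isWord_L {k : ℕ} {z : X.cells (k + 1)} {f : X.cells 1} :
    X.IsWord (X.s 0 f) ([f] ++ [X.edge k z] ++ []) ↔ X.t 0 f = X.bs k z :=
  ⟨fun h => h.2.1.symm, fun h => ⟨rfl, h.symm, trivial⟩⟩

/-- The right whiskering determined by an action. -/
noncomputable def right (u : TObj X ⟶ X) (f : X.cells 1) : X.shift ⟶ X.shift :=
  ctxHom u id [] [f]

/-- The left whiskering determined by an action. -/
noncomputable def left (u : TObj X ⟶ X) (f : X.cells 1) : X.shift ⟶ X.shift :=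
  ctxHom u (fun _ => X.s 0 f) [f] []

theorem right_pos {k : ℕ} {z : X.cells (k + 1)} {f : X.cells 1} (h : X.bt k z = X.s 0 f) :
    (right u f).app k z = u.app (k + 1) (graftCell (X.bs k z) [] z [f] (isWord_R.2 h)) :=
  ctxApp_pos (x := id) _

theorem left_pos {k : ℕ} {z : X.cells (k + 1)} {f : X.cells 1} (h : X.t 0 f = X.bs k z) :
    (left u f).app k z = u.app (k + 1) (graftCell (X.s 0 f) [f] z [] (isWord_L.2 h)) :=
  ctxApp_pos (x := fun _ => X.s 0 f) _

theorem right_zero {z f : X.cells 1} (h : X.t 0 z = X.s 0 f) :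
    (right u f).app 0 z = u.app 1 (stringCell (X.s 0 z) [z, f] ⟨rfl, h.symm, trivial⟩) :=
  (right_pos (k := 0) h).trans (congrArg (u.app 1) (graftCell_zero _))

theorem left_zero {z f : X.cells 1} (h : X.t 0 f = X.s 0 z) :
    (left u f).app 0 z = u.app 1 (stringCell (X.s 0 f) [f, z] ⟨rfl, h.symm, trivial⟩) :=
  (left_pos (k := 0) h).trans (congrArg (u.app 1) (graftCell_zero _))

theorem graftCell_nil {k : ℕ} {x : X.cells 0} {z : X.cells (k + 1)} (hx : x = X.bs k z)
    (h : X.IsWord x ([] ++ [X.edge k z] ++ [])) :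
    graftCell x [] z [] h = (TUnit X).app (k + 1) z := by
  subst hx
  have hb : (unit z).base = X.bs k z := base_unit z
  have hw : X.IsWord (unit z).base ([] ++ (unit z).word ++ []) := by
    rw [word_unit, hb]
    exact h
  exact Subtype.ext ((graft_congr (by rw [word_unit]; exact h) hb.symm rfl rfl rfl).trans
    (graft_nil (unit z) hw))

theorem t_string (hu : IsAction u) {x : X.cells 0} {l : List (X.cells 1)} (h : X.IsWord x l) :
    X.t 0 (u.app 1 (stringCell x l h)) = X.wordEnd x l :=
  (hu.bt_app 0 _).trans (congrArg (X.wordEnd x) (wordOf_stringCell h))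

theorem app_graftCell_flatMap (hu : IsAction u) {k : ℕ} (x : X.cells 0)
    (U V : List ((TObj X).cells 1)) (z : X.cells (k + 1))
    (h : (TObj X).IsWord ((TUnit X).app 0 x)
      (U ++ [(TObj X).edge k ((TUnit X).app (k + 1) z)] ++ V))
    (h1 : X.IsWord x (U.flatMap wordOf ++ [X.edge k z] ++ V.flatMap wordOf))
    (h2 : X.IsWord x (U.map (u.app 1) ++ [X.edge k z] ++ V.map (u.app 1))) :
    u.app (k + 1) (graftCell x (U.flatMap wordOf) z (V.flatMap wordOf) h1) =
      u.app (k + 1) (graftCell x (U.map (u.app 1)) z (V.map (u.app 1)) h2) := by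
  have hx : baseOf ((TUnit X).app 0 x) = x := X.iterS_self x
  have hw : wordOf ((TUnit X).app (k + 1) z) = [X.edge k z] := word_unit z
  have hz : u.app (k + 1) ((TUnit X).app (k + 1) z) = z := hu.app_unit _ _ _
  refine Eq.trans ?_ ((hu.app_graft_flatMap _ U V _ h (by rw [hx, hw]; exact h1)
    (by rw [hx, hz]; exact h2)).trans
      (congrArg (u.app (k + 1)) (graftCell_congr _ hx rfl hz rfl _)))
  refine congrArg (u.app (k + 1)) (Subtype.ext ?_)
  exact graft_congr (by rw [word_unit]; exact h1) hx.symm rfl rfl rfl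

/-- Composition on the right with a composite. -/
theorem right_app (hu : IsAction u) {k : ℕ} (z : X.cells (k + 1)) (q : (TObj X).cells 1)
    (h : X.bt k z = baseOf q) (hw : X.IsWord (X.bs k z) ([] ++ [X.edge k z] ++ wordOf q)) :
    (right u (u.app 1 q)).app k z = u.app (k + 1) (graftCell (X.bs k z) [] z (wordOf q) hw) := by
  have hw1 : wordOf q = [q].flatMap wordOf := (List.flatMap_singleton _ _).symm
  have h2 : (TObj X).IsWord ((TUnit X).app 0 (X.bs k z))
      ([] ++ [(TObj X).edge k ((TUnit X).app (k + 1) z)] ++ [q]) := by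
    refine ⟨((TUnit X).app_bs k z).symm, ?_, trivial⟩
    exact TObj_ext_zero (h.symm.trans ((X.iterS_self _).symm.trans
      (congrArg baseOf ((TUnit X).app_bt k z))))
  refine (right_pos (h.trans (hu.bs_app 0 q).symm)).trans ?_
  refine (hu.app_graftCell_flatMap (X.bs k z) [] [q] z h2 (by rw [← hw1]; exact hw) _).symm.trans ?_
  exact congrArg (u.app (k + 1)) (graftCell_congr _ rfl rfl rfl hw1.symm _)

theorem left_app (hu : IsAction u) {k : ℕ} (z : X.cells (k + 1)) (q : (TObj X).cells 1)
    (h : X.wordEnd (baseOf q) (wordOf q) = X.bs k z)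
    (hw : X.IsWord (baseOf q) (wordOf q ++ [X.edge k z] ++ [])) :
    (left u (u.app 1 q)).app k z = u.app (k + 1) (graftCell (baseOf q) (wordOf q) z [] hw) := by
  have hw1 : wordOf q = [q].flatMap wordOf := (List.flatMap_singleton _ _).symm
  have h2 : (TObj X).IsWord ((TUnit X).app 0 (baseOf q))
      ([q] ++ [(TObj X).edge k ((TUnit X).app (k + 1) z)] ++ []) := by
    refine ⟨TObj_ext_zero (X.iterS_self _).symm, ?_, trivial⟩
    refine TObj_ext_zero (Eq.trans ?_ (base_bt 0 q).symm)
    exact (congrArg baseOf ((TUnit X).app_bs k z)).symm.trans ((X.iterS_self _).trans h.symm)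
  have h3 : X.s 0 (u.app 1 q) = baseOf q := hu.bs_app 0 q
  have h4 : X.t 0 (u.app 1 q) = X.bs k z := (hu.bt_app 0 q).trans h
  have h5 : X.IsWord (baseOf q) ([u.app 1 q] ++ [X.edge k z] ++ []) := ⟨h3, h4.symm, trivial⟩
  refine (left_pos h4).trans ?_
  refine (congrArg (u.app (k + 1)) (graftCell_congr _ h3 rfl rfl rfl h5)).trans ?_
  refine (hu.app_graftCell_flatMap (baseOf q) [q] [] z h2 (by rw [← hw1]; exact hw) _).symm.trans ?_
  exact congrArg (u.app (k + 1)) (graftCell_congr _ rfl hw1.symm rfl rfl _)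

/-- The action on diagrams with a single string inherits associativity, since suspension commutes
with composition (`comp_susp_susp`). -/
theorem suspHom_assoc (hu : IsAction u) :
    TMult X.shift ≫ suspHom X ≫ GlobSet.shiftMap u =
      TMap (suspHom X ≫ GlobSet.shiftMap u) ≫ suspHom X ≫ GlobSet.shiftMap u := by
  refine GlobSet.hom_ext fun k d => ?_
  have e1 := congrArg (fun φ => GlobSet.Hom.app φ (k + 1)
    (⟨susp (d.1.map (suspHom X)), Nat.succ_le_succ d.2⟩ : (TObj (TObj X)).cells (k + 1)))
      hu.mult_comp
  have e2 : (suspHom X).app k ((TMult X.shift).app k d) = (TMult X).app (k + 1)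
    ⟨susp (d.1.map (suspHom X)), Nat.succ_le_succ d.2⟩ := Subtype.ext (comp_susp_susp d.1).symm
  have e3 : (suspHom X).app k ((TMap (suspHom X ≫ GlobSet.shiftMap u)).app k d) =
      (TMap u).app (k + 1) ⟨susp (d.1.map (suspHom X)), Nat.succ_le_succ d.2⟩ :=
    Subtype.ext (susp_map u (d.1.map (suspHom X)))
  exact (congrArg (u.app (k + 1)) e2).trans (e1.trans (congrArg (u.app (k + 1)) e3.symm))

/-- The whiskering operations determined by an action. -/
noncomputable def whiskAlg (hu : IsAction u) : WhiskAlg X where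
  one x := u.app 1 (stringCell x [] trivial)
  R := right u
  L := left u
  a := suspHom X ≫ GlobSet.shiftMap u
  s_one x := hu.bs_app 0 _
  t_one x := hu.t_string (X := X) (x := x) (l := []) trivial
  s_R f z h := by
    rw [right_zero h]
    exact hu.bs_app 0 _
  t_R f z h := by
    rw [right_zero h]
    exact hu.t_string _
  s_L f z h := by
    rw [left_zero h]
    exact hu.bs_app 0 _
  t_L f z h := by
    rw [left_zero h]
    exact hu.t_string _
  R_of_ne f k z h := ctxApp_neg (x := id) (mt isWord_R.1 h)
  L_of_ne f k z h := ctxApp_neg (x := fun _ => X.s 0 f) (mt isWord_L.1 h)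
  R_one x k z h := by
    -- The identity is the value of the empty string, so whiskering by it adds no letters and
    -- returns a unit diagram.
    have hw := wordOf_stringCell (X := X) (x := x) (l := []) trivial
    refine (hu.right_app z (stringCell x [] trivial) h (by rw [hw]; exact ⟨rfl, trivial⟩)).trans ?_
    refine Eq.trans ?_ (hu.app_unit (k + 1) z ((TUnit X).app (k + 1) z).2)
    refine congrArg (u.app (k + 1)) (Eq.trans ?_ (graftCell_nil rfl ⟨rfl, trivial⟩))
    exact graftCell_congr _ rfl rfl rfl hw _
  L_one x k z h := by
    have hw := wordOf_stringCell (X := X) (x := x) (l := []) trivial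
    refine (hu.left_app z (stringCell x [] trivial) (by rw [hw]; exact h)
      (by rw [hw]; exact ⟨h.symm, trivial⟩)).trans ?_
    refine Eq.trans ?_ (hu.app_unit (k + 1) z ((TUnit X).app (k + 1) z).2)
    refine congrArg (u.app (k + 1)) (Eq.trans ?_ (graftCell_nil h ⟨h.symm, trivial⟩))
    exact graftCell_congr _ rfl hw rfl rfl _
  R_R f h k z hf hz := by
    have hi : X.IsWord (X.s 0 h) [h, f] := ⟨rfl, hf.symm, trivial⟩
    have hw := wordOf_stringCell hi
    rw [right_zero hf]
    -- Both sides are the value of `z` followed by the string `[h, f]`: one by `right_app`, the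
    -- other by `ctxApp_comp`.
    have h1 : X.IsWord (X.bs k z) ([] ++ [X.edge k z] ++ [h, f]) := ⟨rfl, hz.symm, hf.symm, trivial⟩
    refine (hu.right_app z (stringCell (X.s 0 h) [h, f] hi) hz (by rw [hw]; exact h1)).trans ?_
    refine Eq.trans ?_ (hu.ctxApp_comp (x := id) (x' := id) (l' := []) (r' := [f])
      (isWord_R.2 hz) rfl h1).symm
    exact congrArg (u.app (k + 1)) (graftCell_congr _ rfl rfl rfl hw _)
  L_R f h k z hf hz := by
    have hi : X.IsWord (X.s 0 h) [h, f] := ⟨rfl, hf.symm, trivial⟩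
    have hw := wordOf_stringCell hi
    rw [right_zero hf]
    have h1 : X.IsWord (X.s 0 h) ([h, f] ++ [X.edge k z] ++ []) := ⟨rfl, hf.symm, hz.symm, trivial⟩
    refine (hu.left_app z (stringCell (X.s 0 h) [h, f] hi) (by rw [hw]; exact hz)
      (by rw [hw]; exact h1)).trans ?_
    refine Eq.trans ?_ (hu.ctxApp_comp (x := fun _ => X.s 0 f) (x' := fun _ => X.s 0 h)
      (l' := [h]) (r' := []) (isWord_L.2 hz) hf.symm h1).symm
    exact congrArg (u.app (k + 1)) (graftCell_congr _ rfl hw rfl rfl _)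
  L_comm f g k z hf hg := by
    -- In either order the result is the value of `z` placed between `f` and `g`.
    have h1 : X.IsWord (X.s 0 f) ([f] ++ [X.edge k z] ++ [g]) := ⟨rfl, hf.symm, hg.symm, trivial⟩
    refine (hu.ctxApp_comp (x := id) (x' := fun _ => X.s 0 f) (l' := [f]) (r' := [])
      (isWord_R.2 hg) hf.symm h1).trans ?_
    exact (hu.ctxApp_comp (x := fun _ => X.s 0 f) (x' := id) (l' := []) (r' := [g])
      (isWord_L.2 hf) rfl h1).symm
  R_eq_L f h hf := (right_zero hf).trans (left_zero hf).symm
  a_unit := by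
    refine GlobSet.hom_ext fun k z => ?_
    have h1 : (suspHom X).app k ((TUnit X.shift).app k z) = (TUnit X).app (k + 1) z :=
      Subtype.ext (susp_unit (X := X) z)
    exact (congrArg (u.app (k + 1)) h1).trans (hu.app_unit (k + 1) z ((TUnit X).app (k + 1) z).2)
  a_assoc := hu.suspHom_assoc
  a_R f k d h := hu.susp_ctxHom _ _ _ d (isWord_R.2 h)
  a_L f k d h := hu.susp_ctxHom _ _ _ d (isWord_L.2 h)

end IsAction

end Sesqui

/-! ### Actions and whiskering algebras determine each other, also on morphisms. -/

namespace Sesqui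

open LDiagram

variable {n : ℕ} {X Y : GlobSet.{u} (n + 1)}

namespace WhiskAlg

@[ext]
theorem ext_of_ops {A B : WhiskAlg X} (h1 : ∀ x, A.one x = B.one x) (h2 : ∀ f, A.R f = B.R f)
    (h3 : ∀ f, A.L f = B.L f) (h4 : A.a = B.a) : A = B := by
  obtain ⟨_, _, _, _, _⟩ := A
  obtain ⟨_, _, _, _, _⟩ := B
  obtain rfl := funext h1
  obtain rfl := funext h2
  obtain rfl := funext h3
  obtain rfl := h4
  rfl

theorem isAction (A : WhiskAlg X) : IsAction A.act := ⟨A.act_unit, A.act_assoc⟩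

theorem act_graftCell (A : WhiskAlg X) {k : ℕ} (x : X.cells 0) (l r : List (X.cells 1))
    (z : X.cells (k + 1)) (h : X.IsWord x (l ++ [X.edge k z] ++ r)) :
    A.act.app (k + 1) (graftCell x l z r h) = (A.Rs r).app k ((A.Ls l).app k z) := by
  have h1 : baseOf ((TUnit X).app (k + 1) z) = X.wordEnd x l := by
    simp only [GlobSet.isWord_append, GlobSet.isWord_cons] at h
    exact (base_unit z).trans h.1.2.1
  refine (A.actPos_graft x l r ((TUnit X).app (k + 1) z) _ h1).trans ?_
  exact congrArg (fun y => (A.Rs r).app k ((A.Ls l).app k y)) (A.isAction.app_unit (k + 1) z _)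

/-- On composable cells the extracted whiskering evaluates a graft of a unit, which is the original
whiskering by `actPos_graft`; on other cells both are the identity. -/
theorem whiskAlg_isAction (A : WhiskAlg X) : A.isAction.whiskAlg = A := by
  refine ext_of_ops (fun x => ?_) (fun f => GlobSet.hom_ext fun k z => ?_)
    (fun f => GlobSet.hom_ext fun k z => ?_) A.suspHom_actPos
  · exact A.actPos_string x [] trivial _
  · by_cases h : X.bt k z = X.s 0 f
    · exact (IsAction.right_pos h).trans (A.act_graftCell _ _ _ _ _)
    · exact (A.isAction.whiskAlg.R_of_ne f k z h).trans (A.R_of_ne f k z h).symm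
  · by_cases h : X.t 0 f = X.bs k z
    · exact (IsAction.left_pos h).trans (A.act_graftCell _ _ _ _ _)
    · exact (A.isAction.whiskAlg.L_of_ne f k z h).trans (A.L_of_ne f k z h).symm

end WhiskAlg

namespace IsAction

variable {u : TObj X ⟶ X} (hu : IsAction u)

theorem Ls_eq (hu : IsAction u) {k : ℕ} (z : X.cells (k + 1)) : ∀ (x : X.cells 0)
    (l : List (X.cells 1)) (h : X.IsWord x (l ++ [X.edge k z] ++ [])),
    (hu.whiskAlg.Ls l).app k z = u.app (k + 1) (graftCell x l z [] h)
  | x, [], h => ((hu.app_unit (k + 1) z ((TUnit X).app (k + 1) z).2).symm).trans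
      (congrArg (u.app (k + 1)) (graftCell_nil h.1.symm h).symm)
  | x, f :: l, h => by
    have h1 := (Ls_eq hu z (X.t 0 f) l h.2).trans
      (ctxApp_pos (u := u) (x := fun _ => X.t 0 f) (l := l) (r := []) h.2).symm
    have h2 : X.IsWord (X.s 0 f) (([f] ++ l) ++ [X.edge k z] ++ ([] ++ [])) := ⟨rfl, h.2⟩
    refine (congrArg ((hu.whiskAlg.L f).app k) h1).trans ?_
    refine (hu.ctxApp_comp (x := fun _ => X.t 0 f) (x' := fun _ => X.s 0 f) (l' := [f]) (r' := [])
      h.2 rfl h2).trans ?_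
    exact congrArg (u.app (k + 1)) (graftCell_congr _ h.1 rfl rfl rfl _)

theorem Rs_eq (hu : IsAction u) {k : ℕ} (z : X.cells (k + 1)) (x : X.cells 0)
    (l : List (X.cells 1)) : ∀ (r r' : List (X.cells 1)) (h : X.IsWord x (l ++ [X.edge k z] ++ r))
      (h' : X.IsWord x (l ++ [X.edge k z] ++ (r ++ r'))),
    (hu.whiskAlg.Rs r').app k (u.app (k + 1) (graftCell x l z r h)) =
      u.app (k + 1) (graftCell x l z (r ++ r') h')
  | r, [], h, h' => congrArg (u.app (k + 1))
      (graftCell_congr h rfl rfl rfl (List.append_nil r).symm h')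
  | r, f :: r', h, h' => by
    have h3 : X.IsWord x (l ++ [X.edge k z] ++ (r ++ [f]) ++ r') := by simpa using h'
    have h4 : X.IsWord x (l ++ [X.edge k z] ++ (r ++ [f])) := by
      rw [GlobSet.isWord_append] at h3
      exact h3.1
    have h1 : (hu.whiskAlg.R f).app k (u.app (k + 1) (graftCell x l z r h)) =
        u.app (k + 1) (graftCell x l z (r ++ [f]) h4) :=
      (congrArg ((hu.whiskAlg.R f).app k)
        (ctxApp_pos (u := u) (x := fun _ => x) (l := l) (r := r) h).symm).trans
        (hu.ctxApp_comp (x := fun _ => x) (x' := id) (l' := []) (r' := [f]) h rfl h4)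
    refine (congrArg ((hu.whiskAlg.Rs r').app k) h1).trans ?_
    refine (Rs_eq hu z x l (r ++ [f]) r' h4 (by simpa using h')).trans ?_
    exact congrArg (u.app (k + 1)) (graftCell_congr _ rfl rfl rfl (by simp) h')

theorem Rs_string (hu : IsAction u) (x : X.cells 0) : ∀ (l r : List (X.cells 1))
    (h : X.IsWord x l) (h' : X.IsWord x (l ++ r)),
    (hu.whiskAlg.Rs r).app 0 (u.app 1 (stringCell x l h)) = u.app 1 (stringCell x (l ++ r) h')
  | l, [], h, h' => congrArg (u.app 1) (eq_stringCell h' rfl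
      ((wordOf_stringCell h).trans (List.append_nil l).symm))
  | l, f :: r, h, h' => by
    have h3 : X.IsWord x ((l ++ [f]) ++ r) := by simpa using h'
    have h4 : X.IsWord x (l ++ [f]) := ((GlobSet.isWord_append _ _ _).1 h3).1
    have hs : X.s 0 (u.app 1 (stringCell x l h)) = x := hu.bs_app 0 _
    have ht : X.t 0 (u.app 1 (stringCell x l h)) = X.s 0 f :=
      (hu.t_string h).trans ((GlobSet.isWord_append _ _ _).1 h').2.1.symm
    have hg : X.IsWord x ([] ++ wordOf (k := 0) (stringCell x l h) ++ [f]) := by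
      rw [wordOf_stringCell]
      exact h4
    have h1 : (hu.whiskAlg.R f).app 0 (u.app 1 (stringCell x l h)) =
        u.app 1 (stringCell x (l ++ [f]) h4) := by
      have h5 : X.IsWord x ([] ++ [X.edge 0 (u.app 1 (stringCell x l h))] ++ [f]) :=
        ⟨hs, ht.symm, trivial⟩
      refine (right_pos (k := 0) ht).trans ?_
      refine (congrArg (u.app 1) (graftCell_congr _ hs rfl rfl rfl h5)).trans ?_
      refine (hu.app_graft x [] [f] (stringCell x l h) rfl hg).symm.trans ?_
      refine congrArg (u.app 1) (eq_stringCell h4 rfl ((word_graft _ hg).trans ?_))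
      exact congrArg (fun w => [] ++ w ++ [f]) (wordOf_stringCell h)
    refine (congrArg ((hu.whiskAlg.Rs r).app 0) h1).trans ?_
    refine (Rs_string hu x (l ++ [f]) r h4 h3).trans ?_
    refine congrArg (u.app 1) (eq_stringCell h' rfl ((wordOf_stringCell h3).trans ?_))
    simp

/-- Adding the letters of a string or of the whiskers one at a time amounts to adding them all at
once, by repeated associativity (`Ls_eq`, `Rs_eq`, `Rs_string`). -/
theorem value_whiskAlg (hu : IsAction u) :
    hu.whiskAlg.value = whiskDiagram X ≫ GlobSet.shiftMap u := by
  refine GlobSet.hom_ext fun k z => ?_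
  match k with
  | 0 => exact hu.Rs_string (Str.base z) [] (Str.word z) trivial (Str.isWord z)
  | k + 1 =>
    have h := Whisk.isWord z
    have h1 : X.IsWord (Whisk.base z) (Whisk.left z ++ [X.edge (k + 1) (Whisk.cell z)] ++ []) := by
      rw [List.append_nil]
      exact ((GlobSet.isWord_append _ _ _).1 h).1
    refine (congrArg ((hu.whiskAlg.Rs (Whisk.right z)).app (k + 1))
      (hu.Ls_eq (Whisk.cell z) _ _ h1)).trans ?_
    exact hu.Rs_eq (Whisk.cell z) _ _ [] _ h1 h

/-- On an assembled diagram the associativity of `u` gives the recipe defining `actPos`: evaluate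
the whiskered labels, then a diagram with a single string. -/
theorem act_whiskAlg (hu : IsAction u) : hu.whiskAlg.act = u := by
  have h1 : hu.whiskAlg.actPos = GlobSet.shiftMap u := by
    rw [← cancel_epi (assembleIso X).hom]
    change assemble X ≫ _ = assemble X ≫ _
    have h2 : GlobSet.shiftMap (TMult X) ≫ GlobSet.shiftMap u =
        GlobSet.shiftMap (TMap u) ≫ GlobSet.shiftMap u := congrArg GlobSet.shiftMap hu.mult_comp
    rw [hu.whiskAlg.assemble_actPos, hu.value_whiskAlg, assemble, Category.assoc, Category.assoc,
      h2, ← Category.assoc (suspHom _), WhiskAlg.suspHom_natural, Category.assoc]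
    rfl
  refine GlobSet.hom_ext fun k d => ?_
  match k with
  | 0 => exact (hu.app_zero d).symm
  | k + 1 => exact congrArg (fun φ : (TObj X).shift ⟶ X.shift => φ.app k d) h1

end IsAction

/-- Maps of globular sets which preserve the operations. -/
structure WhiskAlg.IsHom (A : WhiskAlg X) (B : WhiskAlg Y) (φ : X ⟶ Y) : Prop where
  one : ∀ x, φ.app 1 (A.one x) = B.one (φ.app 0 x)
  R : ∀ f k z, X.bt k z = X.s 0 f →
    φ.app (k + 1) ((A.R f).app k z) = (B.R (φ.app 1 f)).app k (φ.app (k + 1) z)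
  L : ∀ f k z, X.t 0 f = X.bs k z →
    φ.app (k + 1) ((A.L f).app k z) = (B.L (φ.app 1 f)).app k (φ.app (k + 1) z)
  a : TMap (GlobSet.shiftMap φ) ≫ B.a = A.a ≫ GlobSet.shiftMap φ

namespace WhiskAlg.IsHom

variable {A : WhiskAlg X} {B : WhiskAlg Y} {φ : X ⟶ Y}

theorem Rs (h : A.IsHom B φ) : ∀ (l : List (X.cells 1)) (k : ℕ) (z : X.cells (k + 1)),
    X.IsWord (X.bt k z) l → φ.app (k + 1) ((A.Rs l).app k z) =
      (B.Rs (l.map (φ.app 1))).app k (φ.app (k + 1) z)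
  | [], _, _, _ => rfl
  | f :: l, k, z, hl => by
    have h1 : X.IsWord (X.bt k ((A.R f).app k z)) l := by
      rw [A.bt_R f k z hl.1.symm]
      exact hl.2
    exact (Rs h l k _ h1).trans (congrArg ((B.Rs (l.map (φ.app 1))).app k) (h.R f k z hl.1.symm))

theorem Ls (h : A.IsHom B φ) : ∀ (x : X.cells 0) (l : List (X.cells 1)) (k : ℕ)
    (z : X.cells (k + 1)), X.IsWord x l → X.wordEnd x l = X.bs k z →
      φ.app (k + 1) ((A.Ls l).app k z) = (B.Ls (l.map (φ.app 1))).app k (φ.app (k + 1) z)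
  | _, [], _, _, _, _ => rfl
  | x, f :: l, k, z, hl, hz => by
    have h1 := h.L f k ((A.Ls l).app k z) (A.bs_Ls _ l k z hl.2 hz).symm
    exact h1.trans (congrArg ((B.L (φ.app 1 f)).app k) (Ls h _ l k z hl.2 hz))

theorem value (h : A.IsHom B φ) :
    whiskSetMap φ ≫ B.value = A.value ≫ GlobSet.shiftMap φ := by
  refine GlobSet.hom_ext fun k z => ?_
  match k with
  | 0 =>
    have hz : X.IsWord (X.bt 0 (A.one (Str.base z))) (Str.word z) := by
      refine Eq.mpr (congrArg (fun x => X.IsWord x (Str.word z)) (A.t_one _)) (Str.isWord z)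
    refine Eq.trans ?_ (h.Rs (Str.word z) 0 (A.one (Str.base z)) hz).symm
    exact congrArg ((B.Rs ((Str.word z).map (φ.app 1))).app 0) (h.one _).symm
  | k + 1 =>
    have hz := Whisk.isWord z
    simp only [GlobSet.isWord_append, GlobSet.isWord_cons, GlobSet.wordEnd_append,
      GlobSet.wordEnd_cons, GlobSet.wordEnd_nil] at hz
    obtain ⟨⟨hl, he, -⟩, hr⟩ := hz
    have h1 := h.Ls _ (Whisk.left z) (k + 1) (Whisk.cell z) hl he.symm
    have h2 := h.Rs (Whisk.right z) (k + 1) ((A.Ls (Whisk.left z)).app (k + 1) (Whisk.cell z))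
      (Eq.mpr (congrArg (fun x => X.IsWord x (Whisk.right z)) (A.bt_Ls _ (k + 1) _)) hr)
    exact (h2.trans (congrArg ((B.Rs ((Whisk.right z).map (φ.app 1))).app (k + 1)) h1)).symm

/-- Assembly is natural, so in positive dimension it suffices that `φ` preserves the values of
whiskered cells and the action `a`. -/
theorem act (h : A.IsHom B φ) : TMap φ ≫ B.act = A.act ≫ φ := by
  have h1 : GlobSet.shiftMap (TMap φ) ≫ B.actPos = A.actPos ≫ GlobSet.shiftMap φ := by
    rw [← cancel_epi (assembleIso X).hom]
    change assemble X ≫ _ = assemble X ≫ _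
    rw [← Category.assoc, assemble_natural, Category.assoc, B.assemble_actPos, ← Category.assoc,
      ← TMap_comp, h.value, ← Category.assoc (assemble X), A.assemble_actPos, TMap_comp,
      Category.assoc, h.a, Category.assoc]
  refine GlobSet.hom_ext fun k d => ?_
  match k with
  | 0 => rfl
  | k + 1 => exact congrArg (fun φ : (TObj X).shift ⟶ Y.shift => φ.app k d) h1

end WhiskAlg.IsHom

theorem map_graftCell (φ : X ⟶ Y) {k : ℕ} {x : X.cells 0} {l r : List (X.cells 1)}
    {z : X.cells (k + 1)} (h : X.IsWord x (l ++ [X.edge k z] ++ r)) (h') :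
    (TMap φ).app (k + 1) (graftCell x l z r h) =
      graftCell (φ.app 0 x) (l.map (φ.app 1)) (φ.app (k + 1) z) (r.map (φ.app 1)) h' := by
  refine Subtype.ext ((map_graft φ (unit z) (by rw [word_unit]; exact h) ?_).trans
    (graft_congr _ rfl rfl (map_unit φ z) rfl))
  rw [map_unit, word_unit]
  exact h'

theorem IsAction.isHom_of_comp {u : TObj X ⟶ X} {v : TObj Y ⟶ Y} (hu : IsAction u) (hv : IsAction v)
    {φ : X ⟶ Y} (h : TMap φ ≫ v = u ≫ φ) : hu.whiskAlg.IsHom hv.whiskAlg φ where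
  one x := by
    have h1 := congrArg (fun ψ => GlobSet.Hom.app ψ 1 (stringCell x [] trivial)) h
    refine h1.symm.trans (congrArg (v.app 1) ?_)
    exact Subtype.ext (map_string φ (x := x) (l := []) trivial)
  R f k z hz := by
    have hz' : Y.bt k (φ.app (k + 1) z) = Y.s 0 (φ.app 1 f) := by
      rw [← φ.app_bt, hz, φ.app_s]
    have h1 := congrArg (fun ψ => GlobSet.Hom.app ψ (k + 1)
      (graftCell (X.bs k z) [] z [f] (IsAction.isWord_R.2 hz))) h
    refine (congrArg (φ.app (k + 1)) (IsAction.right_pos hz)).trans (h1.symm.trans ?_)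
    refine Eq.trans (congrArg (v.app (k + 1)) ?_) (IsAction.right_pos hz').symm
    refine (map_graftCell φ _ ?_).trans (graftCell_congr _ (φ.app_bs k z) rfl rfl rfl _)
    rw [φ.app_bs]
    exact IsAction.isWord_R.2 hz'
  L f k z hz := by
    have hz' : Y.t 0 (φ.app 1 f) = Y.bs k (φ.app (k + 1) z) := by
      rw [← φ.app_bs, ← hz, φ.app_t]
    have h1 := congrArg (fun ψ => GlobSet.Hom.app ψ (k + 1)
      (graftCell (X.s 0 f) [f] z [] (IsAction.isWord_L.2 hz))) h
    refine (congrArg (φ.app (k + 1)) (IsAction.left_pos hz)).trans (h1.symm.trans ?_)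
    refine Eq.trans (congrArg (v.app (k + 1)) ?_) (IsAction.left_pos hz').symm
    refine (map_graftCell φ _ ?_).trans (graftCell_congr _ (φ.app_s 0 f) rfl rfl rfl _)
    rw [φ.app_s]
    exact IsAction.isWord_L.2 hz'
  a := by
    have h1 : GlobSet.shiftMap (TMap φ) ≫ GlobSet.shiftMap v =
        GlobSet.shiftMap u ≫ GlobSet.shiftMap φ := congrArg GlobSet.shiftMap h
    change TMap (GlobSet.shiftMap φ) ≫ suspHom Y ≫ GlobSet.shiftMap v =
      (suspHom X ≫ GlobSet.shiftMap u) ≫ GlobSet.shiftMap φ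
    rw [← Category.assoc, ← WhiskAlg.suspHom_natural, Category.assoc, h1, Category.assoc]

theorem IsAction.comp_of_isHom {u : TObj X ⟶ X} {v : TObj Y ⟶ Y} (hu : IsAction u)
    (hv : IsAction v) {φ : X ⟶ Y} (h : hu.whiskAlg.IsHom hv.whiskAlg φ) :
    TMap φ ≫ v = u ≫ φ := by
  have := h.act
  rwa [hu.act_whiskAlg, hv.act_whiskAlg] at this

end Sesqui

/-! ### Sorting cells by endpoints: algebras of cells between two objects. -/

namespace Sesqui

open LDiagram

variable {n : ℕ} {V : Type u} {H : V → V → Family.{u} n}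

/-- A category together with algebras of cells between objects, on which the morphisms act. -/
structure TypedAlg (H : V → V → Family.{u} n) where
  act : ∀ x y, TObj (H x y).total ⟶ (H x y).total
  isAction : ∀ x y, IsAction (act x y)
  id : ∀ x, (H x x).cells 0
  comp : ∀ {x y z}, (H x y).cells 0 → (H y z).cells 0 → (H x z).cells 0
  id_comp : ∀ {x y} (f : (H x y).cells 0), comp (id x) f = f
  comp_id : ∀ {x y} (f : (H x y).cells 0), comp f (id y) = f
  assoc : ∀ {x y z w} (f : (H x y).cells 0) (g : (H y z).cells 0) (h : (H z w).cells 0),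
    comp (comp f g) h = comp f (comp g h)
  map : ∀ {x x' y y'}, (H x' x).cells 0 → (H y y').cells 0 → ((H x y).total ⟶ (H x' y').total)
  map_zero : ∀ {x x' y y'} (f : (H x' x).cells 0) (g : (H y y').cells 0) (h : (H x y).cells 0),
    (map f g).app 0 h = comp f (comp h g)
  map_id : ∀ x y, map (id x) (id y) = 𝟙 (H x y).total
  map_comp : ∀ {x x' x'' y y' y''} (f : (H x' x).cells 0) (f' : (H x'' x').cells 0)
    (g : (H y y').cells 0) (g' : (H y' y'').cells 0),
    map (comp f' f) (comp g g') = map f g ≫ map f' g'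
  map_act : ∀ {x x' y y'} (f : (H x' x).cells 0) (g : (H y y').cells 0),
    TMap (map f g) ≫ act x' y' = act x y ≫ map f g

/-- The globular set presented by a type of objects and families of cells between them. -/
abbrev totalOf (H : V → V → Family.{u} n) : GlobSet.{u} (n + 1) :=
  Family.total (n := n + 1) ⟨V, H⟩

/-- A cell between two objects as a cell of positive dimension. -/
abbrev mkCell {k : ℕ} {x y : V} (w : (H x y).cells k) : (totalOf H).cells (k + 1) :=
  (⟨x, y, w⟩ : Σ x y : V, (H x y).cells k)

theorem bs_mkCell : ∀ {k : ℕ} {x y : V} (w : (H x y).cells k), (totalOf H).bs k (mkCell w) = x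
  | 0, _, _, _ => rfl
  | k + 1, x, y, w => bs_mkCell ((H x y).s k w)

theorem bt_mkCell : ∀ {k : ℕ} {x y : V} (w : (H x y).cells k), (totalOf H).bt k (mkCell w) = y
  | 0, _, _, _ => rfl
  | k + 1, x, y, w => bt_mkCell ((H x y).s k w)

theorem mkCell_injective {k : ℕ} {x y : V} {w w' : (H x y).cells k}
    (h : mkCell (H := H) w = mkCell w') : w = w' := by
  have h1 := Sigma.mk.inj h
  exact eq_of_heq (Sigma.mk.inj (eq_of_heq h1.2)).2

theorem exists_mkCell {k : ℕ} (z : (totalOf H).cells (k + 1)) {x y : V}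
    (hx : (totalOf H).bs k z = x) (hy : (totalOf H).bt k z = y) :
    ∃ w : (H x y).cells k, mkCell w = z := by
  obtain ⟨x', y', w⟩ := z
  obtain rfl : x' = x := (bs_mkCell w).symm.trans hx
  obtain rfl : y' = y := (bt_mkCell w).symm.trans hy
  exact ⟨w, rfl⟩

/-- The inclusion of the cells between two objects. -/
def inclCell (H : V → V → Family.{u} n) (x y : V) : (H x y).total ⟶ (totalOf H).shift where
  app _ w := mkCell w
  app_s _ _ := rfl
  app_t _ _ := rfl

theorem inclCell_injective {Y : GlobSet.{u} n} {x y : V} {φ ψ : Y ⟶ (H x y).total}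
    (h : φ ≫ inclCell H x y = ψ ≫ inclCell H x y) : φ = ψ :=
  GlobSet.hom_ext fun k z => mkCell_injective
    (congrArg (fun χ : Y ⟶ (totalOf H).shift => χ.app k z) h)

/-- The means of restricting operations to cells between fixed objects: it avoids transport along
equalities of endpoints, and the lift is unique by `inclCell_injective`. -/
theorem exists_lift {Y : GlobSet.{u} n} {x y : V} (φ : Y ⟶ (totalOf H).shift)
    (h : ∀ k z, (totalOf H).bs k (φ.app k z) = x ∧ (totalOf H).bt k (φ.app k z) = y) :
    ∃ ψ : Y ⟶ (H x y).total, ψ ≫ inclCell H x y = φ := by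
  choose f hf using fun k z => exists_mkCell (φ.app k z) (h k z).1 (h k z).2
  refine ⟨⟨f, fun k z => mkCell_injective ?_, fun k z => mkCell_injective ?_⟩,
    GlobSet.hom_ext hf⟩
  · exact (hf k _).trans ((φ.app_s k z).trans (congrArg ((totalOf H).s (k + 1)) (hf (k + 1) z).symm))
  · exact (hf k _).trans ((φ.app_t k z).trans (congrArg ((totalOf H).t (k + 1)) (hf (k + 1) z).symm))

theorem map_inclCell_injective {k : ℕ} {x y : V} {d e : LDiagram k (H x y).total}
    (h : d.map (inclCell H x y) = e.map (inclCell H x y)) : d = e := by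
  obtain ⟨D, l⟩ := d
  obtain ⟨E, l'⟩ := e
  obtain rfl : D = E := congrArg LDiagram.shape h
  have h1 := eq_of_heq (LDiagram.mk.inj h).2
  refine eq_of_shape fun m hm i => mkCell_injective (H := H) ?_
  exact congrArg (fun q : Labelling D (totalOf H).shift => q.x m hm i) h1

theorem exists_map_inclCell {k : ℕ} (d : LDiagram k (totalOf H).shift) {x y : V}
    (hx : (totalOf H).s 0 d.base = x) (hy : (totalOf H).t 0 d.base = y) :
    ∃ e : LDiagram k (H x y).total, e.map (inclCell H x y) = d := by
  obtain ⟨d', rfl⟩ := exists_map_incl ((totalOf H).endpoints fun p q => p = x ∧ q = y) d ⟨hx, hy⟩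
  obtain ⟨ψ, hψ⟩ := exists_lift ((totalOf H).endpoints fun p q => p = x ∧ q = y).incl
    fun k z => z.2
  exact ⟨d'.map ψ, congrArg d'.map hψ⟩

section OfWhisk

variable (A : WhiskAlg (totalOf H))

theorem exists_right (x : V) {y z : V} (g : (H y z).cells 0) :
    ∃ ψ : (H x y).total ⟶ (H x z).total,
      ψ ≫ inclCell H x z = inclCell H x y ≫ A.R (mkCell g) :=
  exists_lift _ fun k w =>
    ⟨(A.bs_R _ k (mkCell w)).trans (bs_mkCell w), A.bt_R _ k (mkCell w) (bt_mkCell w)⟩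

theorem exists_left (y : V) {x' x : V} (f : (H x' x).cells 0) :
    ∃ ψ : (H x y).total ⟶ (H x' y).total,
      ψ ≫ inclCell H x' y = inclCell H x y ≫ A.L (mkCell f) :=
  exists_lift _ fun k w =>
    ⟨A.bs_L _ k (mkCell w) (bs_mkCell w).symm, (A.bt_L _ k (mkCell w)).trans (bt_mkCell w)⟩

/-- The value of a diagram has the endpoints of its base by `edge_app_of_unit`. -/
theorem exists_act (x y : V) : ∃ ψ : TObj (H x y).total ⟶ (H x y).total,
    ψ ≫ inclCell H x y = TMap (inclCell H x y) ≫ A.a :=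
  exists_lift _ fun k d => by
    have h := edge_app_of_unit A.a_unit k ((TMap (inclCell H x y)).app k d)
    exact ⟨congrArg ((totalOf H).s 0) h, congrArg ((totalOf H).t 0) h⟩

theorem exists_one (x : V) : ∃ i : (H x x).cells 0, mkCell i = A.one x :=
  exists_mkCell (k := 0) (A.one x) (A.s_one x) (A.t_one x)

/-- Right whiskering of cells between given objects. -/
noncomputable def typedR (x : V) {y z : V} (g : (H y z).cells 0) :
    (H x y).total ⟶ (H x z).total := (exists_right A x g).choose

/-- Left whiskering of cells between given objects. -/
noncomputable def typedL (y : V) {x' x : V} (f : (H x' x).cells 0) :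
    (H x y).total ⟶ (H x' y).total := (exists_left A y f).choose

theorem typedR_incl (x : V) {y z : V} (g : (H y z).cells 0) :
    typedR A x g ≫ inclCell H x z = inclCell H x y ≫ A.R (mkCell g) := (exists_right A x g).choose_spec

theorem typedL_incl (y : V) {x' x : V} (f : (H x' x).cells 0) :
    typedL A y f ≫ inclCell H x' y = inclCell H x y ≫ A.L (mkCell f) :=
  (exists_left A y f).choose_spec

theorem mkCell_typedR {k : ℕ} {x y z : V} (g : (H y z).cells 0) (w : (H x y).cells k) :
    mkCell ((typedR A x g).app k w) = (A.R (mkCell g)).app k (mkCell w) :=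
  congrArg (fun φ : (H x y).total ⟶ (totalOf H).shift => φ.app k w) (typedR_incl A x g)

theorem mkCell_typedL {k : ℕ} {x x' y : V} (f : (H x' x).cells 0) (w : (H x y).cells k) :
    mkCell ((typedL A y f).app k w) = (A.L (mkCell f)).app k (mkCell w) :=
  congrArg (fun φ : (H x y).total ⟶ (totalOf H).shift => φ.app k w) (typedL_incl A y f)

/-- The action on cells between given objects. -/
noncomputable def typedAct (x y : V) : TObj (H x y).total ⟶ (H x y).total :=
  (exists_act A x y).choose

theorem typedAct_incl (x y : V) :
    typedAct A x y ≫ inclCell H x y = TMap (inclCell H x y) ≫ A.a := (exists_act A x y).choose_spec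

/-- The identities of a category structure. -/
noncomputable def typedOne (x : V) : (H x x).cells 0 := (exists_one A x).choose

theorem mkCell_typedOne (x : V) : mkCell (typedOne A x) = A.one x := (exists_one A x).choose_spec

theorem typedAct_isAction (x y : V) : IsAction (typedAct A x y) where
  unit_comp := by
    refine inclCell_injective ?_
    have h1 : TUnit (H x y).total ≫ TMap (inclCell H x y) =
        inclCell H x y ≫ TUnit (totalOf H).shift := ((T n).η.naturality (inclCell H x y)).symm
    rw [Category.assoc, typedAct_incl, ← Category.assoc, h1, Category.assoc, A.a_unit]
    rfl
  mult_comp := by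
    refine inclCell_injective ?_
    have h1 : TMult (H x y).total ≫ TMap (inclCell H x y) =
        TMap (TMap (inclCell H x y)) ≫ TMult (totalOf H).shift :=
      ((T n).μ.naturality (inclCell H x y)).symm
    rw [Category.assoc, typedAct_incl, ← Category.assoc, h1, Category.assoc, A.a_assoc,
      Category.assoc, typedAct_incl, ← Category.assoc, ← Category.assoc, ← WhiskAlg.TMap_comp,
      ← WhiskAlg.TMap_comp, ← typedAct_incl]

theorem typedR_one (x y : V) : typedR A x (typedOne A y) = 𝟙 (H x y).total := by
  refine inclCell_injective (GlobSet.hom_ext fun k w => ?_)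
  refine (mkCell_typedR A _ w).trans ?_
  rw [mkCell_typedOne]
  exact A.R_one y k _ (bt_mkCell w)

theorem typedL_one (x y : V) : typedL A y (typedOne A x) = 𝟙 (H x y).total := by
  refine inclCell_injective (GlobSet.hom_ext fun k w => ?_)
  refine (mkCell_typedL A _ w).trans ?_
  rw [mkCell_typedOne]
  exact A.L_one x k _ (bs_mkCell w).symm

/-- Composition of `1`-cells. -/
noncomputable def typedComp {x y z : V} (f : (H x y).cells 0) (g : (H y z).cells 0) :
    (H x z).cells 0 := (typedR A x g).app 0 f

theorem mkCell_typedComp {x y z : V} (f : (H x y).cells 0) (g : (H y z).cells 0) :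
    mkCell (typedComp A f g) = (A.R (mkCell g)).app 0 (mkCell f) := mkCell_typedR A g f

theorem typedComp_eq {x y z : V} (f : (H x y).cells 0) (g : (H y z).cells 0) :
    typedComp A f g = (typedL A z f).app 0 g :=
  mkCell_injective ((mkCell_typedR A g f).trans ((A.R_eq_L _ _ rfl).trans (mkCell_typedL A f g).symm))

theorem typedR_comp (x : V) {y z w : V} (f : (H y z).cells 0) (g : (H z w).cells 0) :
    typedR A x (typedComp A f g) = typedR A x f ≫ typedR A x g := by
  refine inclCell_injective (GlobSet.hom_ext fun k c => ?_)
  refine (mkCell_typedR A _ c).trans ?_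
  rw [mkCell_typedComp]
  refine (A.R_R (mkCell g) (mkCell f) k (mkCell c) rfl (bt_mkCell c)).trans ?_
  exact ((mkCell_typedR A g _).trans
    (congrArg ((A.R (mkCell g)).app k) (mkCell_typedR A f c))).symm

theorem typedL_comp (w : V) {x y z : V} (f : (H x y).cells 0) (g : (H y z).cells 0) :
    typedL A w (typedComp A f g) = typedL A w g ≫ typedL A w f := by
  refine inclCell_injective (GlobSet.hom_ext fun k c => ?_)
  refine (mkCell_typedL A _ c).trans ?_
  rw [mkCell_typedComp]
  refine (A.L_R (mkCell g) (mkCell f) k (mkCell c) rfl (bs_mkCell c).symm).trans ?_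
  exact ((mkCell_typedL A f _).trans
    (congrArg ((A.L (mkCell f)).app k) (mkCell_typedL A g c))).symm

theorem typedL_comm {x x' y y' : V} (f : (H x' x).cells 0) (g : (H y y').cells 0) :
    typedR A x g ≫ typedL A y' f = typedL A y f ≫ typedR A x' g := by
  refine inclCell_injective (GlobSet.hom_ext fun k c => ?_)
  refine ((mkCell_typedL A f _).trans
    (congrArg ((A.L (mkCell f)).app k) (mkCell_typedR A g c))).trans ?_
  refine (A.L_comm (mkCell f) (mkCell g) k (mkCell c) (bs_mkCell c).symm (bt_mkCell c)).trans ?_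
  exact ((mkCell_typedR A g _).trans
    (congrArg ((A.R (mkCell g)).app k) (mkCell_typedL A f c))).symm

theorem typedR_act {x y z : V} (g : (H y z).cells 0) :
    TMap (typedR A x g) ≫ typedAct A x z = typedAct A x y ≫ typedR A x g := by
  refine inclCell_injective ?_
  rw [Category.assoc, typedAct_incl, ← Category.assoc, ← WhiskAlg.TMap_comp, typedR_incl,
    WhiskAlg.TMap_comp, Category.assoc, A.map_R, Category.assoc, typedR_incl, ← Category.assoc,
    ← Category.assoc, typedAct_incl]

theorem typedL_act {x y z : V} (f : (H x y).cells 0) :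
    TMap (typedL A z f) ≫ typedAct A x z = typedAct A y z ≫ typedL A z f := by
  refine inclCell_injective ?_
  rw [Category.assoc, typedAct_incl, ← Category.assoc, ← WhiskAlg.TMap_comp, typedL_incl,
    WhiskAlg.TMap_comp, Category.assoc, A.map_L, Category.assoc, typedL_incl, ← Category.assoc,
    ← Category.assoc, typedAct_incl]

/-- The structure on cells between given objects determined by whiskering operations. -/
noncomputable def WhiskAlg.typed : TypedAlg H where
  act := typedAct A
  isAction := typedAct_isAction A
  id := typedOne A
  comp := typedComp A
  id_comp f := by
    rw [typedComp_eq, typedL_one]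
    rfl
  comp_id f := by
    rw [typedComp, typedR_one]
    rfl
  assoc f g h := by
    rw [typedComp, typedComp, typedComp, typedR_comp]
    rfl
  map {x x' y y'} f g := typedL A y f ≫ typedR A x' g
  map_zero f g h := by
    rw [← typedL_comm, typedComp_eq A f]
    rfl
  map_id x y := by
    rw [typedL_one, typedR_one]
    rfl
  map_comp f f' g g' := by
    rw [typedL_comp, typedR_comp, Category.assoc, Category.assoc, ← Category.assoc (typedR A _ g),
      typedL_comm, Category.assoc]
  map_act f g := by
    rw [WhiskAlg.TMap_comp, Category.assoc, typedR_act, ← Category.assoc, typedL_act,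
      Category.assoc]

end OfWhisk

/-- One-sided whiskerings are recovered by inserting identities in the two-sided action, the rest
being fixed by the convention on non-composable cells. The action is recovered because each diagram
lies between two objects. -/
theorem WhiskAlg.typed_injective {A B : WhiskAlg (totalOf H)} (h : A.typed = B.typed) : A = B := by
  have hid : typedOne A = typedOne B := congrArg TypedAlg.id h
  have hact : typedAct A = typedAct B := congrArg TypedAlg.act h
  have hmap : ∀ {x x' y y' : V} (f : (H x' x).cells 0) (g : (H y y').cells 0),
      typedL A y f ≫ typedR A x' g = typedL B y f ≫ typedR B x' g := fun {x x' y y'} f g =>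
    congrArg (fun t : TypedAlg H => t.map f g) h
  have hR : ∀ (x : V) {y z : V} (g : (H y z).cells 0), typedR A x g = typedR B x g :=
    fun x y z g => by
      have h1 := hmap (typedOne A x) g
      rw [typedL_one, hid, typedL_one] at h1
      exact h1
  have hL : ∀ (y : V) {x' x : V} (f : (H x' x).cells 0), typedL A y f = typedL B y f :=
    fun y x' x f => by
      have h1 := hmap f (typedOne A y)
      rw [typedR_one, hid, typedR_one] at h1
      exact h1
  refine ext_of_ops (fun x => ?_) (fun f => GlobSet.hom_ext fun k z => ?_)
    (fun f => GlobSet.hom_ext fun k z => ?_) (GlobSet.hom_ext fun k d => ?_)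
  · exact (mkCell_typedOne A x).symm.trans ((congrArg (fun i : ∀ x, (H x x).cells 0 =>
      mkCell (H := H) (i x)) hid).trans (mkCell_typedOne B x))
  · obtain ⟨y', z', g⟩ := f
    obtain ⟨x, y, w⟩ := z
    by_cases hy : y = y'
    · subst hy
      exact (mkCell_typedR A g w).symm.trans ((congrArg (fun φ : (H x y).total ⟶ (H x z').total =>
        mkCell (H := H) (φ.app k w)) (hR x g)).trans (mkCell_typedR B g w))
    · exact (A.R_of_ne _ k _ fun e => hy ((bt_mkCell w).symm.trans e)).trans
        (B.R_of_ne _ k _ fun e => hy ((bt_mkCell w).symm.trans e)).symm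
  · obtain ⟨x', x, f⟩ := f
    obtain ⟨x'', y, w⟩ := z
    by_cases hx : x = x''
    · subst hx
      exact (mkCell_typedL A f w).symm.trans ((congrArg (fun φ : (H x y).total ⟶ (H x' y).total =>
        mkCell (H := H) (φ.app k w)) (hL y f)).trans (mkCell_typedL B f w))
    · exact (A.L_of_ne (mkCell f) k (mkCell w) fun e => hx (e.trans (bs_mkCell w))).trans
        (B.L_of_ne (mkCell f) k (mkCell w) fun e => hx (e.trans (bs_mkCell w))).symm
  · obtain ⟨x, y, e, rfl⟩ : ∃ x y, ∃ e : (TObj (H x y).total).cells k,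
        (TMap (inclCell H x y)).app k e = d := by
      obtain ⟨e, he⟩ := exists_map_inclCell d.1 rfl rfl
      exact ⟨_, _, ⟨e, d.2⟩, Subtype.ext he⟩
    exact congrArg (fun φ : TObj (H x y).total ⟶ (totalOf H).shift => φ.app k e)
      ((typedAct_incl A x y).symm.trans ((congrArg (fun φ => φ ≫ inclCell H x y)
        (congrFun (congrFun hact x) y)).trans (typedAct_incl B x y)))

end Sesqui

/-! ### Gluing the operations between given objects. -/

namespace Sesqui

open LDiagram

variable {n : ℕ} {V : Type u} {H : V → V → Family.{u} n}

namespace TypedAlg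

@[ext]
theorem ext_of_ops {t t' : TypedAlg H} (h1 : ∀ x y, t.act x y = t'.act x y)
    (h2 : ∀ x, t.id x = t'.id x)
    (h3 : ∀ {x y z} (f : (H x y).cells 0) (g : (H y z).cells 0), t.comp f g = t'.comp f g)
    (h4 : ∀ {x x' y y'} (f : (H x' x).cells 0) (g : (H y y').cells 0), t.map f g = t'.map f g) :
    t = t' := by
  obtain ⟨_, _, _, _, _, _, _, _, _, _, _, _⟩ := t
  obtain ⟨_, _, _, _, _, _, _, _, _, _, _, _⟩ := t'
  obtain rfl := funext fun x => funext (h1 x)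
  obtain rfl := funext h2
  congr 1
  · exact funext fun x => funext fun y => funext fun z => funext fun f => funext (h3 f)
  · exact funext fun x => funext fun x' => funext fun y => funext fun y' =>
      funext fun f => funext (h4 f)

variable (t : TypedAlg H)

theorem map_eq {x x' y y' : V} (f : (H x' x).cells 0) (g : (H y y').cells 0) :
    t.map f g = t.map f (t.id y) ≫ t.map (t.id x') g := by
  rw [← t.map_comp, t.id_comp, t.id_comp]

theorem map_id_right {x y z : V} (f : (H x y).cells 0) (g : (H y z).cells 0) :
    (t.map (t.id x) g).app 0 f = t.comp f g :=
  (t.map_zero _ _ _).trans (t.id_comp _)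

theorem map_id_left {x y z : V} (f : (H x y).cells 0) (g : (H y z).cells 0) :
    (t.map f (t.id z)).app 0 g = t.comp f g :=
  (t.map_zero _ _ _).trans (congrArg (t.comp f) (t.comp_id g))

open Classical in
/-- Right whiskering by a `1`-cell. -/
noncomputable def right (g : (totalOf H).cells 1) (k : ℕ) (z : (totalOf H).cells (k + 1)) :
    (totalOf H).cells (k + 1) :=
  -- Composability is an equality of objects, hence the transport. It disappears in `right_mkCell`,
  -- where the equality holds by reflexivity.
  if h : z.2.1 = g.1 then
    mkCell ((t.map (t.id z.1) (h.symm ▸ g.2.2 : (H z.2.1 g.2.1).cells 0)).app k z.2.2)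
  else z

open Classical in
/-- Left whiskering by a `1`-cell. -/
noncomputable def left (f : (totalOf H).cells 1) (k : ℕ) (z : (totalOf H).cells (k + 1)) :
    (totalOf H).cells (k + 1) :=
  if h : f.2.1 = z.1 then
    mkCell ((t.map (h ▸ f.2.2 : (H f.1 z.1).cells 0) (t.id z.2.1)).app k z.2.2)
  else z

theorem right_mkCell {k : ℕ} {x y z : V} (g : (H y z).cells 0) (w : (H x y).cells k) :
    t.right (mkCell g) k (mkCell w) = mkCell ((t.map (t.id x) g).app k w) := dif_pos rfl

theorem left_mkCell {k : ℕ} {x y z : V} (f : (H x y).cells 0) (w : (H y z).cells k) :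
    t.left (mkCell f) k (mkCell w) = mkCell ((t.map f (t.id z)).app k w) := dif_pos rfl

theorem right_of_ne {k : ℕ} {x y y' z : V} (g : (H y' z).cells 0) (w : (H x y).cells k)
    (h : y ≠ y') : t.right (mkCell g) k (mkCell w) = mkCell w := dif_neg h

theorem left_of_ne {k : ℕ} {x y y' z : V} (f : (H x y).cells 0) (w : (H y' z).cells k)
    (h : y ≠ y') : t.left (mkCell f) k (mkCell w) = mkCell w := dif_neg h

/-- Right whiskering as a map of globular sets. -/
noncomputable def rightHom (g : (totalOf H).cells 1) : (totalOf H).shift ⟶ (totalOf H).shift where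
  app k z := t.right g k z
  app_s k z := by
    obtain ⟨y', z', g⟩ := g
    obtain ⟨x, y, w⟩ := z
    by_cases h : y = y'
    · subst h
      refine (t.right_mkCell g ((H x y).s k w)).trans ?_
      refine Eq.trans ?_ (congrArg ((totalOf H).s (k + 1)) (t.right_mkCell g w)).symm
      exact congrArg mkCell ((t.map (t.id x) g).app_s k w)
    · refine (t.right_of_ne g ((H x y).s k w) h).trans ?_
      exact (congrArg ((totalOf H).s (k + 1)) (t.right_of_ne g w h)).symm
  app_t k z := by
    obtain ⟨y', z', g⟩ := g
    obtain ⟨x, y, w⟩ := z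
    by_cases h : y = y'
    · subst h
      refine (t.right_mkCell g ((H x y).t k w)).trans ?_
      refine Eq.trans ?_ (congrArg ((totalOf H).t (k + 1)) (t.right_mkCell g w)).symm
      exact congrArg mkCell ((t.map (t.id x) g).app_t k w)
    · refine (t.right_of_ne g ((H x y).t k w) h).trans ?_
      exact (congrArg ((totalOf H).t (k + 1)) (t.right_of_ne g w h)).symm

/-- Left whiskering as a map of globular sets. -/
noncomputable def leftHom (f : (totalOf H).cells 1) : (totalOf H).shift ⟶ (totalOf H).shift where
  app k z := t.left f k z
  app_s k z := by
    obtain ⟨x', x, f⟩ := f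
    obtain ⟨x'', y, w⟩ := z
    by_cases h : x = x''
    · subst h
      refine (t.left_mkCell f ((H x y).s k w)).trans ?_
      refine Eq.trans ?_ (congrArg ((totalOf H).s (k + 1)) (t.left_mkCell f w)).symm
      exact congrArg mkCell ((t.map f (t.id y)).app_s k w)
    · refine (t.left_of_ne f ((H x'' y).s k w) h).trans ?_
      exact (congrArg ((totalOf H).s (k + 1)) (t.left_of_ne f w h)).symm
  app_t k z := by
    obtain ⟨x', x, f⟩ := f
    obtain ⟨x'', y, w⟩ := z
    by_cases h : x = x''
    · subst h
      refine (t.left_mkCell f ((H x y).t k w)).trans ?_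
      refine Eq.trans ?_ (congrArg ((totalOf H).t (k + 1)) (t.left_mkCell f w)).symm
      exact congrArg mkCell ((t.map f (t.id y)).app_t k w)
    · refine (t.left_of_ne f ((H x'' y).t k w) h).trans ?_
      exact (congrArg ((totalOf H).t (k + 1)) (t.left_of_ne f w h)).symm

end TypedAlg

theorem exists_TMap_inclCell {k : ℕ} (d : (TObj (totalOf H).shift).cells k) :
    ∃ x y, ∃ e : (TObj (H x y).total).cells k, (TMap (inclCell H x y)).app k e = d := by
  obtain ⟨e, he⟩ := exists_map_inclCell d.1 rfl rfl
  exact ⟨_, _, ⟨e, d.2⟩, Subtype.ext he⟩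

theorem TMap_inclCell_injective {k : ℕ} {x y : V} {d e : (TObj (H x y).total).cells k}
    (h : (TMap (inclCell H x y)).app k d = (TMap (inclCell H x y)).app k e) : d = e :=
  Subtype.ext (map_inclCell_injective (congrArg Subtype.val h))

namespace TypedAlg

variable (t : TypedAlg H)

/-- The base of `d` determines the two objects, so the value does not depend on the chosen preimage.
Quantifying over all preimages gives a specification of the chosen value that is free of transports.
-/
theorem exists_actCell {k : ℕ} (d : (TObj (totalOf H).shift).cells k) :
    ∃ z : (totalOf H).cells (k + 1), ∀ x y (e : (TObj (H x y).total).cells k),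
      (TMap (inclCell H x y)).app k e = d → z = mkCell ((t.act x y).app k e) := by
  obtain ⟨x, y, e, rfl⟩ := exists_TMap_inclCell d
  refine ⟨mkCell ((t.act x y).app k e), fun x' y' e' h => ?_⟩
  have hb : mkCell (H := H) (LDiagram.base e'.1) = mkCell (LDiagram.base e.1) :=
    congrArg (fun d => LDiagram.base (X := (totalOf H).shift) (Subtype.val d)) h
  obtain rfl : x' = x := congrArg Sigma.fst hb
  obtain rfl : y' = y := congrArg (fun z : Σ x y : V, (H x y).cells 0 => z.2.1) hb
  rw [TMap_inclCell_injective h]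

/-- The action on cells of all the globular sets of cells between objects. -/
noncomputable def actHom : TObj (totalOf H).shift ⟶ (totalOf H).shift where
  app k d := (t.exists_actCell d).choose
  app_s k d := by
    obtain ⟨x, y, e, rfl⟩ := exists_TMap_inclCell d
    refine ((t.exists_actCell _).choose_spec x y ((TObj (H x y).total).s k e) rfl).trans ?_
    refine Eq.trans ?_ (congrArg ((totalOf H).s (k + 1))
      ((t.exists_actCell _).choose_spec x y e rfl)).symm
    exact congrArg mkCell ((t.act x y).app_s k e)
  app_t k d := by
    obtain ⟨x, y, e, rfl⟩ := exists_TMap_inclCell d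
    refine ((t.exists_actCell _).choose_spec x y ((TObj (H x y).total).t k e)
      ((TMap (inclCell H x y)).app_t k e)).trans ?_
    refine Eq.trans ?_ (congrArg ((totalOf H).t (k + 1))
      ((t.exists_actCell _).choose_spec x y e rfl)).symm
    exact congrArg mkCell ((t.act x y).app_t k e)

theorem incl_actHom (x y : V) :
    TMap (inclCell H x y) ≫ t.actHom = t.act x y ≫ inclCell H x y :=
  GlobSet.hom_ext fun _ e => (t.exists_actCell _).choose_spec x y e rfl

theorem incl_rightHom (x : V) {y z : V} (g : (H y z).cells 0) :
    inclCell H x y ≫ t.rightHom (mkCell g) = t.map (t.id x) g ≫ inclCell H x z :=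
  GlobSet.hom_ext fun _ w => t.right_mkCell g w

theorem incl_leftHom (z : V) {x y : V} (f : (H x y).cells 0) :
    inclCell H y z ≫ t.leftHom (mkCell f) = t.map f (t.id z) ≫ inclCell H x z :=
  GlobSet.hom_ext fun _ w => t.left_mkCell f w

end TypedAlg

end Sesqui

/-! ### The laws of the glued whiskering algebra. -/

namespace Sesqui

open LDiagram

variable {n : ℕ} {V : Type u} {H : V → V → Family.{u} n}

namespace TypedAlg

variable (t : TypedAlg H)

/-- A diagram of diagrams also lies between two objects. Evaluating the labels reveals the objects;
having a value with these endpoints is an invariant property pulled back along `actHom`, so all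
labels share it. -/
theorem exists_TMap_TMap_inclCell (t : TypedAlg H) {k : ℕ} (d : (TObj (TObj (totalOf H).shift)).cells k) :
    ∃ x y, ∃ e : (TObj (TObj (H x y).total)).cells k,
      (TMap (TMap (inclCell H x y))).app k e = d := by
  obtain ⟨x, y, e, he⟩ := exists_TMap_inclCell ((TMap t.actHom).app k d)
  have hb : t.actHom.app 0 d.1.base = mkCell (LDiagram.base e.1) :=
    (congrArg (fun d => LDiagram.base (X := (totalOf H).shift) (Subtype.val d)) he).symm
  let P : (TObj (totalOf H).shift).Invariant :=
    ((totalOf H).endpoints fun p q => p = x ∧ q = y).comap t.actHom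
  have hP : P.prop 0 d.1.base := by
    change (totalOf H).bs 0 (t.actHom.app 0 d.1.base) = x ∧
      (totalOf H).bt 0 (t.actHom.app 0 d.1.base) = y
    rw [hb]
    exact ⟨rfl, rfl⟩
  have hl : ∀ m (c : P.sub.cells m), ∃ c' : (TObj (H x y).total).cells m,
      (TMap (inclCell H x y)).app m c' = c.1 := by
    rintro m ⟨c, hc⟩
    obtain ⟨x', y', c', rfl⟩ := exists_TMap_inclCell c
    have h1 : t.actHom.app m ((TMap (inclCell H x' y')).app m c') =
        mkCell ((t.act x' y').app m c') :=
      congrArg (fun φ : TObj (H x' y').total ⟶ (totalOf H).shift => φ.app m c')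
        (t.incl_actHom x' y')
    have hc' : (totalOf H).bs m (t.actHom.app m ((TMap (inclCell H x' y')).app m c')) = x ∧
      (totalOf H).bt m (t.actHom.app m ((TMap (inclCell H x' y')).app m c')) = y := hc
    rw [h1] at hc'
    obtain rfl : x' = x := (bs_mkCell _).symm.trans hc'.1
    obtain rfl : y' = y := (bt_mkCell _).symm.trans hc'.2
    exact ⟨c', rfl⟩
  choose f hf using hl
  let ψ : P.sub ⟶ TObj (H x y).total :=
    { app := f
      app_s m c := TMap_inclCell_injective ((hf m _).trans
        (congrArg ((TObj (totalOf H).shift).s m) (hf (m + 1) c).symm))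
      app_t m c := TMap_inclCell_injective ((hf m _).trans
        ((congrArg ((TObj (totalOf H).shift).t m) (hf (m + 1) c).symm).trans
          ((TMap (inclCell H x y)).app_t m (f (m + 1) c)).symm)) }
  obtain ⟨d', hd'⟩ := exists_map_incl P d.1 hP
  refine ⟨x, y, ⟨d'.map ψ, d.2⟩, Subtype.ext (Eq.trans ?_ hd')⟩
  exact congrArg d'.map (show ψ ≫ TMap (inclCell H x y) = P.incl from GlobSet.hom_ext hf)

theorem unit_actHom : TUnit (totalOf H).shift ≫ t.actHom = 𝟙 (totalOf H).shift := by
  refine GlobSet.hom_ext fun k z => ?_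
  obtain ⟨x, y, w⟩ := z
  have h1 : TUnit (H x y).total ≫ TMap (inclCell H x y) =
      inclCell H x y ≫ TUnit (totalOf H).shift := ((T n).η.naturality (inclCell H x y)).symm
  have h2 : inclCell H x y ≫ TUnit (totalOf H).shift ≫ t.actHom = inclCell H x y := by
    rw [← Category.assoc, ← h1, Category.assoc, t.incl_actHom, ← Category.assoc,
      (t.isAction x y).unit_comp, Category.id_comp]
  exact congrArg (fun φ : (H x y).total ⟶ (totalOf H).shift => φ.app k w) h2

theorem mult_actHom : TMult (totalOf H).shift ≫ t.actHom = TMap t.actHom ≫ t.actHom := by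
  refine GlobSet.hom_ext fun k z => ?_
  obtain ⟨x, y, e, rfl⟩ := t.exists_TMap_TMap_inclCell z
  have h1 : TMult (H x y).total ≫ TMap (inclCell H x y) =
      TMap (TMap (inclCell H x y)) ≫ TMult (totalOf H).shift :=
    ((T n).μ.naturality (inclCell H x y)).symm
  have h2 : TMap (TMap (inclCell H x y)) ≫ TMult (totalOf H).shift ≫ t.actHom =
      TMap (TMap (inclCell H x y)) ≫ TMap t.actHom ≫ t.actHom := by
    rw [← Category.assoc, ← h1, Category.assoc, t.incl_actHom, ← Category.assoc,
      (t.isAction x y).mult_comp, ← Category.assoc, ← WhiskAlg.TMap_comp, t.incl_actHom,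
      WhiskAlg.TMap_comp, Category.assoc, Category.assoc, t.incl_actHom]
  exact congrArg (fun φ : TObj (TObj (H x y).total) ⟶ (totalOf H).shift => φ.app k e) h2

theorem right_act {x y z : V} (g : (H y z).cells 0) {k : ℕ} (e : (TObj (H x y).total).cells k) :
    t.actHom.app k ((TMap (t.rightHom (mkCell g))).app k ((TMap (inclCell H x y)).app k e)) =
      (t.rightHom (mkCell g)).app k (t.actHom.app k ((TMap (inclCell H x y)).app k e)) := by
  have h : TMap (inclCell H x y) ≫ TMap (t.rightHom (mkCell g)) ≫ t.actHom =
      TMap (inclCell H x y) ≫ t.actHom ≫ t.rightHom (mkCell g) := by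
    rw [← Category.assoc, ← WhiskAlg.TMap_comp, t.incl_rightHom, WhiskAlg.TMap_comp,
      Category.assoc, t.incl_actHom, ← Category.assoc, t.map_act, ← Category.assoc, t.incl_actHom,
      Category.assoc, Category.assoc, t.incl_rightHom]
  exact congrArg (fun φ : TObj (H x y).total ⟶ (totalOf H).shift => φ.app k e) h

theorem left_act {x y z : V} (f : (H x y).cells 0) {k : ℕ} (e : (TObj (H y z).total).cells k) :
    t.actHom.app k ((TMap (t.leftHom (mkCell f))).app k ((TMap (inclCell H y z)).app k e)) =
      (t.leftHom (mkCell f)).app k (t.actHom.app k ((TMap (inclCell H y z)).app k e)) := by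
  have h : TMap (inclCell H y z) ≫ TMap (t.leftHom (mkCell f)) ≫ t.actHom =
      TMap (inclCell H y z) ≫ t.actHom ≫ t.leftHom (mkCell f) := by
    rw [← Category.assoc, ← WhiskAlg.TMap_comp, t.incl_leftHom, WhiskAlg.TMap_comp,
      Category.assoc, t.incl_actHom, ← Category.assoc, t.map_act, ← Category.assoc, t.incl_actHom,
      Category.assoc, Category.assoc, t.incl_leftHom]
  exact congrArg (fun φ : TObj (H y z).total ⟶ (totalOf H).shift => φ.app k e) h

theorem app_map_comp {x x' x'' y y' y'' : V} (f : (H x' x).cells 0) (f' : (H x'' x').cells 0)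
    (g : (H y y').cells 0) (g' : (H y' y'').cells 0) {k : ℕ} (w : (H x y).cells k) :
    (t.map f' g').app k ((t.map f g).app k w) = (t.map (t.comp f' f) (t.comp g g')).app k w :=
  (congrArg (fun φ : (H x y).total ⟶ (H x'' y'').total => φ.app k w) (t.map_comp f f' g g')).symm

theorem app_map_id {x y : V} {k : ℕ} (w : (H x y).cells k) :
    (t.map (t.id x) (t.id y)).app k w = w :=
  congrArg (fun φ : (H x y).total ⟶ (H x y).total => φ.app k w) (t.map_id x y)

/-- The whiskering operations determined by a category structure and its action. -/
noncomputable def toWhisk : WhiskAlg (totalOf H) where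
  one x := mkCell (t.id x)
  R := t.rightHom
  L := t.leftHom
  a := t.actHom
  s_one _ := rfl
  t_one _ := rfl
  s_R := by
    rintro ⟨y', z, g⟩ ⟨x, y, w⟩ h
    obtain rfl : y = y' := h
    exact (congrArg ((totalOf H).s 0) (t.right_mkCell g w)).trans rfl
  t_R := by
    rintro ⟨y', z, g⟩ ⟨x, y, w⟩ h
    obtain rfl : y = y' := h
    exact (congrArg ((totalOf H).t 0) (t.right_mkCell g w)).trans rfl
  s_L := by
    rintro ⟨x', x, f⟩ ⟨x'', y, w⟩ h
    obtain rfl : x = x'' := h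
    exact (congrArg ((totalOf H).s 0) (t.left_mkCell f w)).trans rfl
  t_L := by
    rintro ⟨x', x, f⟩ ⟨x'', y, w⟩ h
    obtain rfl : x = x'' := h
    exact (congrArg ((totalOf H).t 0) (t.left_mkCell f w)).trans rfl
  R_of_ne := by
    rintro ⟨y', z, g⟩ k ⟨x, y, w⟩ h
    exact t.right_of_ne g w fun e => h ((bt_mkCell w).trans e)
  L_of_ne := by
    rintro ⟨x', x, f⟩ k ⟨x'', y, w⟩ h
    exact t.left_of_ne f w fun e => h (e.trans (bs_mkCell w).symm)
  R_one := by
    rintro x' k ⟨x, y, w⟩ h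
    obtain rfl : y = x' := (bt_mkCell w).symm.trans h
    exact (t.right_mkCell _ w).trans (congrArg mkCell (t.app_map_id w))
  L_one := by
    rintro x' k ⟨x, y, w⟩ h
    obtain rfl : x' = x := h.trans (bs_mkCell w)
    exact (t.left_mkCell _ w).trans (congrArg mkCell (t.app_map_id w))
  R_R := by
    rintro ⟨c', d, f⟩ ⟨b', c, h⟩ k ⟨a, b, w⟩ e e'
    obtain rfl : c = c' := e
    obtain rfl : b = b' := (bt_mkCell w).symm.trans e'
    have h1 : (t.rightHom (mkCell f)).app 0 (mkCell h) = mkCell (t.comp h f) :=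
      (t.right_mkCell f h).trans (congrArg mkCell (t.map_id_right h f))
    have h2 := (t.app_map_comp (t.id a) (t.id a) h f w).trans
      (congrArg (fun i => (t.map i (t.comp h f)).app k w) (t.id_comp (t.id a)))
    refine (congrArg (fun i => t.right i k (mkCell w)) h1).trans ?_
    refine (t.right_mkCell _ w).trans ((congrArg mkCell h2.symm).trans ?_)
    exact (t.right_mkCell f _).symm.trans (congrArg (t.right (mkCell f) k) (t.right_mkCell h w).symm)
  L_R := by
    rintro ⟨b', c, f⟩ ⟨a, b, h⟩ k ⟨c', d, w⟩ e e'
    obtain rfl : b = b' := e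
    obtain rfl : c = c' := e'.trans (bs_mkCell w)
    have h1 : (t.rightHom (mkCell f)).app 0 (mkCell h) = mkCell (t.comp h f) :=
      (t.right_mkCell f h).trans (congrArg mkCell (t.map_id_right h f))
    have h2 := (t.app_map_comp f h (t.id d) (t.id d) w).trans
      (congrArg (fun i => (t.map (t.comp h f) i).app k w) (t.id_comp (t.id d)))
    refine (congrArg (fun i => t.left i k (mkCell w)) h1).trans ?_
    refine (t.left_mkCell _ w).trans ((congrArg mkCell h2.symm).trans ?_)
    exact (t.left_mkCell h _).symm.trans (congrArg (t.left (mkCell h) k) (t.left_mkCell f w).symm)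
  L_comm := by
    rintro ⟨a, b, f⟩ ⟨c', d, g⟩ k ⟨b', c, w⟩ e e'
    obtain rfl : b = b' := e.trans (bs_mkCell w)
    obtain rfl : c = c' := (bt_mkCell w).symm.trans e'
    have h1 := t.app_map_comp (t.id b) f g (t.id d) w
    rw [t.comp_id, t.comp_id] at h1
    have h2 := t.app_map_comp f (t.id a) (t.id c) g w
    rw [t.id_comp, t.id_comp] at h2
    refine (congrArg (t.left (mkCell f) k) (t.right_mkCell g w)).trans
      ((t.left_mkCell f _).trans ((congrArg mkCell (h1.trans h2.symm)).trans ?_))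
    exact (t.right_mkCell g _).symm.trans
      (congrArg (t.right (mkCell g) k) (t.left_mkCell f w).symm)
  R_eq_L := by
    rintro ⟨b', c, f⟩ ⟨a, b, h⟩ e
    obtain rfl : b = b' := e
    refine (t.right_mkCell f h).trans ((congrArg mkCell ?_).trans (t.left_mkCell h f).symm)
    exact (t.map_id_right h f).trans (t.map_id_left h f).symm
  a_unit := t.unit_actHom
  a_assoc := t.mult_actHom
  a_R := by
    rintro ⟨y', z, g⟩ k d h
    obtain ⟨x, y, e, rfl⟩ := exists_TMap_inclCell d
    obtain rfl : y = y' := h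
    exact t.right_act g e
  a_L := by
    rintro ⟨x', x, f⟩ k d h
    obtain ⟨x'', y, e, rfl⟩ := exists_TMap_inclCell d
    obtain rfl : x = x'' := h
    exact t.left_act f e

theorem typedR_toWhisk (x : V) {y z : V} (g : (H y z).cells 0) :
    typedR t.toWhisk x g = t.map (t.id x) g :=
  inclCell_injective ((typedR_incl t.toWhisk x g).trans (t.incl_rightHom x g))

theorem typedL_toWhisk (z : V) {x y : V} (f : (H x y).cells 0) :
    typedL t.toWhisk z f = t.map f (t.id z) :=
  inclCell_injective ((typedL_incl t.toWhisk z f).trans (t.incl_leftHom z f))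

/-- Only this composite needs computing; the other one follows from `typed_injective`. -/
theorem typed_toWhisk : t.toWhisk.typed = t := by
  refine ext_of_ops (fun x y => ?_) (fun x => ?_) (fun {x y z} f g => ?_)
    (fun {x x' y y'} f g => ?_)
  · exact inclCell_injective ((typedAct_incl t.toWhisk x y).trans (t.incl_actHom x y))
  · exact mkCell_injective (mkCell_typedOne t.toWhisk x)
  · exact (congrArg (fun φ : (H x y).total ⟶ (H x z).total => φ.app 0 f)
      (t.typedR_toWhisk x g)).trans (t.map_id_right f g)
  · refine Eq.trans ?_ (t.map_eq f g).symm
    change typedL t.toWhisk y f ≫ typedR t.toWhisk x' g = _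
    rw [t.typedR_toWhisk, t.typedL_toWhisk]

end TypedAlg

end Sesqui

/-! ### Typed algebras are categories with a lifted hom functor. -/

namespace Sesqui

open LDiagram

variable {n : ℕ} {V : Type u} {H : V → V → Family.{u} n}

namespace TypedAlg

variable (t : TypedAlg H)

/-- The category structure. -/
@[reducible]
def category : Category.{u} V where
  Hom x y := (H x y).cells 0
  id := t.id
  comp f g := t.comp f g
  id_comp f := t.id_comp f
  comp_id f := t.comp_id f
  assoc f g h := t.assoc f g h

/-- The sesquicategory of cells between two objects. -/
noncomputable def homAlg (x y : V) : Sesq.{u} n :=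
  ⟨H x y, t.act x y, (t.isAction x y).unit_comp, (t.isAction x y).mult_comp⟩

/-- The action of a pair of morphisms as a morphism of sesquicategories. -/
noncomputable def mapAlg {x x' y y' : V} (f : (H x' x).cells 0) (g : (H y y').cells 0) :
    t.homAlg x y ⟶ t.homAlg x' y' :=
  (⟨t.map f g, t.map_act f g⟩ : Monad.Algebra.Hom (t.homAlg x y).toAlgebra
    (t.homAlg x' y').toAlgebra)

/-- The lifted hom functor. -/
noncomputable def homFunctor :
    letI := t.category
    Vᵒᵖ × V ⥤ Sesq.{u} n :=
  letI := t.category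
  { obj p := t.homAlg p.1.unop p.2
    map f := t.mapAlg f.1.unop f.2
    map_id p := Monad.Algebra.Hom.ext (t.map_id p.1.unop p.2)
    map_comp f g := Monad.Algebra.Hom.ext (t.map_comp f.1.unop g.1.unop f.2 g.2) }

/-- The morphisms of `t.category` are the 0-cells themselves, so the equality is definitional on
objects; on morphisms it is `map_zero`. -/
theorem homFunctor_lift :
    letI := t.category
    t.homFunctor ⋙ objects n = Functor.hom V := by
  let := t.category
  refine Functor.hext (fun p => rfl) fun p q f => heq_of_eq ?_
  ext h
  exact t.map_zero f.1.unop f.2 h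

/-- The category with a lifted hom functor. -/
noncomputable def toSesqCat : SesqCat.{u} n :=
  letI := t.category
  ⟨V, t.homFunctor, t.homFunctor_lift⟩

/-- The types of the compared fields depend only on `V` and `H`, which are the same on both sides,
so the heterogeneous equalities obtained from `h` are equalities. -/
theorem toSesqCat_injective {t t' : TypedAlg H} (h : t.toSesqCat = t'.toSesqCat) : t = t' := by
  have h1 : t.act = t'.act := eq_of_heq (congr_arg_heq
    (fun S : SesqCat.{u} n => fun x y : S.C => (S.hom.obj (Opposite.op x, y)).act) h)
  have h2 : t.id = t'.id := eq_of_heq (congr_arg_heq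
    (fun S : SesqCat.{u} n => fun x : S.C => 𝟙 x) h)
  have h3 : @t.comp = @t'.comp := eq_of_heq (congr_arg_heq
    (fun S : SesqCat.{u} n => fun x y z : S.C => CategoryStruct.comp (X := x) (Y := y) (Z := z)) h)
  have h4 : @t.map = @t'.map := eq_of_heq (congr_arg_heq
    (fun S : SesqCat.{u} n => fun (x x' y y' : S.C) (f : x' ⟶ x) (g : y ⟶ y') =>
      (S.hom.map (X := (Opposite.op x, y)) (Y := (Opposite.op x', y')) (Quiver.Hom.op f, g)).f) h)
  exact ext_of_ops (fun x y => congrFun (congrFun h1 x) y) (congrFun h2)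
    (fun {x y z} f g => congrFun (congrFun (congrFun (congrFun (congrFun h3 x) y) z) f) g)
    (fun {x x' y y'} f g => congrFun (congrFun (congrFun (congrFun (congrFun (congrFun
      h4 x) x') y) y') f) g)

end TypedAlg

/-- The strict lifting equation says that each hom type is the type of 0-cells of its lift. With the
category taken apart, the hom types can be eliminated by substitution, and the remaining data form a
`TypedAlg`. -/
theorem exists_toSesqCat (S : SesqCat.{u} n) :
    ∃ (V : Type u) (H : V → V → Family.{u} n) (t : TypedAlg H), t.toSesqCat = S := by
  obtain @⟨C, cat, F, lift⟩ := S
  have hH : ∀ x y : C, (x ⟶ y) = (F.obj (Opposite.op x, y)).fam.cells 0 := fun x y =>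
    (Functor.congr_obj lift (Opposite.op x, y)).symm
  obtain @⟨@⟨⟨Hom⟩, id, comp⟩, id_comp, comp_id, assoc⟩ := cat
  obtain ⟨obj, map, map_id, map_comp⟩ := F
  obtain rfl : Hom = fun x y => (obj (Opposite.op x, y)).fam.cells 0 := by
    funext x y
    exact hH x y
  let cat : Category.{u} C := @Category.mk C (@CategoryStruct.mk C
    ⟨fun x y => (obj (Opposite.op x, y)).fam.cells 0⟩ id comp) id_comp comp_id assoc
  have hm : ∀ (p q : Cᵒᵖ × C) (f : p ⟶ q), (objects n).map (map f) = (Functor.hom C).map f := by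
    intro p q f
    exact eq_of_heq (congr_arg_heq (fun G : Cᵒᵖ × C ⥤ Type u => G.map f) lift)
  refine ⟨C, fun x y => (obj (Opposite.op x, y)).fam, 
    { act x y := (obj (Opposite.op x, y)).act
      isAction x y := ⟨(obj (Opposite.op x, y)).unit, (obj (Opposite.op x, y)).assoc⟩
      id := id
      comp f g := comp f g
      id_comp f := id_comp f
      comp_id f := comp_id f
      assoc f g h := assoc f g h
      map {x x' y y'} f g := (map (X := (Opposite.op x, y)) (Y := (Opposite.op x', y'))
        (Quiver.Hom.op f, g)).f
      map_zero {x x' y y'} f g h := congrArg (fun φ : (obj (Opposite.op x, y)).fam.cells 0 ⟶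
        (obj (Opposite.op x', y')).fam.cells 0 => φ h)
          (hm (Opposite.op x, y) (Opposite.op x', y') (Quiver.Hom.op f, g))
      map_id x y := congrArg Monad.Algebra.Hom.f (map_id (Opposite.op x, y))
      map_comp {x x' x'' y y' y''} f f' g g' := congrArg Monad.Algebra.Hom.f
        (map_comp (X := (Opposite.op x, y)) (Y := (Opposite.op x', y')) (Z := (Opposite.op x'', y''))
          (Quiver.Hom.op f, g) (Quiver.Hom.op f', g'))
      map_act {x x' y y'} f g := (map (X := (Opposite.op x, y)) (Y := (Opposite.op x', y'))
        (Quiver.Hom.op f, g)).h }, ?_⟩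
  rfl

end Sesqui

/-! ### Morphisms of categories with lifted hom functors. -/

namespace Sesqui

open LDiagram

variable {n : ℕ} {V V' V'' : Type u} {H : V → V → Family.{u} n} {H' : V' → V' → Family.{u} n}
  {H'' : V'' → V'' → Family.{u} n}

namespace TypedAlg

variable {t : TypedAlg H} {t' : TypedAlg H'} {t'' : TypedAlg H''}

/-- The components of the transformation of lifted hom functors. -/
noncomputable def between (f : t.toSesqCat ⟶ t'.toSesqCat) (x y : V) :
    (H x y).total ⟶ (H' (f.F.obj x) (f.F.obj y)).total :=
  (f.trans.app (Opposite.op x, y)).f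

/-- This is the compatibility condition; its `eqToHom`s are identities definitionally. -/
theorem between_zero (f : t.toSesqCat ⟶ t'.toSesqCat) {x y : V} (w : (H x y).cells 0) :
    (between f x y).app 0 w = f.F.map w :=
  congrArg (fun φ : (H x y).cells 0 ⟶ (H' (f.F.obj x) (f.F.obj y)).cells 0 => φ w)
    (SesqCat.Hom.compat_app f (Opposite.op x, y))

theorem between_act (f : t.toSesqCat ⟶ t'.toSesqCat) (x y : V) :
    TMap (between f x y) ≫ t'.act _ _ = t.act x y ≫ between f x y :=
  (f.trans.app (Opposite.op x, y)).h

theorem between_map (f : t.toSesqCat ⟶ t'.toSesqCat) {x x' y y' : V} (a : (H x' x).cells 0)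
    (b : (H y y').cells 0) :
    t.map a b ≫ between f x' y' = between f x y ≫ t'.map (f.F.map a) (f.F.map b) :=
  congrArg Monad.Algebra.Hom.f (f.trans.naturality (X := (Opposite.op x, y))
    (Y := (Opposite.op x', y')) (Quiver.Hom.op a, b))

/-- The map of globular sets underlying a morphism of categories with lifted hom functors. -/
noncomputable def totHom (f : t.toSesqCat ⟶ t'.toSesqCat) : totalOf H ⟶ totalOf H' where
  app k := match k with
    | 0 => f.F.obj
    | _ + 1 => fun z => mkCell ((between f z.1 z.2.1).app _ z.2.2)
  app_s k z := match k with
    | 0 => rfl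
    | k + 1 => congrArg mkCell ((between f z.1 z.2.1).app_s k z.2.2)
  app_t k z := match k with
    | 0 => rfl
    | k + 1 => congrArg mkCell ((between f z.1 z.2.1).app_t k z.2.2)

theorem incl_totHom (f : t.toSesqCat ⟶ t'.toSesqCat) (x y : V) :
    inclCell H x y ≫ GlobSet.shiftMap (totHom f) = between f x y ≫ inclCell H' _ _ := rfl

/-- Compatibility with the glued actions, tested on diagrams between two objects, is compatibility
with the actions between these objects. The two implications serve the two directions of the
comparison of morphisms. -/
theorem act_comp_iff {φ : totalOf H ⟶ totalOf H'} {x y : V} {p q : V'}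
    {ψ : (H x y).total ⟶ (H' p q).total}
    (h : inclCell H x y ≫ GlobSet.shiftMap φ = ψ ≫ inclCell H' p q) :
    TMap (inclCell H x y) ≫ TMap (GlobSet.shiftMap φ) ≫ t'.actHom =
      TMap (inclCell H x y) ≫ t.actHom ≫ GlobSet.shiftMap φ ↔
    TMap ψ ≫ t'.act p q = t.act x y ≫ ψ := by
  rw [← Category.assoc, ← WhiskAlg.TMap_comp, h, WhiskAlg.TMap_comp, Category.assoc,
    t'.incl_actHom, ← Category.assoc, ← Category.assoc, t.incl_actHom, Category.assoc _ _
    (GlobSet.shiftMap φ), h, ← Category.assoc (t.act x y)]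
  exact ⟨inclCell_injective, congrArg fun χ => χ ≫ inclCell H' p q⟩

theorem totHom_isHom (f : t.toSesqCat ⟶ t'.toSesqCat) :
    t.toWhisk.IsHom t'.toWhisk (totHom f) where
  one x := congrArg mkCell ((between_zero f (t.id x)).trans (f.F.map_id x))
  R := by
    rintro ⟨y', z, g⟩ k ⟨x, y, w⟩ h
    obtain rfl : y = y' := (bt_mkCell w).symm.trans h
    have h1 := congrArg (fun φ : (H x y).total ⟶ (H' (f.F.obj x) (f.F.obj z)).total => φ.app k w)
      (between_map f (t.id x) g)
    refine (congrArg ((totHom f).app (k + 1)) (t.right_mkCell g w)).trans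
      ((congrArg mkCell h1).trans ?_)
    refine Eq.trans ?_ (t'.right_mkCell ((between f y z).app 0 g) _).symm
    rw [between_zero]
    exact congrArg (fun i => mkCell ((t'.map i (f.F.map g)).app k ((between f x y).app k w)))
      (f.F.map_id x)
  L := by
    rintro ⟨x', x, g⟩ k ⟨x'', y, w⟩ h
    obtain rfl : x = x'' := h.trans (bs_mkCell w)
    have h1 := congrArg (fun φ : (H x y).total ⟶ (H' (f.F.obj x') (f.F.obj y)).total => φ.app k w)
      (between_map f g (t.id y))
    refine (congrArg ((totHom f).app (k + 1)) (t.left_mkCell g w)).trans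
      ((congrArg mkCell h1).trans ?_)
    refine Eq.trans ?_ (t'.left_mkCell ((between f x' x).app 0 g) _).symm
    rw [between_zero]
    exact congrArg (fun i => mkCell ((t'.map (f.F.map g) i).app k ((between f x y).app k w)))
      (f.F.map_id y)
  a := by
    refine GlobSet.hom_ext fun k d => ?_
    obtain ⟨x, y, e, rfl⟩ := exists_TMap_inclCell d
    have h := (act_comp_iff (t := t) (t' := t') (incl_totHom f x y)).2 (between_act f x y)
    exact congrArg (fun φ : TObj (H x y).total ⟶ (totalOf H').shift => φ.app k e) h

theorem totHom_id : totHom (𝟙 t.toSesqCat) = 𝟙 (totalOf H) :=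
  GlobSet.hom_ext fun k _ => match k with
    | 0 => rfl
    | _ + 1 => rfl

theorem totHom_comp (f : t.toSesqCat ⟶ t'.toSesqCat) (g : t'.toSesqCat ⟶ t''.toSesqCat) :
    totHom (f ≫ g) = totHom f ≫ totHom g :=
  GlobSet.hom_ext fun k _ => match k with
    | 0 => rfl
    | _ + 1 => rfl

theorem totHom_injective {f g : t.toSesqCat ⟶ t'.toSesqCat} (h : totHom f = totHom g) : f = g := by
  have h0 : ∀ x, f.F.obj x = g.F.obj x := fun x =>
    congrArg (fun φ : totalOf H ⟶ totalOf H' => φ.app 0 x) h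
  have h1 : ∀ {k : ℕ} {x y : V} (w : (H x y).cells k),
      mkCell (H := H') ((between f x y).app k w) = mkCell ((between g x y).app k w) :=
    fun {k x y} w => congrArg (fun φ : totalOf H ⟶ totalOf H' => φ.app (k + 1) (mkCell w)) h
  have h2 : ∀ {x y : V} (w : (H x y).cells 0),
      mkCell (H := H') (f.F.map w) = mkCell (g.F.map w) := fun {x y} w => by
    rw [← between_zero, ← between_zero]
    exact h1 w
  -- The functors have to be made equal first, on objects and then on morphisms, since the type of
  -- the transformation depends on them.
  obtain ⟨F, τ, hf⟩ := f
  obtain ⟨G, σ, hg⟩ := g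
  obtain ⟨fo, fm, _, _⟩ := F
  obtain ⟨go, gm, _, _⟩ := G
  obtain rfl : fo = go := funext h0
  obtain rfl : @fm = @gm := funext fun x => funext fun y => funext fun w => mkCell_injective (h2 w)
  refine SesqCat.Hom.ext rfl (heq_of_eq (NatTrans.ext (funext fun p => ?_)))
  exact Monad.Algebra.Hom.ext (GlobSet.hom_ext fun k w => mkCell_injective (h1 w))

section OfHom

variable {φ : totalOf H ⟶ totalOf H'}

theorem exists_between (φ : totalOf H ⟶ totalOf H') (x y : V) :
    ∃ ψ : (H x y).total ⟶ (H' (φ.app 0 x) (φ.app 0 y)).total,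
      ψ ≫ inclCell H' _ _ = inclCell H x y ≫ GlobSet.shiftMap φ :=
  exists_lift _ fun k w =>
    ⟨(φ.app_bs k (mkCell w)).symm.trans (congrArg (φ.app 0) (bs_mkCell w)),
      (φ.app_bt k (mkCell w)).symm.trans (congrArg (φ.app 0) (bt_mkCell w))⟩

/-- The restriction of a map of globular sets to the cells between two objects. -/
noncomputable def restrict (φ : totalOf H ⟶ totalOf H') (x y : V) :
    (H x y).total ⟶ (H' (φ.app 0 x) (φ.app 0 y)).total := (exists_between φ x y).choose

theorem restrict_incl (φ : totalOf H ⟶ totalOf H') (x y : V) :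
    restrict φ x y ≫ inclCell H' _ _ = inclCell H x y ≫ GlobSet.shiftMap φ :=
  (exists_between φ x y).choose_spec

theorem mkCell_restrict (φ : totalOf H ⟶ totalOf H') {k : ℕ} {x y : V} (w : (H x y).cells k) :
    mkCell (H := H') ((restrict φ x y).app k w) = φ.app (k + 1) (mkCell w) :=
  congrArg (fun ψ : (H x y).total ⟶ (totalOf H').shift => ψ.app k w) (restrict_incl φ x y)

theorem restrict_id (h : t.toWhisk.IsHom t'.toWhisk φ) (x : V) :
    (restrict φ x x).app 0 (t.id x) = t'.id (φ.app 0 x) :=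
  mkCell_injective ((mkCell_restrict φ _).trans (h.one x))

theorem restrict_right (h : t.toWhisk.IsHom t'.toWhisk φ) {x y z : V} (g : (H y z).cells 0) :
    t.map (t.id x) g ≫ restrict φ x z =
      restrict φ x y ≫ t'.map (t'.id _) ((restrict φ y z).app 0 g) := by
  refine inclCell_injective (GlobSet.hom_ext fun k w => ?_)
  refine (mkCell_restrict φ _).trans ?_
  refine (congrArg (φ.app (k + 1)) (t.right_mkCell g w).symm).trans ?_
  refine (h.R (mkCell g) k (mkCell w) (bt_mkCell w)).trans ?_
  exact (congrArg₂ (fun a b => t'.right a k b) (mkCell_restrict φ g).symm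
    (mkCell_restrict φ w).symm).trans (t'.right_mkCell _ _)

theorem restrict_left (h : t.toWhisk.IsHom t'.toWhisk φ) {x y z : V} (f : (H x y).cells 0) :
    t.map f (t.id z) ≫ restrict φ x z =
      restrict φ y z ≫ t'.map ((restrict φ x y).app 0 f) (t'.id _) := by
  refine inclCell_injective (GlobSet.hom_ext fun k w => ?_)
  refine (mkCell_restrict φ _).trans ?_
  refine (congrArg (φ.app (k + 1)) (t.left_mkCell f w).symm).trans ?_
  refine (h.L (mkCell f) k (mkCell w) (bs_mkCell w).symm).trans ?_
  exact (congrArg₂ (fun a b => t'.left a k b) (mkCell_restrict φ f).symm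
    (mkCell_restrict φ w).symm).trans (t'.left_mkCell _ _)

/-- `map_eq` splits the two-sided action into a left and a right one, which `φ` preserves
separately. -/
theorem restrict_map (h : t.toWhisk.IsHom t'.toWhisk φ) {x x' y y' : V} (f : (H x' x).cells 0)
    (g : (H y y').cells 0) :
    t.map f g ≫ restrict φ x' y' =
      restrict φ x y ≫ t'.map ((restrict φ x' x).app 0 f) ((restrict φ y y').app 0 g) := by
  rw [t.map_eq, Category.assoc, restrict_right h, ← Category.assoc, restrict_left h,
    Category.assoc]
  exact congrArg (fun ψ => restrict φ x y ≫ ψ) (t'.map_eq _ _).symm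

theorem restrict_comp (h : t.toWhisk.IsHom t'.toWhisk φ) {x y z : V} (f : (H x y).cells 0)
    (g : (H y z).cells 0) :
    (restrict φ x z).app 0 (t.comp f g) =
      t'.comp ((restrict φ x y).app 0 f) ((restrict φ y z).app 0 g) := by
  refine (congrArg ((restrict φ x z).app 0) (t.map_id_right f g).symm).trans
    (Eq.trans ?_ (t'.map_id_right _ _))
  exact congrArg (fun ψ : (H x y).total ⟶ (H' (φ.app 0 x) (φ.app 0 z)).total => ψ.app 0 f)
    (restrict_right h g)

theorem restrict_act (h : t.toWhisk.IsHom t'.toWhisk φ) (x y : V) :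
    TMap (restrict φ x y) ≫ t'.act _ _ = t.act x y ≫ restrict φ x y :=
  (act_comp_iff (restrict_incl φ x y).symm).1
    (congrArg (fun ψ => TMap (inclCell H x y) ≫ ψ) h.a)

/-- The functor underlying a map which preserves the operations. -/
noncomputable def functorOf (h : t.toWhisk.IsHom t'.toWhisk φ) :
    t.toSesqCat.C ⥤ t'.toSesqCat.C where
  obj := φ.app 0
  map {x y} f := (restrict φ x y).app 0 f
  map_id x := restrict_id h x
  map_comp f g := restrict_comp h f g

/-- The transformation of lifted hom functors given by a map which preserves the operations. -/
noncomputable def transOf (h : t.toWhisk.IsHom t'.toWhisk φ) :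
    t.toSesqCat.hom ⟶ (functorOf h).op.prod (functorOf h) ⋙ t'.toSesqCat.hom where
  app p := (⟨restrict φ p.1.unop p.2, restrict_act h p.1.unop p.2⟩ : Monad.Algebra.Hom
    (t.homAlg p.1.unop p.2).toAlgebra (t'.homAlg (φ.app 0 p.1.unop) (φ.app 0 p.2)).toAlgebra)
  naturality _ _ f := Monad.Algebra.Hom.ext (restrict_map h f.1.unop f.2)

/-- A map which preserves the operations as a morphism of categories with lifted hom functors. -/
noncomputable def homOf (h : t.toWhisk.IsHom t'.toWhisk φ) : t.toSesqCat ⟶ t'.toSesqCat :=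
  SesqCat.Hom.mk (functorOf h) (transOf h) (by
    apply NatTrans.ext
    funext p
    rw [NatTrans.comp_app, NatTrans.comp_app, eqToHom_app, eqToHom_app]
    rfl)

theorem totHom_homOf (h : t.toWhisk.IsHom t'.toWhisk φ) : totHom (homOf h) = φ :=
  GlobSet.hom_ext fun k z => match k with
    | 0 => rfl
    | _ + 1 => mkCell_restrict φ z.2.2

end OfHom

end TypedAlg

/-! ### A criterion for isomorphism of categories. -/

/-- Categories are isomorphic if their objects and morphisms correspond bijectively. -/
theorem nonempty_iso_of_bijective {A B : Type w} [Category.{u} A] [Category.{u} B] (o : A → B)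
    (ho : Function.Bijective o) (m : ∀ {X Y : A}, (o X ⟶ o Y) → (X ⟶ Y))
    (hm : ∀ X Y : A, Function.Bijective (m : (o X ⟶ o Y) → (X ⟶ Y)))
    (m_id : ∀ X : A, m (𝟙 (o X)) = 𝟙 X)
    (m_comp : ∀ {X Y Z : A} (f : o X ⟶ o Y) (g : o Y ⟶ o Z), m (f ≫ g) = m f ≫ m g) :
    Nonempty (Cat.of A ≅ Cat.of B) := by
  -- The map `m` on morphisms points against `o`; its inverse `l` becomes the action of the functor
  -- `F`.
  choose l hl using fun X Y => (hm X Y).2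
  have lm : ∀ {X Y : A} (f : o X ⟶ o Y), l X Y (m f) = f := fun f => (hm _ _).1 (hl _ _ _)
  let e := Equiv.ofBijective o ho
  have he : ∀ Y, o (e.symm Y) = Y := e.apply_symm_apply
  have m_eq : ∀ {X Y : A} (h : o X = o Y), m (eqToHom h) = eqToHom (ho.1 h) := fun {X Y} h => by
    obtain rfl := ho.1 h
    exact m_id X
  have ml : ∀ {X' X Y Y' : A} (f : X ⟶ Y) (h : o X' = o X) (h' : o Y = o Y'),
      m (eqToHom h ≫ l X Y f ≫ eqToHom h') = eqToHom (ho.1 h) ≫ f ≫ eqToHom (ho.1 h') :=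
    fun f h h' => by rw [m_comp, m_comp, hl, m_eq, m_eq]
  let F : A ⥤ B :=
    { obj := o
      map f := l _ _ f
      map_id X := (hm _ _).1 (by rw [hl, m_id])
      map_comp f g := (hm _ _).1 (by rw [hl, m_comp, hl, hl]) }
  let G : B ⥤ A :=
    { obj := e.symm
      -- `o (e.symm X) = X` holds only propositionally, so `g` is conjugated by `eqToHom` before `m`
      -- applies.
      map {X Y} g := m (eqToHom (he X) ≫ g ≫ eqToHom (he Y).symm)
      map_id X := by simp [m_id]
      map_comp f g := by simp [← m_comp] }
  exact ⟨⟨F.toCatHom, G.toCatHom, congrArg Functor.toCatHom (CategoryTheory.Functor.ext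
    (fun X => e.symm_apply_apply X) fun X Y f => ml f _ _), congrArg Functor.toCatHom (CategoryTheory.Functor.ext he fun X Y g => lm _)⟩⟩

end Sesqui

/-! ### The isomorphism between (n+1)-sesquicategories and categories with lifted hom. -/

namespace Sesqui

open LDiagram

variable {n : ℕ}

namespace Sesq

theorem isAction (S : Sesq.{u} n) : IsAction S.act := ⟨S.unit, S.assoc⟩

/-- The whiskering operations of a sesquicategory. -/
noncomputable def whiskAlg (S : Sesq.{u} (n + 1)) : WhiskAlg (totalOf S.fam.2) :=
  S.isAction.whiskAlg

/-- The category structure of a sesquicategory and its action on the cells between objects. -/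
noncomputable def typedAlg (S : Sesq.{u} (n + 1)) : TypedAlg S.fam.2 := S.whiskAlg.typed

/-- Both sides have the same typed algebra, by `typed_toWhisk`. -/
theorem toWhisk_typedAlg (S : Sesq.{u} (n + 1)) : S.typedAlg.toWhisk = S.whiskAlg :=
  WhiskAlg.typed_injective (TypedAlg.typed_toWhisk _)

/-- The category with lifted hom functor of a sesquicategory. -/
noncomputable def toSesqCat (S : Sesq.{u} (n + 1)) : SesqCat.{u} n := S.typedAlg.toSesqCat

theorem toSesqCat_injective : Function.Injective (toSesqCat.{u} (n := n)) := by
  intro S S' h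
  -- The objects and the families underlying the lifted homs are literally the family of `S`; here
  -- the presentation by families gives strictness.
  have h1 : (⟨S.fam.1, S.fam.2⟩ : Σ V : Type u, V → V → Family.{u} n) = ⟨S'.fam.1, S'.fam.2⟩ :=
    congrArg (fun C : SesqCat.{u} n => (⟨C.C, fun x y => (C.hom.obj (Opposite.op x, y)).fam⟩ :
      Σ V : Type u, V → V → Family.{u} n)) h
  obtain ⟨fam, act, unit, assoc⟩ := S
  obtain ⟨fam', act', unit', assoc'⟩ := S'
  obtain rfl : fam = fam' := h1
  have h2 : whiskAlg ⟨fam, act, unit, assoc⟩ = whiskAlg ⟨fam, act', unit', assoc'⟩ :=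
    WhiskAlg.typed_injective (TypedAlg.toSesqCat_injective h)
  obtain rfl : act = act' := (IsAction.act_whiskAlg ⟨unit, assoc⟩).symm.trans
    ((congrArg WhiskAlg.act h2).trans (IsAction.act_whiskAlg ⟨unit', assoc'⟩))
  rfl

theorem toSesqCat_surjective : Function.Surjective (toSesqCat.{u} (n := n)) := by
  intro C
  obtain ⟨V, H, t, rfl⟩ := exists_toSesqCat C
  refine ⟨⟨⟨V, H⟩, t.toWhisk.act, t.toWhisk.isAction.unit_comp, t.toWhisk.isAction.mult_comp⟩,
    congrArg TypedAlg.toSesqCat ?_⟩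
  exact (congrArg WhiskAlg.typed t.toWhisk.whiskAlg_isAction).trans t.typed_toWhisk

/-- Connects morphisms of `SesqCat`, which correspond to `IsHom` maps, with algebra morphisms. -/
theorem isHom_iff {S S' : Sesq.{u} (n + 1)} {φ : totalOf S.fam.2 ⟶ totalOf S'.fam.2} :
    S.typedAlg.toWhisk.IsHom S'.typedAlg.toWhisk φ ↔ TMap φ ≫ S'.act = S.act ≫ φ := by
  rw [toWhisk_typedAlg, toWhisk_typedAlg]
  exact ⟨fun h => S.isAction.comp_of_isHom S'.isAction h,
    fun h => S.isAction.isHom_of_comp S'.isAction h⟩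

/-- The morphism of sesquicategories given by a morphism of categories with lifted hom functors. -/
noncomputable def ofHom {S S' : Sesq.{u} (n + 1)} (f : S.toSesqCat ⟶ S'.toSesqCat) : S ⟶ S' :=
  (⟨TypedAlg.totHom f, isHom_iff.1 (TypedAlg.totHom_isHom f)⟩ :
    Monad.Algebra.Hom S.toAlgebra S'.toAlgebra)

theorem ofHom_bijective (S S' : Sesq.{u} (n + 1)) :
    Function.Bijective (ofHom : (S.toSesqCat ⟶ S'.toSesqCat) → (S ⟶ S')) :=
  ⟨fun _ _ h => TypedAlg.totHom_injective (congrArg Monad.Algebra.Hom.f h), fun g =>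
    ⟨TypedAlg.homOf (isHom_iff.2 g.h),
      Monad.Algebra.Hom.ext (TypedAlg.totHom_homOf (isHom_iff.2 g.h))⟩⟩

end Sesq

theorem nonempty_sesq_iso_sesqCat (n : ℕ) :
    Nonempty (Cat.of (Sesq.{u} (n + 1)) ≅ Cat.of (SesqCat.{u} n)) :=
  nonempty_iso_of_bijective Sesq.toSesqCat
    ⟨Sesq.toSesqCat_injective, Sesq.toSesqCat_surjective⟩ Sesq.ofHom Sesq.ofHom_bijective
    (fun _ => Monad.Algebra.Hom.ext TypedAlg.totHom_id)
    (fun f g => Monad.Algebra.Hom.ext (TypedAlg.totHom_comp f g))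

end Sesqui

/-! ### Dimension 0: sets, and ordinary categories. -/

namespace Sesqui

open LDiagram

/-- The globular set of dimension `0` with a given set of cells. -/
abbrev discreteGlob (A : Type u) : GlobSet.{u} 0 := Family.total (n := 0) A

/-- Maps into a globular set of dimension `0` agree if they agree in dimension `0`. -/
theorem GlobSet.hom_ext_zero {X Y : GlobSet.{u} 0} {f g : X ⟶ Y}
    (h : ∀ x, f.app 0 x = g.app 0 x) : f = g :=
  GlobSet.hom_ext fun k x => match k with
    | 0 => h x
    | k + 1 => ((X.isEmpty (k + 1) k.succ_pos).false x).elim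

/-- Functions as maps of globular sets of dimension `0`. -/
def GlobSet.homOfZero {X Y : GlobSet.{u} 0} (f : X.cells 0 → Y.cells 0) : X ⟶ Y where
  app k := match k with
    | 0 => f
    | k + 1 => fun x => ((X.isEmpty (k + 1) k.succ_pos).false x).elim
  app_s k x := ((X.isEmpty (k + 1) k.succ_pos).false x).elim
  app_t k x := ((X.isEmpty (k + 1) k.succ_pos).false x).elim

theorem eq_unit_zero {X : GlobSet.{u} 0} (d : (TObj X).cells 0) :
    d = (TUnit X).app 0 (base d.1) := Subtype.ext (eq_unit d.1)

namespace Sesq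

/-- Sets as `0`-sesquicategories. -/
noncomputable def discrete : Type u ⥤ Sesq.{u} 0 where
  obj A :=
    { fam := A
      act := GlobSet.homOfZero (X := TObj (discreteGlob A)) (Y := discreteGlob A) fun d => base d.1
      unit := GlobSet.hom_ext_zero fun x => (discreteGlob A).iterS_self x
      assoc := GlobSet.hom_ext_zero fun d => by
        obtain ⟨c, rfl⟩ : ∃ c, (TUnit (TObj (discreteGlob A))).app 0 c = d :=
          ⟨_, (eq_unit_zero d).symm⟩
        have h := congrArg (fun φ : TObj (discreteGlob A) ⟶ TObj (discreteGlob A) => φ.app 0 c)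
          ((T 0).left_unit (discreteGlob A))
        refine (congrArg (fun e : (TObj (discreteGlob A)).cells 0 => base e.1) h).trans ?_
        exact congrArg (fun e : (TObj (discreteGlob A)).cells 0 => base e.1)
          ((TObj (discreteGlob A)).iterS_self c).symm }
  map {A B} f := (⟨GlobSet.homOfZero (X := discreteGlob A) (Y := discreteGlob B) f,
    GlobSet.hom_ext_zero fun _ => rfl⟩ : Monad.Algebra.Hom _ _)
  map_id A := Monad.Algebra.Hom.ext (GlobSet.hom_ext_zero fun _ => rfl)
  map_comp f g := Monad.Algebra.Hom.ext (GlobSet.hom_ext_zero fun _ => rfl)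

/-- A family of dimension 0 is a type, and every 0-diagram is a unit, so the unit law determines the
action. -/
theorem exists_discrete (S : Sesq.{u} 0) : ∃ A, discrete.obj A = S := by
  obtain ⟨A, act, unit, assoc⟩ := S
  obtain rfl : GlobSet.homOfZero (X := TObj (discreteGlob A)) (Y := discreteGlob A)
      (fun d => base d.1) = act := GlobSet.hom_ext_zero fun d => by
    rw [eq_unit_zero d]
    refine ((discreteGlob A).iterS_self _).trans ?_
    exact (congrArg (fun φ : discreteGlob A ⟶ discreteGlob A => φ.app 0 (base d.1)) unit).symm
  exact ⟨A, rfl⟩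

theorem hom_ext_zero {S S' : Sesq.{u} 0} {f g : S ⟶ S'}
    (h : (objects 0).map f = (objects 0).map g) : f = g :=
  Monad.Algebra.Hom.ext (GlobSet.hom_ext_zero fun x =>
    congrArg (fun φ : S.fam.total.cells 0 ⟶ S'.fam.total.cells 0 => φ x) h)

theorem objects_comp_discrete : objects.{u} 0 ⋙ discrete = 𝟭 (Sesq.{u} 0) := by
  refine Functor.hext (fun S => ?_) (fun S S' f => ?_)
  · obtain ⟨A, rfl⟩ := exists_discrete S
    rfl
  · obtain ⟨A, rfl⟩ := exists_discrete S
    obtain ⟨A', rfl⟩ := exists_discrete S'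
    exact heq_of_eq (hom_ext_zero rfl)

end Sesq

namespace SesqCat

/-- A category with its unique lifted hom functor to `0`-sesquicategories. -/
noncomputable def ofCat (C : Cat.{u, u}) : SesqCat.{u} 0 where
  C := C
  hom := Functor.hom C ⋙ Sesq.discrete
  lift := rfl

/-- Since `objects 0` has `discrete` as a strict inverse, the equation `lift` determines `hom`. -/
theorem ofCat_bijective : Function.Bijective ofCat.{u} := by
  refine ⟨fun C C' h => congrArg (fun S : SesqCat.{u} 0 => Cat.of S.C) h, fun S => ?_⟩
  obtain ⟨C, hom, lift⟩ := S
  refine ⟨Cat.of C, ?_⟩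
  obtain rfl : Functor.hom C ⋙ Sesq.discrete = hom := by
    rw [← lift, Functor.assoc, Sesq.objects_comp_discrete]
    rfl
  rfl

/-- The functor underlying a morphism. -/
def Hom.toCatHom {C C' : Cat.{u, u}} (f : ofCat C ⟶ ofCat C') : C ⟶ C' :=
  Functor.toCatHom (C := C) (D := C') f.F

/-- A morphism in `Sesq 0` is determined by its effect on 0-cells, so the compatibility condition
fixes the transformation once the functor is known. -/
theorem Hom.toCatHom_bijective (C C' : Cat.{u, u}) :
    Function.Bijective (Hom.toCatHom : (ofCat C ⟶ ofCat C') → (C ⟶ C')) := by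
  constructor
  · intro f g h
    have h1 : f.F = g.F := congrArg Cat.Hom.toFunctor h
    have h2 := f.compat_app
    have h3 := g.compat_app
    obtain ⟨F, τ, hf⟩ := f
    obtain ⟨G, σ, hg⟩ := g
    obtain rfl : F = G := h1
    refine SesqCat.Hom.ext rfl (heq_of_eq (NatTrans.ext (funext fun p => ?_)))
    exact Sesq.hom_ext_zero ((h2 p).trans (h3 p).symm)
  · intro G
    let F : (ofCat C).C ⥤ (ofCat C').C := G.toFunctor
    exact ⟨SesqCat.Hom.mk F (Functor.whiskerRight (homMap F) Sesq.discrete) rfl, rfl⟩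

end SesqCat

theorem nonempty_sesqCat_zero_iso_cat :
    Nonempty (Cat.of (SesqCat.{u} 0) ≅ Cat.of Cat.{u, u}) :=
  (nonempty_iso_of_bijective SesqCat.ofCat SesqCat.ofCat_bijective SesqCat.Hom.toCatHom
    SesqCat.Hom.toCatHom_bijective (fun _ => rfl) (fun _ _ => rfl)).map Iso.symm

end Sesqui

theorem mainTheorem2 :
    Nonempty (CategoryTheory.Cat.of (Sesqui.Sesq.{u} 1) ≅
      CategoryTheory.Cat.of CategoryTheory.Cat.{u, u}) ∧
    ∀ n : ℕ, Nonempty (CategoryTheory.Cat.of (Sesqui.Sesq.{u} (n + 1)) ≅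
      CategoryTheory.Cat.of (Sesqui.SesqCat.{u} n)) := by
  refine ⟨?_, Sesqui.nonempty_sesq_iso_sesqCat⟩
  -- The first claim is the case `n = 0` of the second one, followed by the identification of
  -- `SesqCat 0` with Cat.
  obtain ⟨e⟩ := Sesqui.nonempty_sesq_iso_sesqCat.{u} 0
  obtain ⟨e'⟩ := Sesqui.nonempty_sesqCat_zero_iso_cat.{u}
  exact ⟨e ≪≫ e'⟩
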